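/- Let $\mathcal{H}=\{p\in\mathbb{P}^n : p_0p_1\cdots p_n\,(p_0+\cdots+p_n)=0\}$ be the arrangement of $n+2$ distinguished hyperplanes in complex projective space $\mathbb{P}^n=\mathbb{P}^n_p$, and let $X\subseteq\mathbb{P}^n_p$ be a closed irreducible subvariety of dimension $d$ that is not contained in $\mathcal{H}$. Let $X_{\rm reg}$ be its set of nonsingular points. For data $u=(u_0:\cdots:u_n)\in\mathbb{P}^n_u$ put $u_+=\sum_i u_i$, $p_+=\sum_i p_i$; the likelihood function $\ell_u=\prod_i p_i^{u_i}/p_+^{u_+}$ has the logarithmic differential $$\mathrm{dlog}(\ell_u)(p)=\Big(\frac{u_0}{p_0}-\frac{u_+}{p_+},\ldots,\frac{u_n}{p_n}-\frac{u_+}{p_+}\Big).$$ A point $p\in X_{\rm reg}\setminus\mathcal{H}$ is a critical point of $\ell_u$ on $X$ if this covector vanishes on the tangent space of $X$ at $p$. The likelihood correspondence $\mathcal{L}_X\subseteq\mathbb{P}^n_p\times\mathbb{P}^n_u$ is the Zariski closure of $$\{(p,u) : p\in X_{\rm reg}\setminus\mathcal{H}\text{ is a critical point of }\ell_u\text{ on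 }X\},$$ and the ML degree of $X$ is the number of critical points of $\ell_u$ on $X$ for all $u$ in some nonempty Zariski open subset of $\mathbb{P}^n_u$. Then: 1. $\mathcal{L}_X$ is an irreducible variety of dimension $n$. 2. The projection $\mathrm{pr}_1:\mathcal{L}_X\to\mathbb{P}^n_p$ is a projective bundle over $X_{\rm reg}\setminus\mathcal{H}$, i.e. its restriction over this set is the projectivization of an algebraic vector bundle; its fibres are projective spaces $\mathbb{P}^{n-d}$. 3. The projection $\mathrm{pr}_2:\mathcal{L}_X\to\mathbb{P}^n_u$ is generically finite-to-one: there is a nonempty Zariski open subset of $\mathbb{P}^n_u$ over all points of which the fibre of $\mathrm{pr}_2$ is finite (possibly empty). 4. The ML degree of $X$ is well defined and equals the degree of $\mathrm{pr}_2:\mathcal{L}_X\to\mathbb{P}^n_u$, that is, the degree $[\mathbb{C}(\mathcal{L}_X):\mathbb{C}(\mathbb{P}^n_u)]$ of the extension of function fields if $\mathrm{pr}_2$ is dominant, and $0$ if $\mathrm{pr}_2$ is not dominant. -/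

import Mathlib

open scoped LinearAlgebra.Projectivization

noncomputable section

namespace LikelihoodGeometry

/-! ### Spaces with homogeneous coordinates and the Zariski topology -/

/-- A set of points carrying homogeneous coordinates: every point has a chosen coordinate vector
`coord y`, and the coordinate functions carry degrees in a monoid. For `ℙⁿ` the degrees are in `ℕ`
(ordinary grading), for `ℙᵃ × ℙᵇ` they are in `ℕ × ℕ` (bigrading). The notions below only use
vanishing of homogeneous polynomials and values of quotients of homogeneous polynomials of equal
degree, which do not depend on the choice of the coordinate vector of a point. -/
class HomogCoords (Y : Type) where
  idx : Type
  deg : Type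
  [addCommMonoid : AddCommMonoid deg]
  wt : idx → deg
  coord : Y → idx → ℂ

attribute [instance, reducible] HomogCoords.addCommMonoid

/-- Complex projective space `ℙⁿ`. -/
abbrev PSpace (n : ℕ) : Type := ℙ ℂ (Fin (n + 1) → ℂ)

instance (n : ℕ) : HomogCoords (PSpace n) where
  idx := Fin (n + 1)
  deg := ℕ
  wt := fun _ => 1
  coord := fun p => p.rep

/-- The product of two spaces with homogeneous coordinates, as an algebraic product (a structure
of its own, because it carries the Zariski topology and not the product topology). -/
@[ext]
structure VProd (Y Z : Type) : Type where
  fst : Y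
  snd : Z

instance (Y Z : Type) [HomogCoords Y] [HomogCoords Z] : HomogCoords (VProd Y Z) where
  idx := HomogCoords.idx Y ⊕ HomogCoords.idx Z
  deg := HomogCoords.deg Y × HomogCoords.deg Z
  wt := Sum.elim (fun i => (HomogCoords.wt i, 0)) (fun j => (0, HomogCoords.wt j))
  coord := fun y => Sum.elim (HomogCoords.coord y.fst) (HomogCoords.coord y.snd)

section Zariski

variable {Y : Type} [HomogCoords Y]

/-- (Multi)homogeneous polynomials of degree `m` in the homogeneous coordinates of `Y`. -/
def IsHomog (F : MvPolynomial (HomogCoords.idx Y) ℂ) (m : HomogCoords.deg Y) : Prop :=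
  MvPolynomial.IsWeightedHomogeneous (HomogCoords.wt (Y := Y)) F m

/-- The value of a polynomial at (the coordinate vector of) a point. -/
def evalAt (F : MvPolynomial (HomogCoords.idx Y) ℂ) (y : Y) : ℂ :=
  MvPolynomial.eval (HomogCoords.coord y) F

/-- The common zero locus of a set of polynomials. -/
def zeroLocus (S : Set (MvPolynomial (HomogCoords.idx Y) ℂ)) : Set Y :=
  {y | ∀ F ∈ S, evalAt F y = 0}

variable (Y) in
/-- The Zariski topology: the closed sets are the common zero loci of sets of (multi)homogeneous
polynomials. -/
instance zariski : TopologicalSpace Y :=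
  TopologicalSpace.ofClosed
    {Z | ∃ S : Set (MvPolynomial (HomogCoords.idx Y) ℂ),
      (∀ F ∈ S, ∃ m, IsHomog (Y := Y) F m) ∧ Z = zeroLocus S}
    (by
      refine ⟨{1}, ?_, ?_⟩
      · rintro F rfl
        exact ⟨0, MvPolynomial.isWeightedHomogeneous_one _ _⟩
      · ext y
        simp [zeroLocus, evalAt])
    (by
      intro A hA
      have hA' : ∀ Z : Set Y, ∃ S : Set (MvPolynomial (HomogCoords.idx Y) ℂ), Z ∈ A →
          (∀ F ∈ S, ∃ m, IsHomog (Y := Y) F m) ∧ Z = zeroLocus S := by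
        intro Z
        by_cases h : Z ∈ A
        · obtain ⟨S, hS⟩ := hA h
          exact ⟨S, fun _ => hS⟩
        · exact ⟨∅, fun h' => absurd h' h⟩
      choose S hS using hA'
      refine ⟨⋃ Z ∈ A, S Z, ?_, ?_⟩
      · intro F hF
        simp only [Set.mem_iUnion] at hF
        obtain ⟨Z, hZA, hF⟩ := hF
        exact (hS Z hZA).1 F hF
      · ext y
        simp only [Set.mem_sInter, zeroLocus, Set.mem_iUnion, Set.mem_ofPred_eq]
        constructor
        · rintro h F ⟨Z, hZA, hF⟩
          have := h Z hZA
          rw [(hS Z hZA).2] at this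
          exact this F hF
        · intro h Z hZA
          rw [(hS Z hZA).2]
          exact fun F hF => h F ⟨Z, hZA, hF⟩)
    (by
      rintro A ⟨S, hS, rfl⟩ B ⟨T, hT, rfl⟩
      refine ⟨{P | ∃ F ∈ S, ∃ G ∈ T, P = F * G}, ?_, ?_⟩
      · rintro P ⟨F, hF, G, hG, rfl⟩
        obtain ⟨k, hk⟩ := hS F hF
        obtain ⟨l, hl⟩ := hT G hG
        exact ⟨k + l, MvPolynomial.IsWeightedHomogeneous.mul hk hl⟩
      · ext y
        simp only [zeroLocus, evalAt, Set.mem_union, Set.mem_ofPred_eq]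
        constructor
        · rintro (h | h) P ⟨F, hF, G, hG, rfl⟩
          · rw [map_mul, h F hF, zero_mul]
          · rw [map_mul, h G hG, mul_zero]
        · intro h
          by_contra! hcon
          obtain ⟨⟨F, hF, hF0⟩, ⟨G, hG, hG0⟩⟩ := hcon
          have := h (F * G) ⟨F, hF, G, hG, rfl⟩
          rw [map_mul] at this
          exact (mul_ne_zero hF0 hG0) this)

/-! ### Regular functions, morphisms, projective bundles -/

/-- `f` is a regular function on the subset `W` (in the applications locally closed): locally on
`W` it is a quotient of two homogeneous polynomials of the same degree. -/
def RegularOn (W : Set Y) (f : Y → ℂ) : Prop :=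
  ∀ y ∈ W, ∃ U : Set Y, IsOpen U ∧ y ∈ U ∧
    ∃ (m : HomogCoords.deg Y) (F G : MvPolynomial (HomogCoords.idx Y) ℂ),
      IsHomog (Y := Y) F m ∧ IsHomog (Y := Y) G m ∧
        ∀ z ∈ W ∩ U, evalAt G z ≠ 0 ∧ f z = evalAt F z / evalAt G z

theorem RegularOn.mono {W W' : Set Y} {f : Y → ℂ} (h : RegularOn W f) (hW : W' ⊆ W) :
    RegularOn W' f := by
  intro y hy
  obtain ⟨U, hU, hyU, m, F, G, hF, hG, H⟩ := h y (hW hy)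
  exact ⟨U, hU, hyU, m, F, G, hF, hG, fun z hz => H z ⟨hW hz.1, hz.2⟩⟩

theorem RegularOn.const (W : Set Y) (c : ℂ) : RegularOn W (fun _ => c) := by
  intro y _
  refine ⟨Set.univ, isOpen_univ, trivial, 0, MvPolynomial.C c, 1,
    MvPolynomial.isWeightedHomogeneous_C _ _, MvPolynomial.isWeightedHomogeneous_one _ _, ?_⟩
  intro z _
  simp [evalAt]

theorem RegularOn.add {W : Set Y} {f g : Y → ℂ} (hf : RegularOn W f) (hg : RegularOn W g) :
    RegularOn W (f + g) := by
  intro y hy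
  obtain ⟨U, hU, hyU, k, F, G, hF, hG, H⟩ := hf y hy
  obtain ⟨U', hU', hyU', l, F', G', hF', hG', H'⟩ := hg y hy
  refine ⟨U ∩ U', hU.inter hU', ⟨hyU, hyU'⟩, k + l, F * G' + G * F', G * G',
    (MvPolynomial.IsWeightedHomogeneous.mul hF hG').add
      (MvPolynomial.IsWeightedHomogeneous.mul hG hF'),
    MvPolynomial.IsWeightedHomogeneous.mul hG hG', ?_⟩
  rintro z ⟨hzW, hzU, hzU'⟩
  obtain ⟨h1, h2⟩ := H z ⟨hzW, hzU⟩
  obtain ⟨h1', h2'⟩ := H' z ⟨hzW, hzU'⟩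
  simp only [evalAt, map_mul, map_add, Pi.add_apply] at *
  refine ⟨mul_ne_zero h1 h1', ?_⟩
  rw [h2, h2', div_add_div _ _ h1 h1']

theorem RegularOn.mul {W : Set Y} {f g : Y → ℂ} (hf : RegularOn W f) (hg : RegularOn W g) :
    RegularOn W (f * g) := by
  intro y hy
  obtain ⟨U, hU, hyU, k, F, G, hF, hG, H⟩ := hf y hy
  obtain ⟨U', hU', hyU', l, F', G', hF', hG', H'⟩ := hg y hy
  refine ⟨U ∩ U', hU.inter hU', ⟨hyU, hyU'⟩, k + l, F * F', G * G',
    MvPolynomial.IsWeightedHomogeneous.mul hF hF',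
    MvPolynomial.IsWeightedHomogeneous.mul hG hG', ?_⟩
  rintro z ⟨hzW, hzU, hzU'⟩
  obtain ⟨h1, h2⟩ := H z ⟨hzW, hzU⟩
  obtain ⟨h1', h2'⟩ := H' z ⟨hzW, hzU'⟩
  simp only [evalAt, map_mul, Pi.mul_apply] at *
  refine ⟨mul_ne_zero h1 h1', ?_⟩
  rw [h2, h2', div_mul_div_comm]

theorem RegularOn.neg {W : Set Y} {f : Y → ℂ} (hf : RegularOn W f) : RegularOn W (-f) := by
  have h := (RegularOn.const W (-1)).mul hf
  have e : (fun _ => (-1 : ℂ)) * f = -f := by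
    funext y
    simp
  rwa [e] at h

/-- `φ` restricts to a morphism of varieties `W → W'`: it is continuous and pulls regular
functions on open subsets back to regular functions. -/
structure IsMorphismOn {Y' : Type} [HomogCoords Y'] (W : Set Y) (W' : Set Y') (φ : Y → Y') :
    Prop where
  mapsTo : Set.MapsTo φ W W'
  continuousOn : ContinuousOn φ W
  regular : ∀ (U' : Set Y') (f : Y' → ℂ), IsOpen U' → RegularOn (W' ∩ U') f →
    RegularOn (W ∩ φ ⁻¹' U') (f ∘ φ)

/-- `φ` restricts to an isomorphism of varieties `W → W'`. -/
def IsIsoOn {Y' : Type} [HomogCoords Y'] (W : Set Y) (W' : Set Y') (φ : Y → Y') : Prop :=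
  IsMorphismOn W W' φ ∧ ∃ ψ : Y' → Y, IsMorphismOn W' W ψ ∧ Set.InvOn ψ φ W W'

/-- `π : E → B` is a projective bundle with fibre `ℙʳ`, i.e. the projectivization of an algebraic
vector bundle of rank `r + 1` on `B`: over the members of an open cover `U i` of `B` there are
isomorphisms `φ i : E|_{U i} ≅ (B ∩ U i) × ℙʳ` over `B`, and on overlaps they differ by invertible
matrices `A i j` of regular functions which satisfy the cocycle condition. -/
def IsProjectiveBundle {Y' : Type} [HomogCoords Y'] (r : ℕ) (π : Y' → Y) (E : Set Y')
    (B : Set Y) : Prop :=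
  IsMorphismOn E B π ∧
  ∃ (ι : Type) (U : ι → Set Y) (φ : ι → Y' → VProd Y (PSpace r))
    (A : ι → ι → Y → GL (Fin (r + 1)) ℂ),
    (∀ i, IsOpen (U i)) ∧ (B ⊆ ⋃ i, U i) ∧
    (∀ i, IsIsoOn (E ∩ π ⁻¹' (U i)) {z | z.fst ∈ B ∩ U i} (φ i)) ∧
    (∀ i, ∀ e ∈ E ∩ π ⁻¹' (U i), (φ i e).fst = π e) ∧
    (∀ i j a b, RegularOn (B ∩ U i ∩ U j)
      (fun x => (A i j x : Matrix (Fin (r + 1)) (Fin (r + 1)) ℂ) a b)) ∧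
    (∀ i j k, ∀ x ∈ B ∩ U i ∩ U j ∩ U k, A j k x * A i j x = A i k x) ∧
    (∀ i j, ∀ e ∈ E, π e ∈ U i ∩ U j → ∃ c : ℂ, c ≠ 0 ∧
      (φ j e).snd.rep = c • Matrix.mulVec
        (A i j (π e) : Matrix (Fin (r + 1)) (Fin (r + 1)) ℂ) (φ i e).snd.rep)

/-! ### Rational functions and the degree of a map -/

/-- The filter generated by the nonempty open subsets of `W` (for irreducible `W`). -/
def genericFilter (W : Set Y) : Filter Y :=
  ⨅ U ∈ {U : Set Y | IsOpen U ∧ (W ∩ U).Nonempty}, Filter.principal (W ∩ U)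

/-- The function field of an irreducible `W`: germs of functions that are regular on some nonempty
open subset of `W`, two such functions being identified if they agree on a nonempty open subset. -/
def ratFun (W : Set Y) : Subring ((genericFilter W).Germ ℂ) where
  carrier := {g | ∃ A ∈ genericFilter W, ∃ f : Y → ℂ, RegularOn A f ∧
    g = (f : (genericFilter W).Germ ℂ)}
  mul_mem' := by
    rintro _ _ ⟨A, hA, f, hf, rfl⟩ ⟨B, hB, g, hg, rfl⟩
    exact ⟨A ∩ B, Filter.inter_mem hA hB, f * g,
      (hf.mono Set.inter_subset_left).mul (hg.mono Set.inter_subset_right), rfl⟩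
  add_mem' := by
    rintro _ _ ⟨A, hA, f, hf, rfl⟩ ⟨B, hB, g, hg, rfl⟩
    exact ⟨A ∩ B, Filter.inter_mem hA hB, f + g,
      (hf.mono Set.inter_subset_left).add (hg.mono Set.inter_subset_right), rfl⟩
  one_mem' := ⟨Set.univ, Filter.univ_mem, fun _ => 1, RegularOn.const _ 1, rfl⟩
  zero_mem' := ⟨Set.univ, Filter.univ_mem, fun _ => 0, RegularOn.const _ 0, rfl⟩
  neg_mem' := by
    rintro _ ⟨A, hA, f, hf, rfl⟩
    exact ⟨A, hA, -f, hf.neg, rfl⟩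

/-- The image of the function field of `W'` in the function field of `W` under pullback of
rational functions along a dominant morphism `φ : W → W'`. -/
def pulledBack {Y' : Type} [HomogCoords Y'] (φ : Y → Y') (W : Set Y) (W' : Set Y') :
    Subring (ratFun W) where
  carrier := {g | ∃ A ∈ genericFilter W', ∃ h : Y' → ℂ, RegularOn A h ∧
    (g : (genericFilter W).Germ ℂ) = ((h ∘ φ : Y → ℂ) : (genericFilter W).Germ ℂ)}
  mul_mem' := by
    rintro ⟨a, ha⟩ ⟨b, hb⟩ ⟨A, hA, f, hf, h1⟩ ⟨B, hB, g, hg, h2⟩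
    dsimp only at h1 h2
    subst h1 h2
    exact ⟨A ∩ B, Filter.inter_mem hA hB, f * g,
      (hf.mono Set.inter_subset_left).mul (hg.mono Set.inter_subset_right), rfl⟩
  add_mem' := by
    rintro ⟨a, ha⟩ ⟨b, hb⟩ ⟨A, hA, f, hf, h1⟩ ⟨B, hB, g, hg, h2⟩
    dsimp only at h1 h2
    subst h1 h2
    exact ⟨A ∩ B, Filter.inter_mem hA hB, f + g,
      (hf.mono Set.inter_subset_left).add (hg.mono Set.inter_subset_right), rfl⟩
  one_mem' := ⟨Set.univ, Filter.univ_mem, fun _ => 1, RegularOn.const _ 1, rfl⟩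
  zero_mem' := ⟨Set.univ, Filter.univ_mem, fun _ => 0, RegularOn.const _ 0, rfl⟩
  neg_mem' := by
    rintro ⟨a, ha⟩ ⟨A, hA, f, hf, h1⟩
    dsimp only at h1
    subst h1
    exact ⟨A, hA, -f, hf.neg, rfl⟩

/-- The degree of a morphism `φ : W → W'` of irreducible varieties of the same dimension is `m`:
`m` is the degree of the extension of function fields if `φ` is dominant, and `0` otherwise. -/
def HasDegree {Y' : Type} [HomogCoords Y'] (φ : Y → Y') (W : Set Y) (W' : Set Y') (m : ℕ) : Prop :=
  (W' ⊆ closure (φ '' W) ∧ Module.rank (pulledBack φ W W') (ratFun W) = (m : Cardinal)) ∨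
    (¬ W' ⊆ closure (φ '' W) ∧ m = 0)

end Zariski

/-! ### Likelihood geometry -/

section Likelihood

variable {n : ℕ}

/-- The arrangement of the `n + 2` hyperplanes `p₀ ⋯ pₙ · (p₀ + ⋯ + pₙ) = 0` in `ℙⁿ`. -/
def arrangement (n : ℕ) : Set (PSpace n) :=
  {p | (∏ i, p.rep i) * ∑ i, p.rep i = 0}

/-- The tangent space at `p` of the affine cone over `X`: the vectors killed by the differentials
of all homogeneous polynomials vanishing on `X`. -/
def coneTangent (X : Set (PSpace n)) (p : PSpace n) : Submodule ℂ (Fin (n + 1) → ℂ) where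
  carrier := {w | ∀ (k : ℕ) (F : MvPolynomial (Fin (n + 1)) ℂ), F.IsHomogeneous k →
    (∀ x ∈ X, MvPolynomial.eval x.rep F = 0) →
      ∑ i, MvPolynomial.eval p.rep (MvPolynomial.pderiv i F) * w i = 0}
  add_mem' := by
    intro a b ha hb k F hF hX
    simp only [Pi.add_apply, mul_add, Finset.sum_add_distrib, ha k F hF hX, hb k F hF hX, add_zero]
  zero_mem' := by
    intro k F _ _
    simp
  smul_mem' := by
    intro c a ha k F hF hX
    have h := congrArg (c * ·) (ha k F hF hX)
    simp only [Finset.mul_sum, mul_zero] at h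
    rw [← h]
    refine Finset.sum_congr rfl fun i _ => ?_
    simp only [Pi.smul_apply, smul_eq_mul]
    ring

/-- The regular locus of an irreducible projective variety `X`, by the Jacobian criterion. -/
def regLocus (X : Set (PSpace n)) : Set (PSpace n) :=
  {p | p ∈ X ∧ (Module.finrank ℂ (coneTangent X p) : WithBot ℕ∞) = topologicalKrullDim X + 1}

/-- The logarithmic differential of `∏ pᵢ ^ uᵢ / (∑ pᵢ) ^ (∑ uᵢ)` at `p`, for data `u`. -/
def dlog (u p : Fin (n + 1) → ℂ) : Fin (n + 1) → ℂ :=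
  fun i => u i / p i - (∑ j, u j) / ∑ j, p j

/-- `p` is a critical point on `X_reg \ ℋ` of the likelihood function with data `u`: the
restriction to `X` of its logarithmic differential vanishes at `p`. -/
def IsCritical (X : Set (PSpace n)) (u p : PSpace n) : Prop :=
  p ∈ regLocus X \ arrangement n ∧
    ∀ w ∈ coneTangent X p, ∑ i, dlog u.rep p.rep i * w i = 0

/-- The likelihood correspondence `ℒ_X ⊆ ℙⁿ × ℙⁿ`: the Zariski closure of the universal family of
critical points. -/
def likelihoodCorrespondence (X : Set (PSpace n)) : Set (VProd (PSpace n) (PSpace n)) :=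
  closure {z | IsCritical X z.snd z.fst}

/-- `m` is the maximum likelihood degree of `X`: the number of critical points for generic data. -/
def IsMLDegree (X : Set (PSpace n)) (m : ℕ) : Prop :=
  ∃ U : Set (PSpace n), IsOpen U ∧ U.Nonempty ∧ ∀ u ∈ U, {p | IsCritical X u p}.encard = m

end Likelihood

end LikelihoodGeometry

end

/-! Fix a point `p` of `X_reg \ ℋ`. The critical equations are linear in the data: the covector with
entries `uᵢ / pᵢ - u₊ / p₊` must be conormal to the cone over `X`. Equivalently, `uᵢ = pᵢ (t + cᵢ)`
with a constant `t` and a conormal covector `c`; Euler's formula gives `∑ pᵢ cᵢ = 0`, so `t = u₊ /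
p₊` holds automatically. Conormal covectors at a regular point form a space of dimension `n - d`,
and the constant covector is independent of them because `p₊ ≠ 0` while the point itself is a
tangent vector of the cone. Hence the data for which `p` is critical form a vector space of
dimension `n - d + 1`, spanned by the columns of `frameMatrix`, which are polynomial in `p`
(`range_frameMatrix`).

So the universal family of critical points is the projectivization of a vector bundle over `X_reg \
ℋ` (`isProjectiveBundle_totalSpace`), and over this base its closure adds no points
(`closure_totalSpace_inter`). The base is nonempty and open in `X`: a generic tangent space has the
dimension predicted by the derivations of the function field (`eventually_finrank_coneTangent`), and
no tangent space outside `ℋ` is smaller (`le_finrank_coneTangent`). Irreducibility is inherited from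
`X × ℙⁿ⁻ᵈ` through the local frames, which also show that the dimension is `d + (n - d) = n`.

For the second projection, the points of `ℒ_X` outside a suitable nonempty open set of critical
points form a proper closed subset. Its components have dimension less than `n` and cannot dominate
`ℙⁿ`, so for generic `u` the whole fibre consists of critical points (`eventually_forall_fiber`). If
the projection is dominant, the function fields have equal transcendence degree, the extension is
finite, and a primitive element identifies a generic fibre with the roots of a separable polynomial
whose degree is that of the extension (`exists_generic_fiber`, `exists_rank_eq_and_encard_fiber`).
If it is not dominant, generic fibres are empty.

Two devices carry the algebraic geometry. Rational functions are germs along `genericFilter`, so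
finitely many identities in a function field hold simultaneously at all points of a nonempty open
set. Charts identify affine parts with closed subsets of affine space, where the Nullstellensatz and
Noether normalization equate the topological Krull dimension with the transcendence degree
(`exists_topologicalKrullDim_eq_trdeg`). -/

noncomputable section

namespace LikelihoodGeometry

open Filter Topology

/-! ### Zariski topology, generic points and the function field. -/

section ZariskiBasics

variable {Y : Type} [HomogCoords Y]

theorem isClosed_iff_zeroLocus {Z : Set Y} :
    IsClosed Z ↔ ∃ S : Set (MvPolynomial (HomogCoords.idx Y) ℂ),
      (∀ F ∈ S, ∃ m, IsHomog (Y := Y) F m) ∧ Z = zeroLocus S := by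
  rw [← isOpen_compl_iff]
  change Zᶜᶜ ∈ {Z | ∃ S : Set (MvPolynomial (HomogCoords.idx Y) ℂ),
      (∀ F ∈ S, ∃ m, IsHomog (Y := Y) F m) ∧ Z = zeroLocus S} ↔ _
  rw [compl_compl]
  rfl

theorem isClosed_setOf_evalAt_eq_zero {F : MvPolynomial (HomogCoords.idx Y) ℂ}
    {m : HomogCoords.deg Y} (hF : IsHomog (Y := Y) F m) : IsClosed {y : Y | evalAt F y = 0} := by
  rw [isClosed_iff_zeroLocus]
  refine ⟨{F}, ?_, ?_⟩
  · rintro G rfl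
    exact ⟨m, hF⟩
  · ext y
    simp [zeroLocus]

theorem isOpen_setOf_evalAt_ne_zero {F : MvPolynomial (HomogCoords.idx Y) ℂ}
    {m : HomogCoords.deg Y} (hF : IsHomog (Y := Y) F m) : IsOpen {y : Y | evalAt F y ≠ 0} :=
  (isClosed_setOf_evalAt_eq_zero hF).isOpen_compl

theorem exists_homog_of_notMem {Z : Set Y} (hZ : IsClosed Z) {y : Y} (hy : y ∉ Z) :
    ∃ m F, IsHomog (Y := Y) F m ∧ (∀ z ∈ Z, evalAt F z = 0) ∧ evalAt F y ≠ 0 := by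
  obtain ⟨S, hS, rfl⟩ := isClosed_iff_zeroLocus.1 hZ
  simp only [zeroLocus, Set.mem_ofPred_eq, not_forall] at hy
  obtain ⟨F, hF, h⟩ := hy
  obtain ⟨m, hm⟩ := hS F hF
  exact ⟨m, F, hm, fun z hz => hz F hF, h⟩

/-- Irreducibility makes the nonempty traces of open sets directed, so a single open set suffices to
describe membership in the infimum of principal filters. -/
theorem mem_genericFilter {W : Set Y} (hW : IsIrreducible W) {S : Set Y} :
    S ∈ genericFilter W ↔ ∃ U, IsOpen U ∧ (W ∩ U).Nonempty ∧ W ∩ U ⊆ S := by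
  unfold genericFilter
  rw [Filter.mem_biInf_of_directed]
  · simp only [Filter.mem_principal, Set.mem_ofPred_eq]
    exact ⟨fun ⟨U, hU, h⟩ => ⟨U, hU.1, hU.2, h⟩, fun ⟨U, h1, h2, h⟩ => ⟨U, ⟨h1, h2⟩, h⟩⟩
  · rintro U ⟨hU, hWU⟩ V ⟨hV, hWV⟩
    refine ⟨U ∩ V, ⟨hU.inter hV, hW.2 U V hU hV hWU hWV⟩, ?_, ?_⟩
    · exact Filter.principal_mono.2 (by gcongr; exact Set.inter_subset_left)
    · exact Filter.principal_mono.2 (by gcongr; exact Set.inter_subset_right)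
  · exact ⟨Set.univ, isOpen_univ, by simpa using hW.1⟩

theorem inter_mem_genericFilter {W U : Set Y} (hW : IsIrreducible W) (hU : IsOpen U)
    (h : (W ∩ U).Nonempty) : W ∩ U ∈ genericFilter W :=
  (mem_genericFilter hW).2 ⟨U, hU, h, subset_rfl⟩

theorem open_mem_genericFilter {W U : Set Y} (hW : IsIrreducible W) (hU : IsOpen U)
    (h : (W ∩ U).Nonempty) : U ∈ genericFilter W :=
  (mem_genericFilter hW).2 ⟨U, hU, h, Set.inter_subset_right⟩

theorem self_mem_genericFilter {W : Set Y} (hW : IsIrreducible W) : W ∈ genericFilter W :=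
  (mem_genericFilter hW).2 ⟨Set.univ, isOpen_univ, by simpa using hW.1, Set.inter_subset_left⟩

theorem genericFilter_neBot {W : Set Y} (hW : IsIrreducible W) : (genericFilter W).NeBot := by
  refine ⟨fun h => ?_⟩
  have : (∅ : Set Y) ∈ genericFilter W := by rw [h]; trivial
  obtain ⟨U, -, hne, hsub⟩ := (mem_genericFilter hW).1 this
  exact (hne.mono hsub).ne_empty rfl

theorem inter_nonempty_of_mem_genericFilter {W U S : Set Y} (hW : IsIrreducible W)
    (hU : IsOpen U) (h : (W ∩ U).Nonempty) (hS : S ∈ genericFilter W) : (W ∩ U ∩ S).Nonempty :=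
  have := genericFilter_neBot hW
  Filter.nonempty_of_mem (Filter.inter_mem (inter_mem_genericFilter hW hU h) hS)

/-- A closed set which contains generic points of `W` contains `W`. -/
theorem subset_of_mem_genericFilter {W Z : Set Y} (hW : IsIrreducible W) (hZ : IsClosed Z)
    (h : Z ∈ genericFilter W) : W ⊆ Z := by
  intro y hy
  by_contra hyZ
  obtain ⟨z, ⟨-, hz⟩, hz'⟩ :=
    inter_nonempty_of_mem_genericFilter hW hZ.isOpen_compl ⟨y, hy, hyZ⟩ h
  exact hz hz'

/-- Open conditions obey a zero-one law along the generic filter, since every nonempty open trace is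
generic. -/
theorem eventually_of_frequently_isOpen {W U : Set Y} (hW : IsIrreducible W) (hU : IsOpen U)
    (h : ∃ᶠ y in genericFilter W, y ∈ U) : ∀ᶠ y in genericFilter W, y ∈ U := by
  refine open_mem_genericFilter hW hU ?_
  obtain ⟨y, hy, hyW⟩ := (h.and_eventually (self_mem_genericFilter hW)).exists
  exact ⟨y, hyW, hy⟩

theorem RegularOn.congr {W : Set Y} {f g : Y → ℂ} (h : RegularOn W f) (hfg : Set.EqOn f g W) :
    RegularOn W g := by
  intro y hy
  obtain ⟨U, hU, hyU, m, F, G, hF, hG, H⟩ := h y hy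
  exact ⟨U, hU, hyU, m, F, G, hF, hG, fun z hz => ⟨(H z hz).1, (hfg hz.1) ▸ (H z hz).2⟩⟩

/-- A quotient of homogeneous polynomials of equal degree is regular where the denominator does
not vanish. -/
theorem regularOn_div {W : Set Y} {m : HomogCoords.deg Y}
    {F G : MvPolynomial (HomogCoords.idx Y) ℂ} (hF : IsHomog (Y := Y) F m)
    (hG : IsHomog (Y := Y) G m) (h : ∀ y ∈ W, evalAt G y ≠ 0) :
    RegularOn W (fun y => evalAt F y / evalAt G y) := fun _ _ =>
  ⟨Set.univ, isOpen_univ, trivial, m, F, G, hF, hG, fun z hz => ⟨h z hz.1, rfl⟩⟩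

/-- One local expression as a quotient is enough: the open set on which it is valid meets `W`, hence
is generic. -/
theorem exists_eventually_eq_div {W A : Set Y} (hW : IsIrreducible W) (hA : A ∈ genericFilter W)
    {f : Y → ℂ} (hf : RegularOn A f) : ∃ m F G, IsHomog (Y := Y) F m ∧ IsHomog (Y := Y) G m ∧
      ∀ᶠ z in genericFilter W, evalAt G z ≠ 0 ∧ f z = evalAt F z / evalAt G z := by
  have := genericFilter_neBot hW
  obtain ⟨y, hy, hyW⟩ := Filter.nonempty_of_mem (Filter.inter_mem hA (self_mem_genericFilter hW))
  obtain ⟨U, hU, hyU, m, F, G, hF, hG, H⟩ := hf y hy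
  refine ⟨m, F, G, hF, hG, ?_⟩
  filter_upwards [hA, open_mem_genericFilter hW hU ⟨y, hyW, hyU⟩] with z hz hzU
  exact H z ⟨hz, hzU⟩

/-- Swap numerator and denominator of a quotient representing `f`. The numerator is generically
nonzero because this is an open condition that holds frequently. -/
theorem eventually_regular_inv {W A : Set Y} (hW : IsIrreducible W) (hA : A ∈ genericFilter W)
    {f : Y → ℂ} (hf : RegularOn A f) (h0 : ∃ᶠ y in genericFilter W, f y ≠ 0) :
    ∃ A' ∈ genericFilter W, RegularOn A' f⁻¹ ∧ ∀ y ∈ A', f y ≠ 0 := by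
  obtain ⟨m, F, G, hF, hG, H⟩ := exists_eventually_eq_div hW hA hf
  have hFne : ∀ᶠ y in genericFilter W, evalAt F y ≠ 0 := by
    refine eventually_of_frequently_isOpen hW (isOpen_setOf_evalAt_ne_zero hF) ?_
    refine (h0.and_eventually H).mono ?_
    rintro y ⟨h1, h2, h3⟩ h4
    rw [h4, zero_div] at h3
    exact h1 h3
  refine ⟨{z | evalAt F z ≠ 0 ∧ evalAt G z ≠ 0 ∧ f z = evalAt F z / evalAt G z}, ?_, ?_, ?_⟩
  · filter_upwards [hFne, H] with z h1 h2 using ⟨h1, h2⟩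
  · refine (regularOn_div hG hF fun y hy => hy.1).congr fun y hy => ?_
    simp only [Pi.inv_apply, hy.2.2, inv_div]
  · rintro y ⟨h1, h2, h3⟩
    rw [h3]
    exact div_ne_zero h1 h2

/-- The rational function given by a function that is regular on a generic set. -/
def toRatFun {W A : Set Y} {f : Y → ℂ} (hA : A ∈ genericFilter W) (hf : RegularOn A f) :
    ratFun W := ⟨(f : (genericFilter W).Germ ℂ), A, hA, f, hf, rfl⟩

theorem exists_eq_toRatFun {W : Set Y} (g : ratFun W) :
    ∃ (A : Set Y) (f : Y → ℂ) (hA : A ∈ genericFilter W) (hf : RegularOn A f),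
      g = toRatFun hA hf := by
  obtain ⟨_, A, hA, f, hf, rfl⟩ := g
  exact ⟨A, f, hA, hf, rfl⟩

theorem isField_ratFun {W : Set Y} (hW : IsIrreducible W) : IsField (ratFun W) := by
  have := genericFilter_neBot hW
  refine ⟨⟨0, 1, fun h => ?_⟩, fun a b => mul_comm a b, fun {g} hg => ?_⟩
  · have h1 : ((fun _ => (0 : ℂ) : Y → ℂ) : (genericFilter W).Germ ℂ) =
        ((fun _ => 1 : Y → ℂ) : (genericFilter W).Germ ℂ) := congrArg Subtype.val h
    obtain ⟨y, hy⟩ := (Filter.Germ.coe_eq.1 h1).exists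
    exact zero_ne_one hy
  · obtain ⟨A, f, hA, hf, rfl⟩ := exists_eq_toRatFun g
    have h0 : ∃ᶠ y in genericFilter W, f y ≠ 0 := by
      intro h
      refine hg (Subtype.ext (Filter.Germ.coe_eq.2 ?_))
      filter_upwards [h] with y hy using not_not.1 hy
    obtain ⟨A', hA', hf', hne⟩ := eventually_regular_inv hW hA hf h0
    refine ⟨toRatFun hA' hf', Subtype.ext ?_⟩
    refine (Filter.Germ.coe_eq (f := f * f⁻¹) (g := fun _ => 1)).2 ?_
    filter_upwards [hA'] with y hy using mul_inv_cancel₀ (hne y hy)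

instance ratFunAlgebra (W : Set Y) : Algebra ℂ (ratFun W) :=
  RingHom.toAlgebra
    { toFun := fun c => ⟨((fun _ => c : Y → ℂ) : (genericFilter W).Germ ℂ), Set.univ,
        Filter.univ_mem, fun _ => c, RegularOn.const _ c, rfl⟩
      map_one' := rfl
      map_zero' := rfl
      map_mul' := fun _ _ => rfl
      map_add' := fun _ _ => rfl }

/-- A map which sends generic points to generic points and pulls regular functions back to
regular functions, generically. -/
structure IsGenericMap {Y' : Type} [HomogCoords Y'] (φ : Y → Y') (W : Set Y) (W' : Set Y') :
    Prop where
  tendsto : Tendsto φ (genericFilter W) (genericFilter W')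
  regular : ∀ A ∈ genericFilter W', ∀ f : Y' → ℂ, RegularOn A f →
    ∃ A' ∈ genericFilter W, RegularOn A' (f ∘ φ)

/-- Pullback of rational functions. -/
def IsGenericMap.pullback {Y' : Type} [HomogCoords Y'] {φ : Y → Y'} {W : Set Y} {W' : Set Y'}
    (h : IsGenericMap φ W W') : ratFun W' →ₐ[ℂ] ratFun W where
  toFun g := ⟨g.1.compTendsto φ h.tendsto, by
    obtain ⟨_, A, hA, f, hf, rfl⟩ := g
    obtain ⟨A', hA', hf'⟩ := h.regular A hA f hf
    exact ⟨A', hA', f ∘ φ, hf', rfl⟩⟩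
  map_one' := rfl
  map_zero' := rfl
  map_mul' := by
    rintro ⟨_, A, hA, f, hf, rfl⟩ ⟨_, B, hB, g, hg, rfl⟩
    rfl
  map_add' := by
    rintro ⟨_, A, hA, f, hf, rfl⟩ ⟨_, B, hB, g, hg, rfl⟩
    rfl
  commutes' _ := rfl

/-- Links the subring in the definition of the degree with a homomorphism of function fields, so
that the rank there becomes the degree of a field extension. -/
theorem IsGenericMap.range_pullback {Y' : Type} [HomogCoords Y'] {φ : Y → Y'} {W : Set Y}
    {W' : Set Y'} (h : IsGenericMap φ W W') :
    h.pullback.toRingHom.range = pulledBack φ W W' := by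
  ext g
  constructor
  · rintro ⟨k, rfl⟩
    obtain ⟨A, f, hA, hf, rfl⟩ := exists_eq_toRatFun k
    exact ⟨A, hA, f, hf, rfl⟩
  · rintro ⟨A, hA, f, hf, e⟩
    exact ⟨toRatFun hA hf, Subtype.ext e.symm⟩

end ZariskiBasics

/-! ### Affine charts, coordinate rings and their fraction fields. -/

section Charts

theorem trdeg_eq_of_isAlgebraic (k A K : Type) [Field k] [CommRing A] [CommRing K] [IsDomain K]
    [Algebra k A] [Algebra k K] [Algebra A K] [IsScalarTower k A K] [FaithfulSMul A K]
    [Algebra.IsAlgebraic A K] : Algebra.trdeg k A = Algebra.trdeg k K := by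
  have := (algebraMap A K).domain_nontrivial
  rw [← trdeg_add_eq k A (A := K), trdeg_eq_zero (R := A) (A := K), add_zero]

open MvPolynomial

/-- Encoding a change of coordinate vector as a character `s` of the degree monoid treats the
grading by `ℕ` and the bigrading by `ℕ × ℕ` at once: all monomials of weight `m` pick up the same
factor. -/
theorem eval_eq_scale_mul {σ M : Type*} [AddCommMonoid M] {w : σ → M} {F : MvPolynomial σ ℂ}
    {m : M} (hF : IsWeightedHomogeneous w F m) (s : Multiplicative M →* ℂ) {x y : σ → ℂ}
    (h : ∀ a, x a = s (Multiplicative.ofAdd (w a)) * y a) :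
    eval x F = s (Multiplicative.ofAdd m) * eval y F := by
  rw [eval_eq, eval_eq, Finset.mul_sum]
  refine Finset.sum_congr rfl fun d hd => ?_
  have hm : Finsupp.weight w d = m := hF (mem_support_iff.1 hd)
  have h : ∏ a ∈ d.support, x a ^ d a =
      s (Multiplicative.ofAdd m) * ∏ a ∈ d.support, y a ^ d a := by
    rw [← hm, Finsupp.weight_apply, Finsupp.sum, ofAdd_sum, map_prod, ← Finset.prod_mul_distrib]
    refine Finset.prod_congr rfl fun a _ => ?_
    rw [h, mul_pow, ofAdd_nsmul, map_pow]
  rw [h]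
  ring

/-- An affine chart of a space with homogeneous coordinates: homogeneous denominators `den a`,
one for each coordinate `a` and of the same degree, such that the affine coordinates
`coord y a / den a` identify the set where no denominator vanishes with the closed subset
`den = 1` of affine space. -/
structure Chart (Y : Type) [HomogCoords Y] where
  den : HomogCoords.idx Y → MvPolynomial (HomogCoords.idx Y) ℂ
  den_homog : ∀ a, IsHomog (Y := Y) (den a) (HomogCoords.wt a)
  scale : Y → Multiplicative (HomogCoords.deg Y) →* ℂ
  scale_wt : ∀ y a, scale y (Multiplicative.ofAdd (HomogCoords.wt a)) = evalAt (den a) y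
  scale_ne_zero : ∀ y, (∀ a, evalAt (den a) y ≠ 0) → ∀ m, scale y m ≠ 0
  exists_point : ∀ x : HomogCoords.idx Y → ℂ, (∀ a, eval x (den a) = 1) →
    ∃ y : Y, (∀ a, evalAt (den a) y ≠ 0) ∧
      ∀ a, HomogCoords.coord y a = evalAt (den a) y * x a
  ext_point : ∀ y z : Y, (∀ a, evalAt (den a) y ≠ 0) → (∀ a, evalAt (den a) z ≠ 0) →
    (∀ a, HomogCoords.coord y a / evalAt (den a) y = HomogCoords.coord z a / evalAt (den a) z) →
      y = z

namespace Chart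

variable {Y : Type} [HomogCoords Y] (c : Chart Y)

/-- The domain of a chart. -/
def dom : Set Y := {y | ∀ a, evalAt (c.den a) y ≠ 0}

/-- The affine coordinates of a point. -/
def aff (y : Y) (a : HomogCoords.idx Y) : ℂ := HomogCoords.coord y a / evalAt (c.den a) y

theorem isOpen_dom [Finite (HomogCoords.idx Y)] : IsOpen c.dom := by
  have : c.dom = ⋂ a, {y | evalAt (c.den a) y ≠ 0} := by
    ext y
    simp [dom]
  rw [this]
  exact isOpen_iInter_of_finite fun a => isOpen_setOf_evalAt_ne_zero (c.den_homog a)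

theorem aff_injOn : Set.InjOn c.aff c.dom := fun y hy z hz h =>
  c.ext_point y z hy hz fun a => congrFun h a

theorem coord_eq {y : Y} (hy : y ∈ c.dom) (a : HomogCoords.idx Y) :
    HomogCoords.coord y a = evalAt (c.den a) y * c.aff y a :=
  (mul_div_cancel₀ _ (hy a)).symm

theorem evalAt_eq {y : Y} (hy : y ∈ c.dom) {F : MvPolynomial (HomogCoords.idx Y) ℂ}
    {m : HomogCoords.deg Y} (hF : IsHomog (Y := Y) F m) :
    evalAt F y = c.scale y (Multiplicative.ofAdd m) * eval (c.aff y) F := by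
  refine eval_eq_scale_mul hF (c.scale y) fun a => ?_
  rw [c.coord_eq hy, c.scale_wt]

theorem evalAt_eq_zero_iff {y : Y} (hy : y ∈ c.dom) {F : MvPolynomial (HomogCoords.idx Y) ℂ}
    {m : HomogCoords.deg Y} (hF : IsHomog (Y := Y) F m) :
    evalAt F y = 0 ↔ eval (c.aff y) F = 0 := by
  rw [c.evalAt_eq hy hF, mul_eq_zero, or_iff_right (c.scale_ne_zero y hy _)]

theorem evalAt_div_eq {y : Y} (hy : y ∈ c.dom) {F G : MvPolynomial (HomogCoords.idx Y) ℂ}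
    {m : HomogCoords.deg Y} (hF : IsHomog (Y := Y) F m) (hG : IsHomog (Y := Y) G m) :
    evalAt F y / evalAt G y = eval (c.aff y) F / eval (c.aff y) G := by
  rw [c.evalAt_eq hy hF, c.evalAt_eq hy hG, mul_div_mul_left _ _ (c.scale_ne_zero y hy _)]

theorem eval_aff_den {y : Y} (hy : y ∈ c.dom) (a : HomogCoords.idx Y) :
    eval (c.aff y) (c.den a) = 1 := by
  have h := c.evalAt_eq hy (c.den_homog a)
  rw [c.scale_wt] at h
  exact (mul_left_cancel₀ (hy a) (by rw [← h, mul_one]))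

theorem exists_aff_eq {x : HomogCoords.idx Y → ℂ} (hx : ∀ a, eval x (c.den a) = 1) :
    ∃ y ∈ c.dom, c.aff y = x := by
  obtain ⟨y, hy, h⟩ := c.exists_point x hx
  refine ⟨y, hy, funext fun a => ?_⟩
  rw [aff, h a, mul_div_cancel_left₀ _ (hy a)]

/-- Induction on the polynomial: an affine coordinate is `X a` over `den a`, and the denominators
accumulate. This turns inhomogeneous polynomials in the affine coordinates into regular functions.
-/
theorem exists_homogenization (f : MvPolynomial (HomogCoords.idx Y) ℂ) :
    ∃ m F G, IsHomog (Y := Y) F m ∧ IsHomog (Y := Y) G m ∧ ∀ y ∈ c.dom, evalAt G y ≠ 0 ∧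
      eval (c.aff y) f = evalAt F y / evalAt G y := by
  induction f using MvPolynomial.induction_on with
  | C r =>
    refine ⟨0, C r, 1, isWeightedHomogeneous_C _ _, isWeightedHomogeneous_one _ _, fun y _ => ?_⟩
    simp [evalAt]
  | add f g hf hg =>
    obtain ⟨k, F, G, hF, hG, H⟩ := hf
    obtain ⟨l, F', G', hF', hG', H'⟩ := hg
    refine ⟨k + l, F * G' + G * F', G * G',
      (IsWeightedHomogeneous.mul hF hG').add (IsWeightedHomogeneous.mul hG hF'),
      IsWeightedHomogeneous.mul hG hG', fun y hy => ?_⟩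
    obtain ⟨h1, h2⟩ := H y hy
    obtain ⟨h1', h2'⟩ := H' y hy
    simp only [evalAt, map_mul, map_add] at *
    refine ⟨mul_ne_zero h1 h1', ?_⟩
    rw [h2, h2', div_add_div _ _ h1 h1']
  | mul_X f a hf =>
    obtain ⟨k, F, G, hF, hG, H⟩ := hf
    refine ⟨k + HomogCoords.wt a, F * X a, G * c.den a,
      IsWeightedHomogeneous.mul hF (isWeightedHomogeneous_X _ _ _),
      IsWeightedHomogeneous.mul hG (c.den_homog a), fun y hy => ?_⟩
    obtain ⟨h1, h2⟩ := H y hy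
    have h3 := hy a
    simp only [evalAt, map_mul, eval_X] at *
    refine ⟨mul_ne_zero h1 h3, ?_⟩
    rw [h2, aff, div_mul_div_comm]
    rfl

theorem regularOn_eval (f : MvPolynomial (HomogCoords.idx Y) ℂ) :
    RegularOn c.dom (fun y => eval (c.aff y) f) := by
  obtain ⟨m, F, G, hF, hG, H⟩ := c.exists_homogenization f
  exact (regularOn_div hF hG fun y hy => (H y hy).1).congr fun y hy => (H y hy).2.symm

/-- The ideal of the affine part of `W`. -/
def ideal (W : Set Y) : Ideal (MvPolynomial (HomogCoords.idx Y) ℂ) :=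
  vanishingIdeal ℂ (c.aff '' (W ∩ c.dom))

theorem mem_ideal {W : Set Y} {f : MvPolynomial (HomogCoords.idx Y) ℂ} :
    f ∈ c.ideal W ↔ ∀ y ∈ W, y ∈ c.dom → eval (c.aff y) f = 0 := by
  simp only [ideal, mem_vanishingIdeal_iff, Set.forall_mem_image, Set.mem_inter_iff, and_imp,
    aeval_eq_eval]

/-- Polynomials as rational functions on `W`. -/
def toRat {W : Set Y} (h : c.dom ∈ genericFilter W) :
    MvPolynomial (HomogCoords.idx Y) ℂ →ₐ[ℂ] ratFun W where
  toFun f := toRatFun h (c.regularOn_eval f)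
  map_one' := Subtype.ext (Filter.Germ.coe_eq.2 (.of_forall fun _ => map_one _))
  map_zero' := Subtype.ext (Filter.Germ.coe_eq.2 (.of_forall fun _ => map_zero _))
  map_mul' f g := Subtype.ext (Filter.Germ.coe_eq.2 (.of_forall fun _ => map_mul _ f g))
  map_add' f g := Subtype.ext (Filter.Germ.coe_eq.2 (.of_forall fun _ => map_add _ f g))
  commutes' r := Subtype.ext (Filter.Germ.coe_eq.2 (.of_forall fun _ => eval_C r))

theorem toRat_eq_zero_iff {W : Set Y} (h : c.dom ∈ genericFilter W)
    (f : MvPolynomial (HomogCoords.idx Y) ℂ) :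
    c.toRat h f = 0 ↔ ∀ᶠ y in genericFilter W, eval (c.aff y) f = 0 :=
  Subtype.ext_iff.trans Filter.Germ.coe_eq

/-- The numerator of a homogenization cuts out a closed set, and a closed set that is generic in `W`
contains all of `W`. -/
theorem mem_ideal_iff_eventually {W : Set Y} (hW : IsIrreducible W)
    (h : c.dom ∈ genericFilter W) {f : MvPolynomial (HomogCoords.idx Y) ℂ} :
    f ∈ c.ideal W ↔ ∀ᶠ y in genericFilter W, eval (c.aff y) f = 0 := by
  rw [mem_ideal]
  constructor
  · intro H
    filter_upwards [h, self_mem_genericFilter hW] with y hy hyW using H y hyW hy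
  · intro H y hyW hy
    obtain ⟨m, F, G, hF, hG, HFG⟩ := c.exists_homogenization f
    have hFW : W ⊆ {y | evalAt F y = 0} := by
      refine subset_of_mem_genericFilter hW (isClosed_setOf_evalAt_eq_zero hF) ?_
      filter_upwards [h, H] with z hz h0
      obtain ⟨h1, h2⟩ := HFG z hz
      rw [h0, eq_comm, div_eq_zero_iff, or_iff_left h1] at h2
      exact h2
    rw [(HFG y hy).2, show evalAt F y = 0 from hFW hyW, zero_div]

theorem toRat_eq_zero_iff_mem {W : Set Y} (hW : IsIrreducible W) (h : c.dom ∈ genericFilter W)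
    (f : MvPolynomial (HomogCoords.idx Y) ℂ) : c.toRat h f = 0 ↔ f ∈ c.ideal W := by
  rw [toRat_eq_zero_iff, c.mem_ideal_iff_eventually hW h]

theorem ker_toRat {W : Set Y} (hW : IsIrreducible W) (h : c.dom ∈ genericFilter W) :
    RingHom.ker (c.toRat h) = c.ideal W := by
  ext f
  rw [RingHom.mem_ker, c.toRat_eq_zero_iff_mem hW h]

/-- If `g` is generically `F / G` with forms of equal degree, then the same `F` and `G` serve at the
affine coordinates, because the scaling factors cancel. -/
theorem exists_toRat_mul_eq {W : Set Y} (hW : IsIrreducible W) (h : c.dom ∈ genericFilter W)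
    (g : ratFun W) : ∃ P Q, c.toRat h Q ≠ 0 ∧ g * c.toRat h Q = c.toRat h P := by
  have := genericFilter_neBot hW
  obtain ⟨A, f, hA, hf, rfl⟩ := exists_eq_toRatFun g
  obtain ⟨m, F, G, hF, hG, H⟩ := exists_eventually_eq_div hW hA hf
  have H' : ∀ᶠ z in genericFilter W, eval (c.aff z) G ≠ 0 ∧
      f z * eval (c.aff z) G = eval (c.aff z) F := by
    filter_upwards [H, h] with z hz hzd
    have h1 : eval (c.aff z) G ≠ 0 := mt (c.evalAt_eq_zero_iff hzd hG).2 hz.1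
    rw [hz.2, c.evalAt_div_eq hzd hF hG]
    exact ⟨h1, div_mul_cancel₀ _ h1⟩
  refine ⟨F, G, ?_, Subtype.ext (Filter.Germ.coe_eq.2 ?_)⟩
  · rw [Ne, toRat_eq_zero_iff]
    intro h0
    obtain ⟨z, hz, hz0⟩ := (H'.and h0).exists
    exact hz.1 hz0
  · filter_upwards [H'] with z hz using hz.2

theorem isPrime_ideal {W : Set Y} (hW : IsIrreducible W) (h : c.dom ∈ genericFilter W) :
    (c.ideal W).IsPrime := by
  let := (isField_ratFun hW).toField
  rw [← c.ker_toRat hW h]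
  exact RingHom.ker_isPrime _

/-- The coordinate ring of the affine part of `W`. -/
abbrev coordRing (W : Set Y) : Type := MvPolynomial (HomogCoords.idx Y) ℂ ⧸ c.ideal W

/-- The coordinate ring in the function field. -/
def coordRingToRat {W : Set Y} (hW : IsIrreducible W) (h : c.dom ∈ genericFilter W) :
    c.coordRing W →ₐ[ℂ] ratFun W :=
  Ideal.Quotient.liftₐ (c.ideal W) (c.toRat h) fun f hf => (c.toRat_eq_zero_iff_mem hW h f).2 hf

theorem coordRingToRat_mk {W : Set Y} (hW : IsIrreducible W) (h : c.dom ∈ genericFilter W)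
    (f : MvPolynomial (HomogCoords.idx Y) ℂ) :
    c.coordRingToRat hW h (Ideal.Quotient.mk _ f) = c.toRat h f := rfl

theorem coordRingToRat_injective {W : Set Y} (hW : IsIrreducible W)
    (h : c.dom ∈ genericFilter W) : Function.Injective (c.coordRingToRat hW h) := by
  rw [injective_iff_map_eq_zero]
  intro x
  obtain ⟨f, rfl⟩ := Ideal.Quotient.mk_surjective x
  rw [coordRingToRat_mk, c.toRat_eq_zero_iff_mem hW h]
  exact Ideal.Quotient.eq_zero_iff_mem.2

theorem isFractionRing_coordRing {W : Set Y} (hW : IsIrreducible W)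
    (h : c.dom ∈ genericFilter W) :
    letI := (isField_ratFun hW).toField
    letI := (c.coordRingToRat hW h).toRingHom.toAlgebra
    IsFractionRing (c.coordRing W) (ratFun W) := by
  let := (isField_ratFun hW).toField
  let := (c.coordRingToRat hW h).toRingHom.toAlgebra
  have := c.isPrime_ideal hW h
  have : FaithfulSMul (c.coordRing W) (ratFun W) :=
    (faithfulSMul_iff_algebraMap_injective _ _).2 (c.coordRingToRat_injective hW h)
  refine IsFractionRing.of_field _ _ fun g => ?_
  obtain ⟨P, Q, hQ, e⟩ := c.exists_toRat_mul_eq hW h g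
  exact ⟨Ideal.Quotient.mk _ P, Ideal.Quotient.mk _ Q, (eq_div_iff hQ).2 e⟩

/-- Passing to the fraction field is algebraic. The right-hand side does not see the chart, which
later makes dimensions in different charts comparable. -/
theorem trdeg_coordRing {W : Set Y} (hW : IsIrreducible W) (h : c.dom ∈ genericFilter W) :
    Algebra.trdeg ℂ (c.coordRing W) = Algebra.trdeg ℂ (ratFun W) := by
  let := (isField_ratFun hW).toField
  let := (c.coordRingToRat hW h).toRingHom.toAlgebra
  have := c.isFractionRing_coordRing hW h
  have hprime := c.isPrime_ideal hW h
  have : IsScalarTower ℂ (c.coordRing W) (ratFun W) := .of_algHom (c.coordRingToRat hW h)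
  have : FaithfulSMul (c.coordRing W) (ratFun W) :=
    (faithfulSMul_iff_algebraMap_injective _ _).2 (c.coordRingToRat_injective hW h)
  have : Algebra.IsAlgebraic (c.coordRing W) (ratFun W) :=
    IsLocalization.isAlgebraic _ (nonZeroDivisors (c.coordRing W))
  exact trdeg_eq_of_isAlgebraic ℂ (c.coordRing W) (ratFun W)

end Chart

instance (n : ℕ) : Finite (HomogCoords.idx (PSpace n)) := inferInstanceAs (Finite (Fin (n + 1)))

instance (Y Z : Type) [HomogCoords Y] [HomogCoords Z] [Finite (HomogCoords.idx Y)]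
    [Finite (HomogCoords.idx Z)] : Finite (HomogCoords.idx (VProd Y Z)) :=
  inferInstanceAs (Finite (HomogCoords.idx Y ⊕ HomogCoords.idx Z))

theorem PSpace.exists_rep_mk {n : ℕ} {x : Fin (n + 1) → ℂ} (hx : x ≠ 0) :
    ∃ s : ℂ, s ≠ 0 ∧ (Projectivization.mk ℂ x hx).rep = s • x := by
  obtain ⟨s, hs⟩ := Projectivization.exists_smul_eq_mk_rep ℂ x hx
  exact ⟨s, s.ne_zero, hs.symm⟩

theorem PSpace.ext_of_smul {n : ℕ} {p q : PSpace n} {s : ℂ} (h : p.rep = s • q.rep) :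
    p = q := by
  rw [← p.mk_rep, ← q.mk_rep, Projectivization.mk_eq_mk_iff']
  exact ⟨s, h.symm⟩

/-- The standard chart `p i ≠ 0` of projective space. -/
def PSpace.chart (n : ℕ) (i : Fin (n + 1)) : Chart (PSpace n) where
  den _ := (X i : MvPolynomial (Fin (n + 1)) ℂ)
  den_homog _ := isWeightedHomogeneous_X ℂ (fun _ : Fin (n + 1) => (1 : ℕ)) i
  scale p :=
    { toFun := fun m => p.rep i ^ (Multiplicative.toAdd m : ℕ)
      map_one' := pow_zero _
      map_mul' := fun a b => pow_add _ _ _ }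
  scale_wt p _ := by
    change p.rep i ^ 1 = eval p.rep (X i)
    rw [pow_one, eval_X]
  scale_ne_zero p hp m := by
    have h : eval p.rep (X i) ≠ 0 := hp i
    rw [eval_X] at h
    exact pow_ne_zero _ h
  exists_point x hx := by
    have hxi : eval (σ := Fin (n + 1)) x (X i) = 1 := hx i
    rw [eval_X] at hxi
    have hx0 : (id x : Fin (n + 1) → ℂ) ≠ 0 := fun h => by
      rw [show x i = 0 from congrFun h i] at hxi
      exact zero_ne_one hxi
    obtain ⟨s, hs, h⟩ := PSpace.exists_rep_mk hx0
    have hsi : eval (Projectivization.mk ℂ _ hx0).rep (X i) = s := by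
      rw [eval_X, h, Pi.smul_apply, id, hxi, smul_eq_mul, mul_one]
    refine ⟨Projectivization.mk ℂ _ hx0, fun _ => ?_, fun a => ?_⟩
    · exact hsi.trans_ne hs
    · change (Projectivization.mk ℂ _ hx0).rep a = eval _ (X i) * _
      refine Eq.trans ?_ (congrArg (· * x a) hsi.symm)
      rw [h]
      rfl
  ext_point p q hp hq h := by
    have hp' : p.rep i ≠ 0 := by
      have h : eval p.rep (X i) ≠ 0 := hp i
      rwa [eval_X] at h
    have hq' : q.rep i ≠ 0 := by
      have h : eval q.rep (X i) ≠ 0 := hq i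
      rwa [eval_X] at h
    refine PSpace.ext_of_smul (s := p.rep i / q.rep i) (funext fun a => ?_)
    have ha : p.rep a / eval p.rep (X i) = q.rep a / eval q.rep (X i) := h a
    rw [eval_X, eval_X, div_eq_div_iff hp' hq'] at ha
    rw [Pi.smul_apply, smul_eq_mul, div_mul_eq_mul_div, eq_div_iff hq', ha, mul_comm]

theorem PSpace.mem_chart_dom {n : ℕ} {i : Fin (n + 1)} {p : PSpace n} :
    p ∈ (PSpace.chart n i).dom ↔ p.rep i ≠ 0 := by
  change (∀ a : Fin (n + 1), eval p.rep (X i) ≠ 0) ↔ _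
  simp

theorem PSpace.chart_aff {n : ℕ} (i : Fin (n + 1)) (p : PSpace n) (a : Fin (n + 1)) :
    (PSpace.chart n i).aff p a = p.rep a / p.rep i := by
  change p.rep a / eval p.rep (X i) = _
  rw [eval_X]

theorem VProd.evalAt_rename_inl {Y Z : Type} [HomogCoords Y] [HomogCoords Z]
    (F : MvPolynomial (HomogCoords.idx Y) ℂ) (z : VProd Y Z) :
    evalAt (Y := VProd Y Z) (rename Sum.inl F) z = evalAt F z.fst :=
  eval_rename _ _ _

theorem VProd.evalAt_rename_inr {Y Z : Type} [HomogCoords Y] [HomogCoords Z]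
    (F : MvPolynomial (HomogCoords.idx Z) ℂ) (z : VProd Y Z) :
    evalAt (Y := VProd Y Z) (rename Sum.inr F) z = evalAt F z.snd :=
  eval_rename _ _ _

/-- Each monomial of weight `m` becomes a product of forms whose degrees add up to `D m`. The
additive map `D` covers inclusions, projections and twists of degree alike. -/
theorem isWeightedHomogeneous_aeval {σ τ M N : Type*} [AddCommMonoid M] [AddCommMonoid N]
    {w : σ → M} {w' : τ → N} {F : MvPolynomial σ ℂ} {m : M} (hF : IsWeightedHomogeneous w F m)
    (D : M →+ N) (Φ : σ → MvPolynomial τ ℂ)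
    (hΦ : ∀ a, IsWeightedHomogeneous w' (Φ a) (D (w a))) :
    IsWeightedHomogeneous w' (aeval Φ F) (D m) := by
  rw [aeval_def, eval₂_eq]
  refine IsWeightedHomogeneous.sum _ _ _ fun d hd => ?_
  have hm : Finsupp.weight w d = m := hF (mem_support_iff.1 hd)
  rw [← hm, ← zero_add (D _), Finsupp.weight_apply, Finsupp.sum, map_sum]
  refine (isWeightedHomogeneous_C w' _).mul (IsWeightedHomogeneous.prod _ _ _ fun a _ => ?_)
  rw [map_nsmul]
  exact (hΦ a).pow _

theorem VProd.isHomog_rename_inl {Y Z : Type} [HomogCoords Y] [HomogCoords Z]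
    {F : MvPolynomial (HomogCoords.idx Y) ℂ} {m : HomogCoords.deg Y}
    (hF : IsHomog (Y := Y) F m) : IsHomog (Y := VProd Y Z) (rename Sum.inl F) (m, 0) := by
  rw [rename_eq_aeval]
  exact isWeightedHomogeneous_aeval hF (AddMonoidHom.inl _ (HomogCoords.deg Z)) _ fun a =>
    isWeightedHomogeneous_X ℂ (HomogCoords.wt (Y := VProd Y Z)) (Sum.inl a)

theorem VProd.isHomog_rename_inr {Y Z : Type} [HomogCoords Y] [HomogCoords Z]
    {F : MvPolynomial (HomogCoords.idx Z) ℂ} {m : HomogCoords.deg Z}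
    (hF : IsHomog (Y := Z) F m) : IsHomog (Y := VProd Y Z) (rename Sum.inr F) (0, m) := by
  rw [rename_eq_aeval]
  exact isWeightedHomogeneous_aeval hF (AddMonoidHom.inr (HomogCoords.deg Y) _) _ fun a =>
    isWeightedHomogeneous_X ℂ (HomogCoords.wt (Y := VProd Y Z)) (Sum.inr a)

/-- The product of two charts. -/
def Chart.prod {Y Z : Type} [HomogCoords Y] [HomogCoords Z] (c : Chart Y) (c' : Chart Z) :
    Chart (VProd Y Z) where
  den := Sum.elim (fun a => rename Sum.inl (c.den a)) (fun b => rename Sum.inr (c'.den b))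
  den_homog := by
    rintro (a | b)
    · exact VProd.isHomog_rename_inl (c.den_homog a)
    · exact VProd.isHomog_rename_inr (c'.den_homog b)
  scale z :=
    { toFun := fun m => c.scale z.fst (Multiplicative.ofAdd (Multiplicative.toAdd m).1) *
        c'.scale z.snd (Multiplicative.ofAdd (Multiplicative.toAdd m).2)
      map_one' := by
        change c.scale z.fst 1 * c'.scale z.snd 1 = 1
        rw [map_one, map_one, mul_one]
      map_mul' := fun a b => by
        rw [toAdd_mul, Prod.fst_add, Prod.snd_add, ofAdd_add, ofAdd_add, map_mul, map_mul]
        ring }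
  scale_wt := by
    rintro z (a | b)
    · change c.scale z.fst (Multiplicative.ofAdd (HomogCoords.wt a)) * c'.scale z.snd 1 =
        evalAt (Y := VProd Y Z) (rename Sum.inl (c.den a)) z
      rw [VProd.evalAt_rename_inl, c.scale_wt, map_one, mul_one]
    · change c.scale z.fst 1 * c'.scale z.snd (Multiplicative.ofAdd (HomogCoords.wt b)) =
        evalAt (Y := VProd Y Z) (rename Sum.inr (c'.den b)) z
      rw [VProd.evalAt_rename_inr, c'.scale_wt, map_one, one_mul]
  scale_ne_zero z hz m := by
    refine mul_ne_zero (c.scale_ne_zero _ (fun a => ?_) _) (c'.scale_ne_zero _ (fun b => ?_) _)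
    · have := hz (Sum.inl a)
      rwa [Sum.elim_inl, VProd.evalAt_rename_inl] at this
    · have := hz (Sum.inr b)
      rwa [Sum.elim_inr, VProd.evalAt_rename_inr] at this
  exists_point x hx := by
    obtain ⟨y, hy, hyx⟩ := c.exists_point (fun a => x (Sum.inl a)) fun a => by
      have := hx (Sum.inl a)
      rwa [Sum.elim_inl, eval_rename] at this
    obtain ⟨z, hz, hzx⟩ := c'.exists_point (fun b => x (Sum.inr b)) fun b => by
      have := hx (Sum.inr b)
      rwa [Sum.elim_inr, eval_rename] at this
    refine ⟨⟨y, z⟩, ?_, ?_⟩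
    · rintro (a | b)
      · rw [Sum.elim_inl, VProd.evalAt_rename_inl]
        exact hy a
      · rw [Sum.elim_inr, VProd.evalAt_rename_inr]
        exact hz b
    · rintro (a | b)
      · rw [Sum.elim_inl, VProd.evalAt_rename_inl]
        exact hyx a
      · rw [Sum.elim_inr, VProd.evalAt_rename_inr]
        exact hzx b
  ext_point := by
    intro y z hy hz h
    ext1
    · refine c.ext_point _ _ (fun a => ?_) (fun a => ?_) fun a => ?_
      · have := hy (Sum.inl a)
        rwa [Sum.elim_inl, VProd.evalAt_rename_inl] at this
      · have := hz (Sum.inl a)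
        rwa [Sum.elim_inl, VProd.evalAt_rename_inl] at this
      · have := h (Sum.inl a)
        rwa [Sum.elim_inl, VProd.evalAt_rename_inl, VProd.evalAt_rename_inl] at this
    · refine c'.ext_point _ _ (fun a => ?_) (fun a => ?_) fun a => ?_
      · have := hy (Sum.inr a)
        rwa [Sum.elim_inr, VProd.evalAt_rename_inr] at this
      · have := hz (Sum.inr a)
        rwa [Sum.elim_inr, VProd.evalAt_rename_inr] at this
      · have := h (Sum.inr a)
        rwa [Sum.elim_inr, VProd.evalAt_rename_inr, VProd.evalAt_rename_inr] at this

theorem Chart.mem_prod_dom {Y Z : Type} [HomogCoords Y] [HomogCoords Z] {c : Chart Y}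
    {c' : Chart Z} {z : VProd Y Z} : z ∈ (c.prod c').dom ↔ z.fst ∈ c.dom ∧ z.snd ∈ c'.dom := by
  constructor
  · intro h
    refine ⟨fun a => ?_, fun b => ?_⟩
    · have := h (Sum.inl a)
      rwa [← VProd.evalAt_rename_inl (Z := Z) (c.den a) z]
    · have := h (Sum.inr b)
      rwa [← VProd.evalAt_rename_inr (Y := Y) (c'.den b) z]
  · rintro ⟨h1, h2⟩ (a | b)
    · exact (VProd.evalAt_rename_inl (Z := Z) (c.den a) z).trans_ne (h1 a)
    · exact (VProd.evalAt_rename_inr (Y := Y) (c'.den b) z).trans_ne (h2 b)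

theorem Chart.prod_aff_inl {Y Z : Type} [HomogCoords Y] [HomogCoords Z] (c : Chart Y)
    (c' : Chart Z) (z : VProd Y Z) (a : HomogCoords.idx Y) :
    (c.prod c').aff z (Sum.inl a) = c.aff z.fst a := by
  change HomogCoords.coord z.fst a / evalAt (Y := VProd Y Z) (rename Sum.inl (c.den a)) z = _
  rw [VProd.evalAt_rename_inl]
  rfl

theorem Chart.prod_aff_inr {Y Z : Type} [HomogCoords Y] [HomogCoords Z] (c : Chart Y)
    (c' : Chart Z) (z : VProd Y Z) (b : HomogCoords.idx Z) :
    (c.prod c').aff z (Sum.inr b) = c'.aff z.snd b := by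
  change HomogCoords.coord z.snd b / evalAt (Y := VProd Y Z) (rename Sum.inr (c'.den b)) z = _
  rw [VProd.evalAt_rename_inr]
  rfl

theorem PSpace.exists_mem_chart {n : ℕ} (p : PSpace n) :
    ∃ c : Chart (PSpace n), p ∈ c.dom := by
  obtain ⟨i, hi⟩ := Function.ne_iff.1 p.rep_nonzero
  exact ⟨PSpace.chart n i, PSpace.mem_chart_dom.2 hi⟩

theorem VProd.exists_mem_chart {Y Z : Type} [HomogCoords Y] [HomogCoords Z]
    (hY : ∀ y : Y, ∃ c : Chart Y, y ∈ c.dom) (hZ : ∀ z : Z, ∃ c : Chart Z, z ∈ c.dom)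
    (y : VProd Y Z) : ∃ c : Chart (VProd Y Z), y ∈ c.dom := by
  obtain ⟨c, hc⟩ := hY y.fst
  obtain ⟨c', hc'⟩ := hZ y.snd
  exact ⟨c.prod c', Chart.mem_prod_dom.2 ⟨hc, hc'⟩⟩

end Charts

/-! ### Krull dimension and transcendence degree of finitely generated domains. -/

section KrullDimension

/-- Lying over starts the chain and going up prolongs it; keeping track of the last prime is what
the induction needs. -/
theorem exists_ltSeries_comap_of_isIntegral {R S : Type*} [CommRing R] [CommRing S] [Algebra R S]
    [Algebra.IsIntegral R S] (hinj : Function.Injective (algebraMap R S))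
    (l : LTSeries (PrimeSpectrum R)) : ∃ L : LTSeries (PrimeSpectrum S), L.length = l.length ∧
      PrimeSpectrum.comap (algebraMap R S) L.last = l.last := by
  induction l using RelSeries.inductionOn' with
  | singleton p =>
    obtain ⟨Q, -, hQ, e⟩ := Ideal.exists_ideal_over_prime_of_isIntegral (S := S) p.asIdeal ⊥ (by
      rw [← RingHom.ker_eq_comap_bot, (RingHom.injective_iff_ker_eq_bot _).1 hinj]
      exact bot_le)
    exact ⟨RelSeries.singleton _ ⟨Q, hQ⟩, rfl, PrimeSpectrum.ext e⟩
  | snoc l p hp ih =>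
    obtain ⟨L, hL, e⟩ := ih
    have hle : Ideal.comap (algebraMap R S) L.last.asIdeal ≤ p.asIdeal := by
      have h := congrArg PrimeSpectrum.asIdeal e
      rw [PrimeSpectrum.comap_asIdeal] at h
      rw [h]
      exact le_of_lt hp
    obtain ⟨Q, hQL, hQ, e'⟩ := Ideal.exists_ideal_over_prime_of_isIntegral p.asIdeal _ hle
    have hlt : L.last < ⟨Q, hQ⟩ := by
      refine lt_of_le_of_ne hQL fun h => ?_
      have h1 : l.last = p := by
        rw [← e, h]
        exact PrimeSpectrum.ext e'
      exact absurd hp (by rw [h1]; exact lt_irrefl p)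
    refine ⟨L.snoc ⟨Q, hQ⟩ hlt, ?_, ?_⟩
    · simp [hL]
    · rw [RelSeries.last_snoc, RelSeries.last_snoc]
      exact PrimeSpectrum.ext e'

/-- Incomparability of primes with the same contraction gives one inequality, lifting of chains the
other. -/
theorem ringKrullDim_eq_of_isIntegral {R S : Type*} [CommRing R] [CommRing S] [Algebra R S]
    [Algebra.IsIntegral R S] (hinj : Function.Injective (algebraMap R S)) :
    ringKrullDim S = ringKrullDim R := by
  refine le_antisymm ?_ ?_
  · refine Order.krullDim_le_of_strictMono (PrimeSpectrum.comap (algebraMap R S)) fun P Q h => ?_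
    exact Ideal.IsIntegral.comap_lt_comap h
  · refine iSup_le fun l => ?_
    obtain ⟨L, hL, -⟩ := exists_ltSeries_comap_of_isIntegral hinj l
    rw [← hL]
    exact le_iSup (fun p : LTSeries (PrimeSpectrum S) => (p.length : WithBot ℕ∞)) L

/-- The Krull dimension of a finitely generated domain over a field is its transcendence
degree. -/
theorem exists_ringKrullDim_eq_trdeg (k A : Type) [Field k] [CommRing A] [IsDomain A]
    [Algebra k A] [Algebra.FiniteType k A] :
    ∃ s : ℕ, ringKrullDim A = s ∧ Algebra.trdeg k A = s := by
  -- Noether normalization: both invariants are read off from a polynomial ring in `s` variables.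
  obtain ⟨s, g, hinj, hint⟩ := exists_integral_inj_algHom_of_fg k A
  let := g.toRingHom.toAlgebra
  have : IsScalarTower k (MvPolynomial (Fin s) k) A := .of_algHom g
  have : Algebra.IsIntegral (MvPolynomial (Fin s) k) A := ⟨hint⟩
  have : FaithfulSMul (MvPolynomial (Fin s) k) A :=
    (faithfulSMul_iff_algebraMap_injective _ _).2 hinj
  refine ⟨s, ?_, ?_⟩
  · rw [ringKrullDim_eq_of_isIntegral (R := MvPolynomial (Fin s) k) hinj,
      MvPolynomial.ringKrullDim_of_isNoetherianRing, ringKrullDim_eq_zero_of_field]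
    simp
  · rw [← trdeg_add_eq k (MvPolynomial (Fin s) k) (A := A), trdeg_eq_zero (R := MvPolynomial (Fin s) k) (A := A), add_zero,
      MvPolynomial.trdeg_of_isDomain]
    simp

end KrullDimension

/-! ### Topological dimension of closed sets via coordinate rings. -/

section Dimension

open MvPolynomial TopologicalSpace

theorem isIrreducible_preimage_val {T : Type*} [TopologicalSpace T] {W Z : Set T}
    (hZ : IsIrreducible Z) (h : Z ⊆ W) : IsIrreducible (Subtype.val ⁻¹' Z : Set W) := by
  obtain ⟨⟨z, hz⟩, hpre⟩ := hZ
  refine ⟨⟨⟨z, h hz⟩, hz⟩, ?_⟩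
  rintro _ _ ⟨U, hU, rfl⟩ ⟨V, hV, rfl⟩ ⟨x, hx, hxU⟩ ⟨y, hy, hyV⟩
  obtain ⟨t, ht, htU, htV⟩ := hpre U V hU hV ⟨x, hx, hxU⟩ ⟨y, hy, hyV⟩
  exact ⟨⟨t, h ht⟩, ht, htU, htV⟩

/-- The irreducible closed subsets of a closed subspace. -/
def irreducibleClosedsOrderIso {T : Type*} [TopologicalSpace T] {W : Set T} (hW : IsClosed W) :
    IrreducibleCloseds W ≃o {Z : IrreducibleCloseds T // (Z : Set T) ⊆ W} where
  toFun s := ⟨⟨Subtype.val '' (s : Set W),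
    s.isIrreducible.image _ continuous_subtype_val.continuousOn,
    hW.isClosedEmbedding_subtypeVal.isClosedMap _ s.isClosed⟩, by
      rintro _ ⟨x, -, rfl⟩
      exact x.2⟩
  invFun Z := ⟨Subtype.val ⁻¹' (Z.1 : Set T), isIrreducible_preimage_val Z.1.isIrreducible Z.2,
    Z.1.isClosed.preimage continuous_subtype_val⟩
  left_inv s := IrreducibleCloseds.ext (Set.preimage_image_eq _ Subtype.val_injective)
  right_inv Z := Subtype.ext (IrreducibleCloseds.ext (by
    change Subtype.val '' (Subtype.val ⁻¹' (Z.1 : Set T)) = (Z.1 : Set T)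
    rw [Subtype.image_preimage_coe]
    exact Set.inter_eq_right.2 Z.2))
  map_rel_iff' {s t} := Set.image_subset_image_iff Subtype.val_injective

theorem topologicalKrullDim_eq_krullDim {T : Type*} [TopologicalSpace T] {W : Set T}
    (hW : IsClosed W) : topologicalKrullDim W =
      Order.krullDim {Z : IrreducibleCloseds T // (Z : Set T) ⊆ W} :=
  Order.krullDim_eq_of_orderIso (irreducibleClosedsOrderIso hW)

/-- Every chain inside `Z` can be prolonged by `W` itself, so chains in `Z` are shorter by at least
one. -/
theorem topologicalKrullDim_lt_of_ssubset {T : Type*} [TopologicalSpace T] {Z W : Set T} {s : ℕ}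
    (hZ : IsClosed Z) (hW : IsClosed W) (hWi : IsIrreducible W)
    (h : Z ⊂ W) (hs : topologicalKrullDim W = s) : topologicalKrullDim Z < s := by
  rw [topologicalKrullDim_eq_krullDim hZ]
  rw [topologicalKrullDim_eq_krullDim hW] at hs
  have key : ∀ l : LTSeries {V : IrreducibleCloseds T // (V : Set T) ⊆ Z}, l.length + 1 ≤ s := by
    intro l
    let l' : LTSeries {V : IrreducibleCloseds T // (V : Set T) ⊆ W} :=
      l.map (fun V => ⟨V.1, V.2.trans h.1⟩) (fun a b hab => hab)
    have hlt : l'.last < ⟨⟨W, hWi, hW⟩, subset_rfl⟩ := by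
      have h1 : (l'.last.1 : Set T) ⊆ Z := l.last.2
      exact ⟨fun x hx => h.1 (h1 hx), fun hle => h.2 fun x hx => h1 (hle hx)⟩
    have h2 := Order.LTSeries.length_le_krullDim (l'.snoc _ hlt)
    rw [hs] at h2
    exact_mod_cast h2
  -- For `s = 0` there is no chain in `Z` at all and its dimension is `⊥`; otherwise `s - 1` is a
  -- true predecessor.
  rcases Nat.eq_zero_or_pos s with rfl | hpos
  · have : IsEmpty {V : IrreducibleCloseds T // (V : Set T) ⊆ Z} :=
      ⟨fun V => absurd (key (RelSeries.singleton _ V)) (by simp)⟩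
    rw [Order.krullDim_eq_bot]
    exact WithBot.bot_lt_coe _
  · have h3 : Order.krullDim {V : IrreducibleCloseds T // (V : Set T) ⊆ Z} ≤ ((s - 1 : ℕ) : ℕ∞) :=
      iSup_le fun l => by
        have := key l
        have h4 : l.length ≤ s - 1 := by omega
        exact_mod_cast h4
    refine h3.trans_lt ?_
    have : s - 1 < s := by omega
    exact_mod_cast this

namespace Chart

variable {Y : Type} [HomogCoords Y] (c : Chart Y)

theorem ideal_anti {Z W : Set Y} (h : Z ⊆ W) : c.ideal W ≤ c.ideal Z := fun _ hf =>
  c.mem_ideal.2 fun y hy hyd => c.mem_ideal.1 hf y (h hy) hyd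

/-- If the ideals agreed, every homogeneous equation of `Z` would vanish on the affine part of `W`;
that part is generic, so `W` would lie in `Z`. -/
theorem ideal_lt_ideal [Finite (HomogCoords.idx Y)] {Z W : Set Y} (hZ : IsClosed Z)
    (hW : IsIrreducible W) (hd : (W ∩ c.dom).Nonempty) (hZW : Z ⊂ W) :
    c.ideal W < c.ideal Z := by
  refine ⟨c.ideal_anti hZW.1, fun hle => hZW.2 ?_⟩
  refine subset_of_mem_genericFilter hW hZ ?_
  filter_upwards [inter_mem_genericFilter hW c.isOpen_dom hd] with y hy
  by_contra hyZ
  obtain ⟨m, F, hF, hF0, hFy⟩ := exists_homog_of_notMem hZ hyZ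
  refine hFy ((c.evalAt_eq_zero_iff hy.2 hF).2 (c.mem_ideal.1 (hle ?_) y hy.1 hy.2))
  exact c.mem_ideal.2 fun z hz hzd => (c.evalAt_eq_zero_iff hzd hF).1 (hF0 z hz)

theorem ideal_closure {V : Set Y} (hV : V ⊆ c.dom) : c.ideal (closure V) = c.ideal V := by
  refine le_antisymm (c.ideal_anti subset_closure) fun f hf => c.mem_ideal.2 fun y hy hyd => ?_
  obtain ⟨m, F, G, hF, hG, H⟩ := c.exists_homogenization f
  have h0 : closure V ⊆ {y | evalAt F y = 0} :=
    closure_minimal (fun z hz => by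
      obtain ⟨h1, h2⟩ := H z (hV hz)
      rw [c.mem_ideal.1 hf z hz (hV hz), eq_comm, div_eq_zero_iff, or_iff_left h1] at h2
      exact h2) (isClosed_setOf_evalAt_eq_zero hF)
  rw [(H y hyd).2, show evalAt F y = 0 from h0 hy, zero_div]

/-- The points in the domain of a chart where the polynomials of an ideal vanish. -/
def locus (P : Ideal (MvPolynomial (HomogCoords.idx Y) ℂ)) : Set Y :=
  {y | y ∈ c.dom ∧ ∀ f ∈ P, eval (c.aff y) f = 0}

/-- Because of these relations every zero of an ideal above `c.ideal W` is the coordinate vector of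
a point of the chart. -/
theorem den_sub_one_mem_ideal (W : Set Y) (a : HomogCoords.idx Y) :
    c.den a - 1 ∈ c.ideal W := c.mem_ideal.2 fun y _ hyd => by
  rw [map_sub, c.eval_aff_den hyd, map_one, sub_self]

theorem exists_mem_locus {W : Set Y} {P : Ideal (MvPolynomial (HomogCoords.idx Y) ℂ)}
    (hP : c.ideal W ≤ P) {x : HomogCoords.idx Y → ℂ} (hx : ∀ f ∈ P, eval x f = 0) :
    ∃ y ∈ c.locus P, c.aff y = x := by
  obtain ⟨y, hy, rfl⟩ := c.exists_aff_eq (x := x) fun a => by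
    have := hx _ (hP (c.den_sub_one_mem_ideal W a))
    rwa [map_sub, map_one, sub_eq_zero] at this
  exact ⟨y, ⟨hy, hx⟩, rfl⟩

/-- The Nullstellensatz for the prime `P`, transported from affine space to the chart by
`exists_mem_locus`. -/
theorem ideal_locus [Finite (HomogCoords.idx Y)] {W : Set Y}
    {P : Ideal (MvPolynomial (HomogCoords.idx Y) ℂ)}
    [P.IsPrime] (hP : c.ideal W ≤ P) : c.ideal (c.locus P) = P := by
  have h := MvPolynomial.IsPrime.vanishingIdeal_zeroLocus (K := ℂ) P
  refine Eq.trans ?_ h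
  ext f
  rw [mem_ideal, mem_vanishingIdeal_iff]
  constructor
  · intro H x hx
    obtain ⟨y, hy, rfl⟩ := c.exists_mem_locus hP (x := x) fun f hf => hx f hf
    exact H y hy hy.1
  · intro H y hy _
    exact H _ fun f hf => hy.2 f hf

/-- Forms detecting two open sets that meet the locus lie outside `P`, hence so does their product.
By `ideal_locus` the product is nonzero at some point of the locus, which then lies in both open
sets. -/
theorem isIrreducible_locus [Finite (HomogCoords.idx Y)] {W : Set Y}
    {P : Ideal (MvPolynomial (HomogCoords.idx Y) ℂ)}
    [hprime : P.IsPrime] (hP : c.ideal W ≤ P) : IsIrreducible (c.locus P) := by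
  constructor
  · by_contra hne
    rw [Set.not_nonempty_iff_eq_empty] at hne
    refine hprime.ne_top ((Ideal.eq_top_iff_one _).2 ?_)
    rw [← c.ideal_locus hP, mem_ideal, hne]
    exact fun y hy => hy.elim
  · rintro U V hU hV ⟨y, hy, hyU⟩ ⟨z, hz, hzV⟩
    obtain ⟨k, F, hF, hF0, hFy⟩ := exists_homog_of_notMem hU.isClosed_compl
      (y := y) (fun h => h hyU)
    obtain ⟨l, G, hG, hG0, hGz⟩ := exists_homog_of_notMem hV.isClosed_compl
      (y := z) (fun h => h hzV)
    have hFP : F ∉ P := fun h => hFy ((c.evalAt_eq_zero_iff hy.1 hF).2 (hy.2 F h))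
    have hGP : G ∉ P := fun h => hGz ((c.evalAt_eq_zero_iff hz.1 hG).2 (hz.2 G h))
    have hFG : F * G ∉ c.ideal (c.locus P) := by
      rw [c.ideal_locus hP]
      exact fun h => (hprime.mem_or_mem h).elim hFP hGP
    rw [mem_ideal] at hFG
    push Not at hFG
    obtain ⟨x, hx, hxd, hne⟩ := hFG
    rw [map_mul] at hne
    refine ⟨x, hx, ?_, ?_⟩
    · by_contra hxU
      exact left_ne_zero_of_mul hne ((c.evalAt_eq_zero_iff hxd hF).1 (hF0 x hxU))
    · by_contra hxV
      exact right_ne_zero_of_mul hne ((c.evalAt_eq_zero_iff hxd hG).1 (hG0 x hxV))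

theorem locus_subset {W : Set Y} (hW : IsClosed W)
    {P : Ideal (MvPolynomial (HomogCoords.idx Y) ℂ)} (hP : c.ideal W ≤ P) : c.locus P ⊆ W := by
  intro y hy
  by_contra hyW
  obtain ⟨m, F, hF, hF0, hFy⟩ := exists_homog_of_notMem hW hyW
  refine hFy ((c.evalAt_eq_zero_iff hy.1 hF).2 (hy.2 F (hP ?_)))
  exact c.mem_ideal.2 fun z hz hzd => (c.evalAt_eq_zero_iff hzd hF).1 (hF0 z hz)

theorem exists_ringKrullDim_coordRing [Finite (HomogCoords.idx Y)] {W : Set Y}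
    (hW : IsIrreducible W) (h : c.dom ∈ genericFilter W) :
    ∃ s : ℕ, ringKrullDim (c.coordRing W) = s ∧ Algebra.trdeg ℂ (ratFun W) = s := by
  have := c.isPrime_ideal hW h
  rw [← c.trdeg_coordRing hW h]
  exact exists_ringKrullDim_eq_trdeg ℂ (c.coordRing W)

/-- Chains of irreducible closed sets through a point give chains of prime ideals. -/
theorem length_le_ringKrullDim [Finite (HomogCoords.idx Y)] {W : Set Y}
    (l : LTSeries {Z : IrreducibleCloseds Y // (Z : Set Y) ⊆ W})
    (hl : ((l.head.1 : Set Y) ∩ c.dom).Nonempty) :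
    (l.length : WithBot ℕ∞) ≤ ringKrullDim (c.coordRing W) := by
  have hne : ∀ i, (((l i).1 : Set Y) ∩ c.dom).Nonempty := fun i =>
    hl.mono (Set.inter_subset_inter_left _ (LTSeries.head_le l i))
  have hprime : ∀ i, (c.ideal ((l i).1 : Set Y)).IsPrime := fun i =>
    c.isPrime_ideal (l i).1.isIrreducible
      (open_mem_genericFilter (l i).1.isIrreducible c.isOpen_dom (hne i))
  have hle : ∀ i, c.ideal W ≤ c.ideal ((l i).1 : Set Y) := fun i => c.ideal_anti (l i).2
  rw [ringKrullDim_quotient]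
  -- Vanishing ideals reverse inclusions, so the chain is read backwards with `Fin.rev`.
  refine Order.LTSeries.length_le_krullDim (LTSeries.mk l.length
    (fun i => (⟨⟨c.ideal ((l i.rev).1 : Set Y), hprime _⟩, hle _⟩ :
      PrimeSpectrum.zeroLocus (c.ideal W : Set (MvPolynomial (HomogCoords.idx Y) ℂ))))
    fun i j hij => ?_)
  refine c.ideal_lt_ideal (l j.rev).1.isClosed (l i.rev).1.isIrreducible (hne _) ?_
  exact l.strictMono (Fin.rev_lt_rev.2 hij)

/-- Closures of zero loci turn a chain of primes into a chain of irreducible closed sets; the steps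
stay strict because each prime is recovered as the ideal of its locus. -/
theorem ringKrullDim_coordRing_le [Finite (HomogCoords.idx Y)] {W : Set Y} (hW : IsClosed W) :
    ringKrullDim (c.coordRing W) ≤
      Order.krullDim {Z : IrreducibleCloseds Y // (Z : Set Y) ⊆ W} := by
  rw [ringKrullDim_quotient]
  refine iSup_le fun l => ?_
  have hirr : ∀ i, IsIrreducible (c.locus (l i).1.asIdeal) := fun i =>
    c.isIrreducible_locus (l i).2
  refine Order.LTSeries.length_le_krullDim (LTSeries.mk l.length
    (fun i => (⟨⟨closure (c.locus (l i.rev).1.asIdeal), (hirr _).closure, isClosed_closure⟩,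
      closure_minimal (c.locus_subset hW (l i.rev).2) hW⟩ :
        {Z : IrreducibleCloseds Y // (Z : Set Y) ⊆ W})) fun i j hij => ?_)
  have hlt : (l j.rev).1.asIdeal < (l i.rev).1.asIdeal := l.strictMono (Fin.rev_lt_rev.2 hij)
  refine ⟨closure_mono fun y hy => ⟨hy.1, fun f hf => hy.2 f (hlt.le hf)⟩, fun hle => ?_⟩
  have h1 := c.ideal_anti (show closure (c.locus (l j.rev).1.asIdeal) ⊆
    closure (c.locus (l i.rev).1.asIdeal) from hle)
  rw [c.ideal_closure fun y hy => hy.1, c.ideal_closure fun y hy => hy.1,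
    c.ideal_locus (l i.rev).2, c.ideal_locus (l j.rev).2] at h1
  exact hlt.not_ge h1

end Chart

/-- The dimension of an irreducible closed set is the transcendence degree of its function
field. -/
theorem exists_topologicalKrullDim_eq_trdeg {Y : Type} [HomogCoords Y]
    [Finite (HomogCoords.idx Y)] (hY : ∀ y : Y, ∃ c : Chart Y, y ∈ c.dom) {W : Set Y}
    (hWc : IsClosed W) (hW : IsIrreducible W) :
    ∃ s : ℕ, topologicalKrullDim W = s ∧ Algebra.trdeg ℂ (ratFun W) = s := by
  obtain ⟨y, hy⟩ := hW.1
  obtain ⟨c, hc⟩ := hY y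
  obtain ⟨s, hs, hs'⟩ := c.exists_ringKrullDim_coordRing hW
    (open_mem_genericFilter hW c.isOpen_dom ⟨y, hy, hc⟩)
  refine ⟨s, ?_, hs'⟩
  rw [topologicalKrullDim_eq_krullDim hWc]
  refine le_antisymm (iSup_le fun l => ?_) (hs ▸ c.ringKrullDim_coordRing_le hWc)
  -- A chart around a point of the smallest member meets every member of the chain. Its coordinate
  -- ring has the same dimension as the one for `c`, both being the transcendence degree of the
  -- function field.
  obtain ⟨z, hz⟩ := l.head.1.isIrreducible.1
  obtain ⟨c', hc'⟩ := hY z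
  obtain ⟨s', hs1, hs2⟩ := c'.exists_ringKrullDim_coordRing hW
    (open_mem_genericFilter hW c'.isOpen_dom ⟨z, l.head.2 hz, hc'⟩)
  rw [hs', Nat.cast_inj] at hs2
  subst hs2
  rw [← hs1]
  exact c'.length_le_ringKrullDim l ⟨z, hz, hc'⟩

end Dimension

/-! ### Morphisms, products, dominant maps and generic fibres. -/

section Morphisms

open MvPolynomial TopologicalSpace Filter Topology

variable {Y Y' : Type} [HomogCoords Y] [HomogCoords Y']

/-- A map which is given locally by homogeneous polynomials. -/
def IsPolyMapOn (W : Set Y) (φ : Y → Y') : Prop :=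
  ∀ y ∈ W, ∃ O : Set Y, IsOpen O ∧ y ∈ O ∧
    ∃ (D : HomogCoords.deg Y' →+ HomogCoords.deg Y)
      (Φ : HomogCoords.idx Y' → MvPolynomial (HomogCoords.idx Y) ℂ),
      (∀ a, IsHomog (Y := Y) (Φ a) (D (HomogCoords.wt a))) ∧
      ∀ z ∈ W ∩ O, ∃ s : Multiplicative (HomogCoords.deg Y') →* ℂ, (∀ m, s m ≠ 0) ∧
        ∀ a, evalAt (Φ a) z =
          s (Multiplicative.ofAdd (HomogCoords.wt a)) * HomogCoords.coord (φ z) a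

theorem evalAt_aeval (Φ : HomogCoords.idx Y' → MvPolynomial (HomogCoords.idx Y) ℂ)
    (F : MvPolynomial (HomogCoords.idx Y') ℂ) (z : Y) :
    evalAt (aeval Φ F) z = eval (fun a => evalAt (Φ a) z) F := by
  have h := comp_aeval_apply (R := ℂ) (f := Φ) (aeval (HomogCoords.coord z)) F
  simpa only [aeval_eq_eval, evalAt] using h

theorem IsPolyMapOn.continuousOn {W : Set Y} {φ : Y → Y'} (h : IsPolyMapOn W φ) :
    ContinuousOn φ W := by
  refine continuousOn_of_locally_continuousOn fun y hy => ?_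
  obtain ⟨O, hO, hyO, D, Φ, hΦ, H⟩ := h y hy
  refine ⟨O, hO, hyO, continuousOn_iff_isClosed.2 fun Z hZ => ?_⟩
  obtain ⟨S, hS, rfl⟩ := isClosed_iff_zeroLocus.1 hZ
  refine ⟨zeroLocus (aeval Φ '' S), isClosed_iff_zeroLocus.2 ⟨_, ?_, rfl⟩, ?_⟩
  · rintro _ ⟨F, hF, rfl⟩
    obtain ⟨m, hm⟩ := hS F hF
    exact ⟨D m, isWeightedHomogeneous_aeval hm D Φ hΦ⟩
  · ext z
    simp only [Set.mem_inter_iff, Set.mem_preimage, and_congr_left_iff, zeroLocus,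
      Set.mem_ofPred_eq, Set.forall_mem_image]
    intro hz
    obtain ⟨s, hs, hz'⟩ := H z hz
    refine forall₂_congr fun F hF => ?_
    obtain ⟨m, hm⟩ := hS F hF
    rw [evalAt_aeval, eval_eq_scale_mul hm s hz', mul_eq_zero, or_iff_right (hs _)]
    rfl

/-- Substituting `Φ` multiplies numerator and denominator of a quotient by the same nonzero factor,
so quotients of forms pull back to quotients of forms. -/
theorem IsPolyMapOn.isMorphismOn {W : Set Y} {W' : Set Y'} {φ : Y → Y'} (h : IsPolyMapOn W φ)
    (hm : Set.MapsTo φ W W') : IsMorphismOn W W' φ where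
  mapsTo := hm
  continuousOn := h.continuousOn
  regular U' f hU' hf y hy := by
    obtain ⟨U, hU, hyU, m, F, G, hF, hG, HFG⟩ := hf (φ y) ⟨hm hy.1, hy.2⟩
    obtain ⟨O, hO, hyO, D, Φ, hΦ, H⟩ := h y hy.1
    obtain ⟨V, hV, hVU⟩ := (continuousOn_iff'.1 h.continuousOn) U hU
    have hyV : y ∈ V := (hVU.subset ⟨hyU, hy.1⟩).1
    refine ⟨O ∩ V, hO.inter hV, ⟨hyO, hyV⟩, D m, aeval Φ F, aeval Φ G,
      isWeightedHomogeneous_aeval hF D Φ hΦ, isWeightedHomogeneous_aeval hG D Φ hΦ, ?_⟩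
    rintro z ⟨⟨hzW, hzU'⟩, hzO, hzV⟩
    have hzU : φ z ∈ U := (hVU.superset ⟨hzV, hzW⟩).1
    obtain ⟨s, hs, hz'⟩ := H z ⟨hzW, hzO⟩
    obtain ⟨h1, h2⟩ := HFG (φ z) ⟨⟨hm hzW, hzU'⟩, hzU⟩
    rw [evalAt_aeval, evalAt_aeval, eval_eq_scale_mul hF s hz', eval_eq_scale_mul hG s hz']
    refine ⟨mul_ne_zero (hs _) h1, ?_⟩
    rw [mul_div_mul_left _ _ (hs _)]
    exact h2

theorem isPolyMapOn_fst (W : Set (VProd Y Y')) : IsPolyMapOn W VProd.fst := fun _ _ =>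
  ⟨Set.univ, isOpen_univ, trivial, AddMonoidHom.inl _ _, fun a => X (Sum.inl a),
    fun a => isWeightedHomogeneous_X ℂ (HomogCoords.wt (Y := VProd Y Y')) (Sum.inl a),
    fun z _ => ⟨1, fun _ => one_ne_zero, fun a => by
      rw [evalAt, eval_X, MonoidHom.one_apply, one_mul]
      rfl⟩⟩

theorem isPolyMapOn_snd (W : Set (VProd Y Y')) : IsPolyMapOn W VProd.snd := fun _ _ =>
  ⟨Set.univ, isOpen_univ, trivial, AddMonoidHom.inr _ _, fun a => X (Sum.inr a),
    fun a => isWeightedHomogeneous_X ℂ (HomogCoords.wt (Y := VProd Y Y')) (Sum.inr a),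
    fun z _ => ⟨1, fun _ => one_ne_zero, fun a => by
      rw [evalAt, eval_X, MonoidHom.one_apply, one_mul]
      rfl⟩⟩

theorem VProd.continuous_fst : Continuous (VProd.fst : VProd Y Y' → Y) :=
  continuousOn_univ.1 (isPolyMapOn_fst _).continuousOn

/-- `VProd` does not carry the product topology, so slices need an argument: fixing one factor
substitutes constants into bihomogeneous equations. -/
theorem continuous_mk_left (y : Y) : Continuous (VProd.mk y : Y' → VProd Y Y') := by
  refine continuous_iff_isClosed.2 fun Z hZ => ?_
  obtain ⟨S, hS, rfl⟩ := isClosed_iff_zeroLocus.1 hZ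
  have : VProd.mk y ⁻¹' (zeroLocus S) = zeroLocus ((aeval (Sum.elim
      (fun a => C (HomogCoords.coord y a)) (fun b => X b)) :
        MvPolynomial (HomogCoords.idx (VProd Y Y')) ℂ →
          MvPolynomial (HomogCoords.idx Y') ℂ) '' S) := by
    ext z
    simp only [zeroLocus, Set.mem_preimage, Set.mem_ofPred_eq, Set.forall_mem_image]
    refine forall₂_congr fun F hF => ?_
    rw [evalAt_aeval (Y' := VProd Y Y') _ F z]
    have : (fun a => evalAt (Y := Y') (Sum.elim (fun a => C (HomogCoords.coord y a))
        (fun b => X b) a) z) = HomogCoords.coord (⟨y, z⟩ : VProd Y Y') := by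
      funext a
      rcases a with a | b
      · exact eval_C _
      · exact eval_X _
    exact iff_of_eq (congrArg (fun x => eval x F = 0) this.symm)
  rw [this, isClosed_iff_zeroLocus]
  refine ⟨_, ?_, rfl⟩
  rintro _ ⟨F, hF, rfl⟩
  obtain ⟨m, hm⟩ := hS F hF
  refine ⟨m.2, isWeightedHomogeneous_aeval hm (AddMonoidHom.snd _ _) _ ?_⟩
  rintro (a | b)
  · exact isWeightedHomogeneous_C _ _
  · exact isWeightedHomogeneous_X ℂ _ b

theorem continuous_mk_right (z : Y') : Continuous (fun y : Y => VProd.mk y z) := by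
  refine continuous_iff_isClosed.2 fun Z hZ => ?_
  obtain ⟨S, hS, rfl⟩ := isClosed_iff_zeroLocus.1 hZ
  have : (fun y : Y => VProd.mk y z) ⁻¹' (zeroLocus S) = zeroLocus ((aeval (Sum.elim
      (fun a => X a) (fun b => C (HomogCoords.coord z b))) :
        MvPolynomial (HomogCoords.idx (VProd Y Y')) ℂ →
          MvPolynomial (HomogCoords.idx Y) ℂ) '' S) := by
    ext y
    simp only [zeroLocus, Set.mem_preimage, Set.mem_ofPred_eq, Set.forall_mem_image]
    refine forall₂_congr fun F hF => ?_
    rw [evalAt_aeval (Y' := VProd Y Y') _ F y]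
    have : (fun a => evalAt (Y := Y) (Sum.elim (fun a => X a)
        (fun b => C (HomogCoords.coord z b)) a) y) = HomogCoords.coord (⟨y, z⟩ : VProd Y Y') := by
      funext a
      rcases a with a | b
      · exact eval_X _
      · exact eval_C _
    exact iff_of_eq (congrArg (fun x => eval x F = 0) this.symm)
  rw [this, isClosed_iff_zeroLocus]
  refine ⟨_, ?_, rfl⟩
  rintro _ ⟨F, hF, rfl⟩
  obtain ⟨m, hm⟩ := hS F hF
  refine ⟨m.1, isWeightedHomogeneous_aeval hm (AddMonoidHom.fst _ _) _ ?_⟩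
  rintro (a | b)
  · exact isWeightedHomogeneous_X ℂ _ a
  · exact isWeightedHomogeneous_C _ _

/-- Only continuity of slices is used. The slices of `U` at `a'` and of `V` at `b'` share a point
`t` of `W`; then the slices of `U` and `V` over `t` are open, meet `W'`, and share a point there. -/
theorem isIrreducible_prod {W : Set Y} {W' : Set Y'} (hW : IsIrreducible W)
    (hW' : IsIrreducible W') : IsIrreducible {z : VProd Y Y' | z.fst ∈ W ∧ z.snd ∈ W'} := by
  obtain ⟨⟨y, hy⟩, hpre⟩ := hW
  obtain ⟨⟨y', hy'⟩, hpre'⟩ := hW'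
  refine ⟨⟨⟨y, y'⟩, hy, hy'⟩, ?_⟩
  rintro U V hU hV ⟨⟨a, a'⟩, ⟨ha, ha'⟩, haU⟩ ⟨⟨b, b'⟩, ⟨hb, hb'⟩, hbV⟩
  obtain ⟨t, ht, htU, htV⟩ := hpre _ _ (hU.preimage (continuous_mk_right a'))
    (hV.preimage (continuous_mk_right b')) ⟨a, ha, haU⟩ ⟨b, hb, hbV⟩
  obtain ⟨t', ht', htU', htV'⟩ := hpre' _ _ (hU.preimage (continuous_mk_left t))
    (hV.preimage (continuous_mk_left t)) ⟨a', ha', htU⟩ ⟨b', hb', htV⟩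
  exact ⟨⟨t, t'⟩, ⟨ht, ht'⟩, htU', htV'⟩

/-- Density of the image gives every nonempty open set of the target a nonempty, hence generic,
preimage; both properties of a generic map follow. -/
theorem IsMorphismOn.isGenericMap {W B : Set Y} {W' B' : Set Y'} {φ : Y → Y'}
    (h : IsMorphismOn B B' φ) (hW : IsIrreducible W) (hW' : IsIrreducible W')
    (hB : B ∈ genericFilter W) (hB' : B' ⊆ W') (hd : W' ⊆ closure (φ '' (W ∩ B))) :
    IsGenericMap φ W W' := by
  have key : ∀ U', IsOpen U' → (W' ∩ U').Nonempty →
      B ∩ φ ⁻¹' U' ∈ genericFilter W := by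
    rintro U' hU' ⟨y', hy', hyU'⟩
    obtain ⟨_, hxU, x, ⟨hxW, hxB⟩, rfl⟩ := mem_closure_iff.1 (hd hy') U' hU' hyU'
    obtain ⟨V, hV, hVU⟩ := (continuousOn_iff'.1 h.continuousOn) U' hU'
    filter_upwards [hB, open_mem_genericFilter hW hV
      ⟨x, hxW, (hVU.subset ⟨hxU, hxB⟩).1⟩] with z hzB hzV
    exact ⟨hzB, (hVU.superset ⟨hzV, hzB⟩).1⟩
  refine ⟨fun S hS => ?_, fun A hA f hf => ?_⟩
  · obtain ⟨U', hU', hne, hsub⟩ := (mem_genericFilter hW').1 hS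
    exact Filter.mem_map.2 (Filter.mem_of_superset (key U' hU' hne)
      fun z hz => hsub ⟨hB' (h.mapsTo hz.1), hz.2⟩)
  · obtain ⟨U', hU', hne, hsub⟩ := (mem_genericFilter hW').1 hA
    exact ⟨_, key U' hU' hne, h.regular U' f hU'
      (hf.mono ((Set.inter_subset_inter_left _ hB').trans hsub))⟩

theorem IsGenericMap.trdeg_le {φ : Y → Y'} {W : Set Y} {W' : Set Y'} (h : IsGenericMap φ W W')
    (hW : IsIrreducible W) (hW' : IsIrreducible W') :
    Algebra.trdeg ℂ (ratFun W') ≤ Algebra.trdeg ℂ (ratFun W) := by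
  let := (isField_ratFun hW).toField
  let := (isField_ratFun hW').toField
  exact trdeg_le_of_injective h.pullback h.pullback.toRingHom.injective

/-- Strictly decreasing closed sets have strictly increasing ideals, and a polynomial ring in
finitely many variables over `ℂ` is noetherian. -/
theorem noetherianSpace [Finite (HomogCoords.idx Y)] : NoetherianSpace Y := by
  refine ((noetherianSpace_TFAE Y).out 0 1).2 ?_
  let I : Closeds Y → Ideal (MvPolynomial (HomogCoords.idx Y) ℂ) := fun Z =>
    Ideal.span {F | (∃ m, IsHomog (Y := Y) F m) ∧ ∀ z ∈ Z, evalAt F z = 0}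
  have hI : StrictAnti I := by
    intro Z Z' h
    refine ⟨Ideal.span_mono fun F hF => ⟨hF.1, fun z hz => hF.2 z (h.le hz)⟩, fun hle => ?_⟩
    refine h.not_ge fun y hy => ?_
    by_contra hyZ
    obtain ⟨m, F, hF, hF0, hFy⟩ := exists_homog_of_notMem Z.isClosed hyZ
    have h1 : F ∈ I Z' := hle (Ideal.subset_span ⟨⟨m, hF⟩, hF0⟩)
    have h2 : I Z' ≤ RingHom.ker (eval (HomogCoords.coord y)) :=
      Ideal.span_le.2 fun G hG => hG.2 y hy
    exact hFy (h2 h1)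
  exact hI.wellFoundedLT

/-- In a map between varieties of equal dimension, the fibres over generic points consist of
generic points. -/
theorem eventually_forall_fiber [Finite (HomogCoords.idx Y)]
    (hY : ∀ y : Y, ∃ c : Chart Y, y ∈ c.dom) {φ : Y → Y'} (hφ : IsMorphismOn Set.univ Set.univ φ)
    {W : Set Y} (hWc : IsClosed W) (hW : IsIrreducible W)
    (hY' : IsIrreducible (Set.univ : Set Y')) {s : ℕ}
    (hs : topologicalKrullDim W = s) (hs' : Algebra.trdeg ℂ (ratFun (Set.univ : Set Y')) = s)
    {P : Y → Prop} (hP : ∀ᶠ y in genericFilter W, P y) :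
    ∀ᶠ u in genericFilter (Set.univ : Set Y'), ∀ y ∈ W, φ y = u → P y := by
  obtain ⟨U, hU, hne, hsub⟩ := (mem_genericFilter hW).1 hP
  have := noetherianSpace (Y := Y)
  have hZc : IsClosed (W \ U) := hWc.sdiff hU
  -- On `W`, the property can fail only on the finitely many pieces `t` of `W \ U`. Each has
  -- dimension less than `s` and so cannot dominate a target of transcendence degree `s`; a generic
  -- `u` avoids the closures of all their images.
  obtain ⟨S, hS, hSc, hirr, hSW⟩ := NoetherianSpace.exists_finite_set_isClosed_irreducible hZc
  have hnd : ∀ t ∈ S, (closure (φ '' t))ᶜ ∈ genericFilter (Set.univ : Set Y') := by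
    intro t ht
    refine open_mem_genericFilter hY' isClosed_closure.isOpen_compl ?_
    rw [Set.univ_inter, Set.nonempty_compl]
    intro hdense
    have htW : t ⊆ W \ U := hSW ▸ Set.subset_sUnion_of_mem ht
    have hlt : t ⊂ W := by
      refine ⟨htW.trans Set.sdiff_subset, fun h => ?_⟩
      obtain ⟨y, hyW, hyU⟩ := hne
      exact (htW (h hyW)).2 hyU
    have hdim := topologicalKrullDim_lt_of_ssubset (hSc t ht) hWc hW hlt hs
    obtain ⟨k, hk, hk'⟩ := exists_topologicalKrullDim_eq_trdeg hY (hSc t ht) (hirr t ht)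
    have hgen : IsGenericMap φ t (Set.univ : Set Y') :=
      hφ.isGenericMap (hirr t ht) hY' Filter.univ_mem subset_rfl
        (by rw [Set.inter_univ, hdense])
    have hle := hgen.trdeg_le (hirr t ht) hY'
    rw [hs', hk', Nat.cast_le] at hle
    rw [hk] at hdim
    have : k < s := by exact_mod_cast hdim
    omega
  filter_upwards [(Filter.biInter_mem hS).2 hnd] with u hu y hyW hyu
  by_contra hPy
  have hyZ : y ∈ W \ U := ⟨hyW, fun hyU => hPy (hsub ⟨hyW, hyU⟩)⟩
  rw [hSW] at hyZ
  obtain ⟨t, ht, hyt⟩ := hyZ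
  exact Set.mem_iInter₂.1 hu t ht (subset_closure ⟨y, hyt, hyu⟩)

end Morphisms

/-! ### Specialization of a finite extension of function fields. -/

section Germs

open Polynomial Filter

/-- Only finitely many coefficients are involved, so their germ equalities hold on one common set of
the filter. -/
theorem eventually_map_eq_of_germ_eq {U : Type} {l : Filter U} {F G : (U → ℂ)[X]}
    (h : F.map (Germ.coeRingHom l) = G.map (Germ.coeRingHom l)) :
    ∀ᶠ u in l, F.map (Pi.evalRingHom (fun _ => ℂ) u) = G.map (Pi.evalRingHom (fun _ => ℂ) u) := by
  have hc : ∀ i, ∀ᶠ u in l, F.coeff i u = G.coeff i u := fun i => by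
    have := congrArg (fun p => p.coeff i) h
    simp only [coeff_map] at this
    exact Germ.coe_eq.1 this
  have hfin : ∀ᶠ u in l, ∀ i ∈ F.support ∪ G.support, F.coeff i u = G.coeff i u :=
    (Filter.eventually_all_finset _).2 fun i _ => hc i
  filter_upwards [hfin] with u hu
  ext i
  rw [coeff_map, coeff_map, Pi.evalRingHom_apply, Pi.evalRingHom_apply]
  by_cases hi : i ∈ F.support ∪ G.support
  · exact hu i hi
  · rw [Finset.mem_union, not_or, notMem_support_iff, notMem_support_iff] at hi
    rw [hi.1, hi.2]

/-- Composition of germs with a map as a ring homomorphism. -/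
def germComap {U V : Type} {lu : Filter U} {lv : Filter V} (φ : V → U) (hφ : Tendsto φ lv lu) :
    lu.Germ ℂ →+* lv.Germ ℂ where
  toFun g := g.compTendsto φ hφ
  map_one' := rfl
  map_zero' := rfl
  map_mul' a b := by
    induction a using Germ.inductionOn
    induction b using Germ.inductionOn
    rfl
  map_add' a b := by
    induction a using Germ.inductionOn
    induction b using Germ.inductionOn
    rfl

variable {U V : Type} {lu : Filter U} {lv : Filter V} {φ : V → U} (hφ : Tendsto φ lv lu)
  {k K : Type} [Field k] [Field K] [Algebra k K] {ι₀ : k →+* lu.Germ ℂ} {ι₁ : K →+* lv.Germ ℂ}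

/-- Lifting to functions, evaluating at `t` and taking germs are compatible ring homomorphisms, so a
relation for `θ` over `k` becomes an identity at the points `v`, eventually. -/
theorem eventually_eval_eq_of_aeval_eq
    (hι : ∀ a, ι₁ (algebraMap k K a) = germComap φ hφ (ι₀ a))
    {H : k[X]} {H' : (U → ℂ)[X]} (hH : H'.map (Germ.coeRingHom lu) = H.map ι₀)
    {θ g : K} {t g' : V → ℂ} (ht : ι₁ θ = (t : lv.Germ ℂ)) (hg : ι₁ g = (g' : lv.Germ ℂ))
    (h : aeval θ H = g) :
    ∀ᶠ v in lv, (H'.map (Pi.evalRingHom (fun _ => ℂ) (φ v))).eval (t v) = g' v := by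
  let κ : (U → ℂ) →+* (V → ℂ) := RingHom.pi fun v => Pi.evalRingHom (fun _ => ℂ) (φ v)
  have hκ : (germComap φ hφ).comp (Germ.coeRingHom lu) = (Germ.coeRingHom lv).comp κ := rfl
  have hι' : ι₁.comp (algebraMap k K) = (germComap φ hφ).comp ι₀ := RingHom.ext hι
  have key : Germ.coeRingHom lv (eval₂ κ t H') = (g' : lv.Germ ℂ) := by
    rw [hom_eval₂, ← hκ, ← eval₂_map, hH, eval₂_map, ← hι', ← hg, ← h, aeval_def, hom_eval₂, ht]
    rfl
  filter_upwards [Germ.coe_eq.1 key] with v hv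
  rw [← hv, eval_map]
  change _ = Pi.evalRingHom (fun _ => ℂ) v (eval₂ κ t H')
  rw [hom_eval₂]
  rfl

/-- The cofactor lifts to a polynomial with functions as coefficients, and the factorization then
specializes at generic `u`. -/
theorem eventually_eval_eq_zero_of_dvd {f H : k[X]} {f' H' : (U → ℂ)[X]}
    (hf : f'.map (Germ.coeRingHom lu) = f.map ι₀) (hH : H'.map (Germ.coeRingHom lu) = H.map ι₀)
    (h : f ∣ H) : ∀ᶠ u in lu, ∀ τ : ℂ, (f'.map (Pi.evalRingHom (fun _ => ℂ) u)).eval τ = 0 →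
      (H'.map (Pi.evalRingHom (fun _ => ℂ) u)).eval τ = 0 := by
  obtain ⟨q, rfl⟩ := h
  obtain ⟨q', hq⟩ := map_surjective (Germ.coeRingHom lu) Quotient.mk_surjective (q.map ι₀)
  have : H'.map (Germ.coeRingHom lu) = (f' * q').map (Germ.coeRingHom lu) := by
    rw [hH, Polynomial.map_mul, Polynomial.map_mul, hf, hq]
  filter_upwards [eventually_map_eq_of_germ_eq this] with u hu τ hτ
  rw [hu, Polynomial.map_mul, eval_mul, hτ, zero_mul]

/-- The generic fibre count in terms of germs. Let `θ` be a primitive element of `K` over `k`: `f`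
specializes its minimal polynomial, `q` expresses the coordinates `xK` as polynomials in `θ`, and `P
/ Q` expresses `θ` through the coordinates. Finitely many identities specialize. Thus roots of `f u`
give zeros of `I` over `u`, while a generic `v` yields the root `P / Q`, from which `q` recovers its
coordinates. Once all points of a fibre are known to be generic, these two assignments are inverse
to each other. -/
theorem exists_generic_fiber [Algebra ℂ k] [Algebra ℂ K] [IsScalarTower ℂ k K]
    [FiniteDimensional k K] [CharZero k] [lv.NeBot]
    (hι : ∀ a, ι₁ (algebraMap k K a) = germComap φ hφ (ι₀ a))
    (hι₀ : ∀ c : ℂ, ι₀ (algebraMap ℂ k c) = ((fun _ => c : U → ℂ) : lu.Germ ℂ))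
    (hι₁ : ∀ c : ℂ, ι₁ (algebraMap ℂ K c) = ((fun _ => c : V → ℂ) : lv.Germ ℂ))
    {σ τ : Type} [Finite σ] [Finite τ] {x : V → σ → ℂ} {y : U → τ → ℂ} {xK : σ → K} {yk : τ → k}
    (hx : ∀ a, ι₁ (xK a) = ((fun v => x v a : V → ℂ) : lv.Germ ℂ))
    (hy : ∀ b, ι₀ (yk b) = ((fun u => y u b : U → ℂ) : lu.Germ ℂ))
    (hgen : ∀ g : K, ∃ P Q : MvPolynomial (σ ⊕ τ) ℂ,
      MvPolynomial.aeval (Sum.elim xK fun b => algebraMap k K (yk b)) Q ≠ 0 ∧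
      g * MvPolynomial.aeval (Sum.elim xK fun b => algebraMap k K (yk b)) Q =
        MvPolynomial.aeval (Sum.elim xK fun b => algebraMap k K (yk b)) P)
    {I : Ideal (MvPolynomial (σ ⊕ τ) ℂ)}
    (hI : ∀ G ∈ I, MvPolynomial.aeval (Sum.elim xK fun b => algebraMap k K (yk b)) G = 0) :
    ∃ (f : U → ℂ[X]) (q : U → σ → ℂ[X]) (P Q : MvPolynomial (σ ⊕ τ) ℂ),
      (∀ᶠ u in lu, (f u).natDegree = Module.finrank k K ∧ (f u).Separable ∧
        ∀ t, (f u).eval t = 0 →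
          (∀ G ∈ I, MvPolynomial.eval (Sum.elim (fun a => (q u a).eval t) (y u)) G = 0) ∧
          MvPolynomial.eval (Sum.elim (fun a => (q u a).eval t) (y u)) P =
            t * MvPolynomial.eval (Sum.elim (fun a => (q u a).eval t) (y u)) Q) ∧
      (∀ᶠ v in lv, MvPolynomial.eval (Sum.elim (x v) (y (φ v))) Q ≠ 0 ∧
        ∀ t, MvPolynomial.eval (Sum.elim (x v) (y (φ v))) P =
            t * MvPolynomial.eval (Sum.elim (x v) (y (φ v))) Q →
          (f (φ v)).eval t = 0 ∧ ∀ a, (q (φ v) a).eval t = x v a) := by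
  have : lu.NeBot := hφ.neBot
  have hsurj : Function.Surjective (Germ.coeRingHom (R := ℂ) lu) := Quotient.mk_surjective
  let pb := Field.powerBasisOfFiniteOfSeparable k K
  obtain ⟨P, Q, hQ, hPQ⟩ := hgen pb.gen
  let f := minpoly k pb.gen
  have hfm : f.Monic := minpoly.monic pb.isIntegral_gen
  -- A monic lift of the same degree keeps its degree under every specialization.
  obtain ⟨f', hf', hfdeg, hfm'⟩ := lifts_and_natDegree_eq_and_monic
    (f := Germ.coeRingHom lu) (p := f.map ι₀)
    ((mem_lifts _).2 (map_surjective _ hsurj _)) (hfm.map ι₀)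
  choose q hq using fun a => pb.exists_eq_aeval' (xK a)
  choose q' hq' using fun a => map_surjective _ hsurj ((q a).map ι₀)
  -- the polynomials in one variable obtained by substituting the coordinates
  let S : MvPolynomial (σ ⊕ τ) ℂ → k[X] :=
    MvPolynomial.aeval (Sum.elim q fun b => C (yk b))
  let S' : MvPolynomial (σ ⊕ τ) ℂ → (U → ℂ)[X] :=
    MvPolynomial.aeval (Sum.elim q' fun b => C fun u => y u b)
  have hSS' : ∀ G, (S' G).map (Germ.coeRingHom lu) = (S G).map ι₀ := by
    intro G
    have h1 : (mapRingHom (Germ.coeRingHom lu)).comp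
        (MvPolynomial.aeval (R := ℂ) (Sum.elim q' fun b => C fun u => y u b)).toRingHom =
        (mapRingHom ι₀).comp
        (MvPolynomial.aeval (R := ℂ) (Sum.elim q fun b => C (yk b))).toRingHom := by
      refine MvPolynomial.ringHom_ext (fun c => ?_) ?_
      · simp only [AlgHom.toRingHom_eq_coe, RingHom.coe_comp, RingHom.coe_coe, Function.comp_apply,
          MvPolynomial.algHom_C, coe_mapRingHom, Polynomial.algebraMap_apply, map_C]
        rw [hι₀]
        rfl
      · rintro (a | b)
        · simpa using hq' a
        · simp only [AlgHom.toRingHom_eq_coe, RingHom.coe_comp, RingHom.coe_coe,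
            Function.comp_apply, MvPolynomial.aeval_X, Sum.elim_inr, coe_mapRingHom, map_C]
          rw [hy]
          rfl
    exact RingHom.congr_fun h1 G
  have hS : ∀ G, aeval pb.gen (S G) =
      MvPolynomial.aeval (Sum.elim xK fun b => algebraMap k K (yk b)) G := by
    intro G
    have h1 : ((aeval pb.gen).restrictScalars ℂ).comp
        (MvPolynomial.aeval (R := ℂ) (Sum.elim q fun b => C (yk b))) =
        MvPolynomial.aeval (Sum.elim xK fun b => algebraMap k K (yk b)) := by
      refine MvPolynomial.algHom_ext ?_
      rintro (a | b)
      · simpa using (hq a).symm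
      · simp
    exact DFunLike.congr_fun h1 G
  have hev : ∀ u t G, ((S' G).map (Pi.evalRingHom (fun _ => ℂ) u)).eval t = MvPolynomial.eval
      (Sum.elim (fun a => ((q' a).map (Pi.evalRingHom (fun _ => ℂ) u)).eval t) (y u)) G := by
    intro u t G
    have h1 : ((evalRingHom t).comp (mapRingHom (Pi.evalRingHom (fun _ => ℂ) u))).comp
        (MvPolynomial.aeval (R := ℂ) (Sum.elim q' fun b => C fun u => y u b)).toRingHom =
        MvPolynomial.eval
          (Sum.elim (fun a => ((q' a).map (Pi.evalRingHom (fun _ => ℂ) u)).eval t) (y u)) := by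
      refine MvPolynomial.ringHom_ext (fun c => ?_) ?_
      · simp
      · rintro (a | b) <;> simp
    exact RingHom.congr_fun h1 G
  have hgerm : ∀ G, ι₁ (MvPolynomial.aeval (Sum.elim xK fun b => algebraMap k K (yk b)) G) =
      ((fun v => MvPolynomial.eval (Sum.elim (x v) (y (φ v))) G : V → ℂ) : lv.Germ ℂ) := by
    intro G
    let E : MvPolynomial (σ ⊕ τ) ℂ →+* (V → ℂ) :=
      RingHom.pi fun v => MvPolynomial.eval (Sum.elim (x v) (y (φ v)))
    have h1 : ι₁.comp
        (MvPolynomial.aeval (R := ℂ) (Sum.elim xK fun b => algebraMap k K (yk b))).toRingHom =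
        (Germ.coeRingHom lv).comp E := by
      refine MvPolynomial.ringHom_ext (fun c => ?_) ?_
      · simp only [AlgHom.toRingHom_eq_coe, RingHom.coe_comp, RingHom.coe_coe, Function.comp_apply,
          MvPolynomial.algHom_C, hι₁]
        exact congrArg (Germ.ofFun) (funext fun v => (MvPolynomial.eval_C c).symm)
      · rintro (a | b)
        · simp only [AlgHom.toRingHom_eq_coe, RingHom.coe_comp, RingHom.coe_coe,
            Function.comp_apply, MvPolynomial.aeval_X, Sum.elim_inl, hx]
          exact congrArg (Germ.ofFun) (funext fun v =>
            (MvPolynomial.eval_X (f := Sum.elim (x v) (y (φ v))) (Sum.inl a)).symm)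
        · simp only [AlgHom.toRingHom_eq_coe, RingHom.coe_comp, RingHom.coe_coe,
            Function.comp_apply, MvPolynomial.aeval_X, Sum.elim_inr, hι, hy]
          exact congrArg (Germ.ofFun) (funext fun v =>
            (MvPolynomial.eval_X (f := Sum.elim (x v) (y (φ v))) (Sum.inr b)).symm)
    exact RingHom.congr_fun h1 G
  have hmin : ∀ H : k[X], aeval pb.gen H = 0 → f ∣ H := fun H => minpoly.dvd k pb.gen
  refine ⟨fun u => f'.map (Pi.evalRingHom (fun _ => ℂ) u),
    fun u a => (q' a).map (Pi.evalRingHom (fun _ => ℂ) u), P, Q, ?_, ?_⟩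
  -- Separability is a Bézout identity and therefore specializes.
  · obtain ⟨a, b, hab⟩ : f.Separable := Algebra.IsSeparable.isSeparable k pb.gen
    obtain ⟨a', ha'⟩ := map_surjective _ hsurj (a.map ι₀)
    obtain ⟨b', hb'⟩ := map_surjective _ hsurj (b.map ι₀)
    have hsep : (a' * f' + b' * derivative f').map (Germ.coeRingHom lu) =
        (1 : (U → ℂ)[X]).map (Germ.coeRingHom lu) := by
      rw [Polynomial.map_add, Polynomial.map_mul, Polynomial.map_mul, ← derivative_map, ha', hb',
        hf', derivative_map, ← Polynomial.map_mul, ← Polynomial.map_mul, ← Polynomial.map_add,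
        hab, Polynomial.map_one, Polynomial.map_one]
    -- Finitely many generators of `I` reduce the claim to a finite intersection of generic
    -- conditions.
    obtain ⟨s, hs⟩ := (isNoetherianRing_iff_ideal_fg _).1 inferInstance I
    have hIu : ∀ᶠ u in lu, ∀ G ∈ s, ∀ t, (f'.map (Pi.evalRingHom (fun _ => ℂ) u)).eval t = 0 →
        ((S' G).map (Pi.evalRingHom (fun _ => ℂ) u)).eval t = 0 :=
      (Filter.eventually_all_finset s).2 fun G hG =>
        eventually_eval_eq_zero_of_dvd hf' (hSS' G)
          (hmin _ ((hS G).trans (hI G (hs ▸ Ideal.subset_span hG))))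
    have hPu := eventually_eval_eq_zero_of_dvd (H := S P - X * S Q) (H' := S' P - X * S' Q) hf'
      (by simp only [Polynomial.map_sub, Polynomial.map_mul, map_X, hSS']) (hmin _ (by
        rw [map_sub, map_mul, aeval_X, hS, hS, ← hPQ, sub_self]))
    filter_upwards [eventually_map_eq_of_germ_eq hsep, hIu, hPu] with u h1 h2 h3
    refine ⟨?_, ⟨a'.map (Pi.evalRingHom (fun _ => ℂ) u),
      b'.map (Pi.evalRingHom (fun _ => ℂ) u), ?_⟩, fun t ht => ⟨fun G hG => ?_, ?_⟩⟩
    · rw [hfm'.natDegree_map, hfdeg, hfm.natDegree_map, pb.natDegree_minpoly, pb.finrank]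
    · rw [derivative_map, ← Polynomial.map_mul, ← Polynomial.map_mul, ← Polynomial.map_add, h1,
        Polynomial.map_one]
    · have hle : I ≤ RingHom.ker (MvPolynomial.eval (Sum.elim
          (fun a => ((q' a).map (Pi.evalRingHom (fun _ => ℂ) u)).eval t) (y u))) := by
        rw [← hs]
        refine Ideal.span_le.2 fun G hG => ?_
        rw [SetLike.mem_coe, RingHom.mem_ker, ← hev]
        exact h2 G hG t ht
      exact hle hG
    · have := h3 t ht
      rw [Polynomial.map_sub, Polynomial.map_mul, map_X, eval_sub, eval_mul, eval_X, hev, hev,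
        sub_eq_zero] at this
      exact this
  · have hQv : ∀ᶠ v in lv, MvPolynomial.eval (Sum.elim (x v) (y (φ v))) Q ≠ 0 := by
      have h1 : ι₁ ((MvPolynomial.aeval (Sum.elim xK fun b => algebraMap k K (yk b)) Q) *
          (MvPolynomial.aeval (Sum.elim xK fun b => algebraMap k K (yk b)) Q)⁻¹) = 1 := by
        rw [mul_inv_cancel₀ hQ, map_one]
      rw [map_mul, hgerm] at h1
      obtain ⟨w, hw⟩ := Quotient.exists_rep (ι₁ (MvPolynomial.aeval
        (Sum.elim xK fun b => algebraMap k K (yk b)) Q)⁻¹)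
      rw [← hw] at h1
      have h2 : (fun v => MvPolynomial.eval (Sum.elim (x v) (y (φ v))) Q * w v) =ᶠ[lv]
        fun _ => 1 := Germ.coe_eq.1 h1
      filter_upwards [h2] with v hv h0
      rw [h0, zero_mul] at hv
      exact zero_ne_one hv
    let t : V → ℂ := fun v => MvPolynomial.eval (Sum.elim (x v) (y (φ v))) P /
      MvPolynomial.eval (Sum.elim (x v) (y (φ v))) Q
    have ht : ι₁ pb.gen = (t : lv.Germ ℂ) := by
      obtain ⟨w, hw⟩ := Quotient.exists_rep (ι₁ pb.gen)
      rw [← hw]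
      have h1 := congrArg ι₁ hPQ
      rw [map_mul, hgerm, hgerm, ← hw] at h1
      have h2 : (fun v => w v * MvPolynomial.eval (Sum.elim (x v) (y (φ v))) Q) =ᶠ[lv]
        fun v => MvPolynomial.eval (Sum.elim (x v) (y (φ v))) P := Germ.coe_eq.1 h1
      refine Germ.coe_eq.2 ?_
      filter_upwards [h2, hQv] with v hv hv'
      exact (eq_div_iff hv').2 hv
    have hfv := eventually_eval_eq_of_aeval_eq hφ hι hf' (g' := fun _ => 0) ht
      (by rw [map_zero]; rfl) (minpoly.aeval k pb.gen)
    have hqv : ∀ᶠ v in lv, ∀ a, ((q' a).map (Pi.evalRingHom (fun _ => ℂ) (φ v))).eval (t v) =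
        x v a :=
      Filter.eventually_all.2 fun a =>
        eventually_eval_eq_of_aeval_eq hφ hι (hq' a) ht (hx a) (hq a).symm
    filter_upwards [hQv, hfv, hqv] with v h1 h2 h3
    refine ⟨h1, fun t' ht' => ?_⟩
    obtain rfl : t' = t v := (eq_div_iff h1).2 ht'.symm
    exact ⟨h2, h3⟩

end Germs

/-! ### Degree of a dominant projection and the size of its generic fibre. -/

section Degree

open MvPolynomial Filter

theorem charZero_ratFun {Y : Type} [HomogCoords Y] {W : Set Y} (hW : IsIrreducible W) :
    CharZero (ratFun W) := by
  let := (isField_ratFun hW).toField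
  exact charZero_of_injective_algebraMap (algebraMap ℂ (ratFun W)).injective

/-- Additivity leaves transcendence degree `0` for the upper extension; its finiteness is checked
first, so that `s` can be cancelled in natural numbers. -/
theorem isAlgebraic_of_trdeg_eq (F k K : Type) [Field F] [Field k] [Field K] [Algebra F k]
    [Algebra F K] [Algebra k K] [IsScalarTower F k K] {s : ℕ} (hk : Algebra.trdeg F k = s)
    (hK : Algebra.trdeg F K = s) : Algebra.IsAlgebraic k K := by
  have h := trdeg_add_eq F k (A := K)
  rw [hk, hK] at h
  have h0 : Algebra.trdeg k K = 0 := by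
    have hfin : Algebra.trdeg k K < Cardinal.aleph0 :=
      (self_le_add_left _ (s : Cardinal)).trans_lt (h.trans_lt Cardinal.natCast_lt_aleph0)
    obtain ⟨t, ht⟩ := Cardinal.lt_aleph0.1 hfin
    rw [ht] at h ⊢
    have : s + t = s := by exact_mod_cast h
    have : t = 0 := by omega
    rw [this, Nat.cast_zero]
  exact trdeg_eq_zero_iff.1 h0

theorem finiteDimensional_of_adjoin {k K σ : Type} [Field k] [Field K] [Algebra k K] [Finite σ]
    [Algebra.IsAlgebraic k K] (x : σ → K) (h : IntermediateField.adjoin k (Set.range x) = ⊤) :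
    FiniteDimensional k K := by
  have : FiniteDimensional k (IntermediateField.adjoin k (Set.range x)) :=
    IntermediateField.finiteDimensional_adjoin fun a _ => Algebra.IsIntegral.isIntegral a
  rw [h] at this
  exact IntermediateField.topEquiv.toLinearEquiv.finiteDimensional

theorem encard_eq_natDegree_of_bijOn {T : Type*} {S : Set T} {f : Polynomial ℂ}
    (hf : f.Separable) {t : T → ℂ} (h : Set.BijOn t S {τ | f.eval τ = 0}) :
    S.encard = f.natDegree := by
  have h1 : {τ | f.eval τ = 0} = ((f.roots.toFinset : Finset ℂ) : Set ℂ) := by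
    ext τ
    simp [hf.ne_zero]
  rw [← h.injOn.encard_image, h.image_eq, h1, Set.encard_coe_eq_coe_finsetCard,
    Multiset.toFinset_card_of_nodup (Polynomial.nodup_roots hf),
    ← (IsAlgClosed.splits f).natDegree_eq_card_roots]

variable {Z Y' : Type} [HomogCoords Z] [HomogCoords Y']

/-- The projection of an irreducible closed subset of a product onto a factor of the same
dimension, if it is dominant: its degree is the number of points in a generic fibre. -/
theorem exists_rank_eq_and_encard_fiber [Finite (HomogCoords.idx Z)]
    [Finite (HomogCoords.idx Y')] (hZ : ∀ y : Z, ∃ c : Chart Z, y ∈ c.dom)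
    (hY' : ∀ y : Y', ∃ c : Chart Y', y ∈ c.dom) {W : Set (VProd Z Y')} (hWc : IsClosed W)
    (hW : IsIrreducible W) (hirr : IsIrreducible (Set.univ : Set Y')) {s : ℕ}
    (hs : topologicalKrullDim W = s) (hs' : Algebra.trdeg ℂ (ratFun (Set.univ : Set Y')) = s)
    (hd : Set.univ ⊆ closure (VProd.snd '' W)) :
    ∃ m : ℕ, Module.rank (pulledBack VProd.snd W (Set.univ : Set Y')) (ratFun W) = m ∧
      ∀ᶠ u in genericFilter (Set.univ : Set Y'), {y | y ∈ W ∧ y.snd = u}.encard = m := by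
  have hcharts : ∀ y : VProd Z Y', ∃ c : Chart (VProd Z Y'), y ∈ c.dom :=
    VProd.exists_mem_chart hZ hY'
  have hmor : IsMorphismOn (Set.univ : Set (VProd Z Y')) Set.univ VProd.snd :=
    (isPolyMapOn_snd _).isMorphismOn (Set.mapsTo_univ _ _)
  have hgm : IsGenericMap VProd.snd W (Set.univ : Set Y') :=
    hmor.isGenericMap hW hirr Filter.univ_mem subset_rfl (by rwa [Set.inter_univ])
  obtain ⟨s₁, h1, h2⟩ := exists_topologicalKrullDim_eq_trdeg hcharts hWc hW
  obtain rfl : s₁ = s := by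
    rw [hs] at h1
    exact_mod_cast h1.symm
  have := charZero_ratFun hirr
  have := genericFilter_neBot hW
  let := (isField_ratFun hW).toField
  let := (isField_ratFun hirr).toField
  let := hgm.pullback.toRingHom.toAlgebra
  have : IsScalarTower ℂ (ratFun (Set.univ : Set Y')) (ratFun W) := .of_algHom hgm.pullback
  have halg := isAlgebraic_of_trdeg_eq ℂ (ratFun (Set.univ : Set Y')) (ratFun W) hs' h2
  obtain ⟨w, hw⟩ := hW.1
  obtain ⟨c, hc⟩ := hZ w.fst
  obtain ⟨c', hc'⟩ := hY' w.snd
  have hdom' : c'.dom ∈ genericFilter (Set.univ : Set Y') :=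
    open_mem_genericFilter hirr c'.isOpen_dom ⟨w.snd, trivial, hc'⟩
  have hdom : (c.prod c').dom ∈ genericFilter W :=
    open_mem_genericFilter hW (c.prod c').isOpen_dom ⟨w, hw, Chart.mem_prod_dom.2 ⟨hc, hc'⟩⟩
  let xK : HomogCoords.idx Z → ratFun W := fun a => (c.prod c').toRat hdom (X (Sum.inl a))
  let yk : HomogCoords.idx Y' → ratFun (Set.univ : Set Y') := fun b => c'.toRat hdom' (X b)
  have hyk : ∀ b, algebraMap (ratFun (Set.univ : Set Y')) (ratFun W) (yk b) =
      (c.prod c').toRat hdom (X (Sum.inr b)) := by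
    intro b
    refine Subtype.ext (Germ.coe_eq.2 (.of_forall fun z => ?_))
    change eval (c'.aff z.snd) (X b) = eval ((c.prod c').aff z) (X (Sum.inr b))
    rw [eval_X, eval_X, Chart.prod_aff_inr]
  have haeval : aeval (Sum.elim xK fun b => algebraMap _ (ratFun W) (yk b)) =
      (c.prod c').toRat hdom := by
    refine algHom_ext fun a => ?_
    rw [aeval_X]
    rcases a with a | b
    · rfl
    · exact hyk b
  -- The coordinates of the second factor are pulled back from the base, so those of the first
  -- factor generate the function field over it.
  have htop : IntermediateField.adjoin (ratFun (Set.univ : Set Y')) (Set.range xK) = ⊤ := by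
    rw [eq_top_iff]
    intro g _
    have hmem : ∀ P, (c.prod c').toRat hdom P ∈
        IntermediateField.adjoin (ratFun (Set.univ : Set Y')) (Set.range xK) := by
      intro P
      induction P using MvPolynomial.induction_on with
      | C r =>
        have : (c.prod c').toRat hdom (C r) = algebraMap (ratFun (Set.univ : Set Y')) (ratFun W)
            (algebraMap ℂ _ r) := by
          rw [← IsScalarTower.algebraMap_apply]
          exact ((c.prod c').toRat hdom).commutes r
        rw [this]
        exact IntermediateField.algebraMap_mem _ _
      | add P Q hP hQ =>
        rw [map_add]
        exact add_mem hP hQ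
      | mul_X P a hP =>
        rw [map_mul]
        refine mul_mem hP ?_
        rcases a with a | b
        · exact IntermediateField.subset_adjoin _ _ ⟨a, rfl⟩
        · rw [← hyk]
          exact IntermediateField.algebraMap_mem _ _
    obtain ⟨P, Q, hQ, e⟩ := (c.prod c').exists_toRat_mul_eq hW hdom g
    rw [← eq_div_iff hQ] at e
    rw [e]
    exact div_mem (hmem P) (hmem Q)
  have hfin := finiteDimensional_of_adjoin xK htop
  obtain ⟨f, q, P, Q, hf, hP⟩ := exists_generic_fiber (φ := VProd.snd) hgm.tendsto
    (k := ratFun (Set.univ : Set Y')) (K := ratFun W)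
    (ι₀ := (ratFun (Set.univ : Set Y')).subtype) (ι₁ := (ratFun W).subtype)
    (fun _ => rfl) (fun _ => rfl) (fun _ => rfl)
    (x := fun z => c.aff z.fst) (y := c'.aff) (xK := xK) (yk := yk)
    (fun a => Germ.coe_eq.2 (.of_forall fun z => (eval_X _).trans (c.prod_aff_inl c' z a)))
    (fun b => Germ.coe_eq.2 (.of_forall fun z => eval_X _))
    (fun g => by
      obtain ⟨P, Q, hQ, e⟩ := (c.prod c').exists_toRat_mul_eq hW hdom g
      refine ⟨P, Q, ?_⟩
      rw [haeval]
      exact ⟨hQ, e⟩)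
    (I := (c.prod c').ideal W) (fun G hG => by
      rw [haeval]
      exact ((c.prod c').toRat_eq_zero_iff_mem hW hdom G).2 hG)
  refine ⟨Module.finrank (ratFun (Set.univ : Set Y')) (ratFun W), ?_, ?_⟩
  · rw [Module.finrank_eq_rank]
    -- Injectivity of pullback identifies the scalars in the two ranks.
    let i : ratFun (Set.univ : Set Y') → pulledBack VProd.snd W (Set.univ : Set Y') := fun g =>
      ⟨hgm.pullback g, hgm.range_pullback ▸ ⟨g, rfl⟩⟩
    refine (rank_eq_of_equiv_equiv i (AddEquiv.refl (ratFun W)) ⟨fun a b hab => ?_, ?_⟩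
      fun _ _ => rfl).symm
    · exact hgm.pullback.toRingHom.injective (congrArg Subtype.val hab)
    · rintro ⟨g, hg⟩
      rw [← hgm.range_pullback] at hg
      obtain ⟨g', rfl⟩ := hg
      exact ⟨g', rfl⟩
  -- For generic `u` every point of the fibre lies in the chart and in the set where `P / Q` is
  -- controlled; there `P / Q` is a bijection onto the roots of `f u`.
  · have hfib := eventually_forall_fiber hcharts hmor hWc hW hirr hs hs' (hP.and hdom)
    filter_upwards [hf, hfib, hdom'] with u hu hfu hud
    obtain ⟨hdeg, hsep, hroot⟩ := hu
    rw [← hdeg]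
    refine encard_eq_natDegree_of_bijOn hsep (t := fun z =>
      eval (Sum.elim (c.aff z.fst) (c'.aff z.snd)) P /
        eval (Sum.elim (c.aff z.fst) (c'.aff z.snd)) Q) ⟨?_, ?_, ?_⟩
    · rintro z ⟨hz, rfl⟩
      obtain ⟨⟨hQ, H⟩, -⟩ := hfu z hz rfl
      exact (H _ (div_mul_cancel₀ _ hQ).symm).1
    · rintro z ⟨hz, hzu⟩ z' ⟨hz', hzu'⟩ heq
      obtain ⟨⟨hQ, H⟩, hd⟩ := hfu z hz hzu
      obtain ⟨⟨hQ', H'⟩, hd'⟩ := hfu z' hz' hzu'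
      have h1 := (H _ (div_mul_cancel₀ _ hQ).symm).2
      have h2 := (H' _ (div_mul_cancel₀ _ hQ').symm).2
      simp only [hzu, hzu'] at heq
      refine (c.prod c').aff_injOn hd hd' (funext ?_)
      rintro (a | b)
      · rw [Chart.prod_aff_inl, Chart.prod_aff_inl, ← h1, ← h2, hzu, hzu']
        exact congrArg (fun t => (q u a).eval t) heq
      · rw [Chart.prod_aff_inr, Chart.prod_aff_inr, hzu, hzu']
    · intro t ht
      obtain ⟨hI, hPQ⟩ := hroot t ht
      obtain ⟨z, hz, hzx⟩ := (c.prod c').exists_mem_locus le_rfl hI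
      have hzW := (c.prod c').locus_subset hWc le_rfl hz
      have hzd := Chart.mem_prod_dom.1 hz.1
      have hzu : z.snd = u := by
        refine c'.aff_injOn hzd.2 hud (funext fun b => ?_)
        rw [← Chart.prod_aff_inr c c' z b, hzx]
        rfl
      have hcoord : Sum.elim (c.aff z.fst) (c'.aff z.snd) =
          Sum.elim (fun a => (q u a).eval t) (c'.aff u) := by
        rw [← hzx]
        funext a
        rcases a with a | b
        · exact (c.prod_aff_inl c' z a).symm
        · exact (c.prod_aff_inr c' z b).symm
      obtain ⟨⟨hQ, -⟩, -⟩ := hfu z hzW hzu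
      refine ⟨z, ⟨hzW, hzu⟩, ?_⟩
      change eval (Sum.elim (c.aff z.fst) (c'.aff z.snd)) P /
        eval (Sum.elim (c.aff z.fst) (c'.aff z.snd)) Q = t
      rw [div_eq_iff hQ, hcoord]
      exact hPQ

end Degree

/-! ### Function fields of projective space and of products with it. -/

section ProjectiveSpace

open MvPolynomial Filter

theorem PSpace.exists_evalAt_mk {n : ℕ} {x : Fin (n + 1) → ℂ} (hx : x ≠ 0) :
    ∃ s : ℂ, s ≠ 0 ∧ ∀ (m : ℕ) (F : MvPolynomial (Fin (n + 1)) ℂ), IsHomog (Y := PSpace n) F m →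
      evalAt (Y := PSpace n) F (Projectivization.mk ℂ x hx) = s ^ m * eval x F := by
  obtain ⟨s, hs, h⟩ := PSpace.exists_rep_mk hx
  refine ⟨s, hs, fun m F hF => ?_⟩
  refine eval_eq_scale_mul (w := fun _ : Fin (n + 1) => (1 : ℕ)) hF (powersHom ℂ s) fun a => ?_
  change (Projectivization.mk ℂ x hx).rep a = s ^ 1 * x a
  rw [h, pow_one]
  rfl

theorem PSpace.isIrreducible_univ (n : ℕ) : IsIrreducible (Set.univ : Set (PSpace n)) := by
  refine ⟨⟨Projectivization.mk ℂ (fun _ => 1) fun h => one_ne_zero (congrFun h 0), trivial⟩, ?_⟩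
  rintro U V hU hV ⟨y, -, hy⟩ ⟨z, -, hz⟩
  obtain ⟨k, F, hF, hF0, hFy⟩ := exists_homog_of_notMem hU.isClosed_compl
    (y := y) (fun h => h hy)
  obtain ⟨l, G, hG, hG0, hGz⟩ := exists_homog_of_notMem hV.isClosed_compl
    (y := z) (fun h => h hz)
  have hFne : F ≠ 0 := fun h => hFy (by rw [h]; exact map_zero _)
  have hGne : G ≠ 0 := fun h => hGz (by rw [h]; exact map_zero _)
  have hXne : (X 0 : MvPolynomial (Fin (n + 1)) ℂ) ≠ 0 := X_ne_zero 0
  -- The extra factor `X 0` forces `x` to be nonzero, so that it represents a projective point.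
  obtain ⟨x, hx⟩ : ∃ x : Fin (n + 1) → ℂ, eval x ((F : MvPolynomial (Fin (n + 1)) ℂ) * G * (X 0 : MvPolynomial (Fin (n + 1)) ℂ)) ≠ 0 := by
    by_contra! h
    exact mul_ne_zero (mul_ne_zero hFne hGne) hXne
      (MvPolynomial.funext fun x => (h x).trans (map_zero _).symm)
  rw [map_mul, map_mul, eval_X] at hx
  have hx0 : x ≠ 0 := fun h => right_ne_zero_of_mul hx (by rw [h]; rfl)
  obtain ⟨s, hs, H⟩ := PSpace.exists_evalAt_mk hx0
  refine ⟨Projectivization.mk ℂ x hx0, trivial, ?_, ?_⟩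
  · by_contra hxU
    have h1 := H k F hF
    rw [hF0 _ hxU] at h1
    exact mul_ne_zero (pow_ne_zero _ hs) (left_ne_zero_of_mul (left_ne_zero_of_mul hx)) h1.symm
  · by_contra hxV
    have h1 := H l G hG
    rw [hG0 _ hxV] at h1
    exact mul_ne_zero (pow_ne_zero _ hs) (right_ne_zero_of_mul (left_ne_zero_of_mul hx)) h1.symm

theorem PSpace.exists_chart_aff_eq {n : ℕ} (t : Fin n → ℂ) :
    ∃ p ∈ (PSpace.chart n 0).dom, (PSpace.chart n 0).aff p = (Fin.cons 1 t : Fin (n + 1) → ℂ) :=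
  (PSpace.chart n 0).exists_aff_eq (x := (Fin.cons 1 t : Fin (n + 1) → ℂ)) fun _ =>
    (eval_X (f := (Fin.cons 1 t : Fin (n + 1) → ℂ)) 0)

theorem PSpace.chart_aff_eq_cons {n : ℕ} {p : PSpace n} (hp : p ∈ (PSpace.chart n 0).dom) :
    (PSpace.chart n 0).aff p =
      (Fin.cons 1 fun i : Fin n => (PSpace.chart n 0).aff p (i.succ : Fin (n + 1)) :
        Fin (n + 1) → ℂ) := by
  funext a
  revert a
  refine Fin.cases ?_ fun i => rfl
  rw [PSpace.chart_aff, div_self (PSpace.mem_chart_dom.1 hp)]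
  rfl

theorem PSpace.chart_dom_mem_genericFilter (n : ℕ) :
    (PSpace.chart n 0).dom ∈ genericFilter (Set.univ : Set (PSpace n)) := by
  obtain ⟨p, hp, -⟩ := PSpace.exists_chart_aff_eq (fun _ : Fin n => 0)
  exact open_mem_genericFilter (PSpace.isIrreducible_univ n) (PSpace.chart n 0).isOpen_dom
    ⟨p, trivial, hp⟩

theorem eval_aeval_cons {n : ℕ} (t : Fin n → ℂ) (f : MvPolynomial (Fin (n + 1)) ℂ) :
    eval t (aeval (Fin.cons 1 X : Fin (n + 1) → MvPolynomial (Fin n) ℂ) f) =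
      eval (Fin.cons 1 t : Fin (n + 1) → ℂ) f := by
  have h := comp_aeval_apply (R := ℂ) (f := (Fin.cons 1 X : Fin (n + 1) → MvPolynomial (Fin n) ℂ))
    (aeval t) f
  rw [aeval_eq_eval, aeval_eq_eval] at h
  refine h.trans (congrArg (fun x => eval x f) (funext fun i => ?_))
  revert i
  refine Fin.cases ?_ fun i => ?_
  · exact map_one _
  · exact eval_X i

/-- Dehomogenization `X 0 ↦ 1` identifies the coordinate ring of the standard chart with a
polynomial ring in `n` variables. -/
theorem PSpace.trdeg_ratFun_univ (n : ℕ) :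
    Algebra.trdeg ℂ (ratFun (Set.univ : Set (PSpace n))) = n := by
  rw [← (PSpace.chart n 0).trdeg_coordRing (PSpace.isIrreducible_univ n)
    (PSpace.chart_dom_mem_genericFilter n)]
  let δ := aeval (R := ℂ) (Fin.cons 1 X : Fin (n + 1) → MvPolynomial (Fin n) ℂ)
  have hsurj : Function.Surjective δ := fun g => by
    refine ⟨rename Fin.succ g, ?_⟩
    change aeval _ (rename _ _) = _
    rw [aeval_rename]
    exact aeval_X_left_apply g
  have hker : RingHom.ker δ = (PSpace.chart n 0).ideal Set.univ := by
    ext f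
    rw [RingHom.mem_ker, Chart.mem_ideal]
    constructor
    · intro h p _ hp
      rw [PSpace.chart_aff_eq_cons hp]
      refine (eval_aeval_cons _ f).symm.trans ?_
      exact (congrArg (eval _) h).trans (map_zero _)
    · intro h
      refine MvPolynomial.funext fun t => ?_
      obtain ⟨p, hp, hpt⟩ := PSpace.exists_chart_aff_eq t
      refine (eval_aeval_cons t f).trans ?_
      rw [map_zero, ← hpt]
      exact h p trivial hp
  have e := (Ideal.quotientEquivAlgOfEq ℂ hker.symm).trans
    (Ideal.quotientKerAlgEquivOfSurjective hsurj)
  rw [e.trdeg_eq, MvPolynomial.trdeg_of_isDomain]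
  simp

theorem trdeg_mvPolynomial (k A : Type) [Field k] [CommRing A] [IsDomain A] [Algebra k A]
    (r : ℕ) : Algebra.trdeg k (MvPolynomial (Fin r) A) = Algebra.trdeg k A + r := by
  rw [← trdeg_add_eq k A (A := MvPolynomial (Fin r) A), MvPolynomial.trdeg_of_isDomain]
  simp

theorem isIrreducible_prod_univ {Y : Type} [HomogCoords Y] {W : Set Y} (hW : IsIrreducible W)
    (r : ℕ) : IsIrreducible {z : VProd Y (PSpace r) | z.fst ∈ W} := by
  have := isIrreducible_prod hW (PSpace.isIrreducible_univ r)
  simpa using this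

/-- The function field of `W × ℙʳ` has transcendence degree `r` over that of `W`. -/
theorem trdeg_ratFun_prod {Y : Type} [HomogCoords Y] [Finite (HomogCoords.idx Y)] {W : Set Y}
    (hW : IsIrreducible W) (hY : ∀ y : Y, ∃ c : Chart Y, y ∈ c.dom) (r : ℕ) :
    Algebra.trdeg ℂ (ratFun {z : VProd Y (PSpace r) | z.fst ∈ W}) =
      Algebra.trdeg ℂ (ratFun W) + r := by
  have hW' := isIrreducible_prod_univ hW r
  obtain ⟨w, hw⟩ := hW.1
  obtain ⟨c, hc⟩ := hY w
  have hdom : c.dom ∈ genericFilter W := open_mem_genericFilter hW c.isOpen_dom ⟨w, hw, hc⟩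
  obtain ⟨p, hp, -⟩ := PSpace.exists_chart_aff_eq (fun _ : Fin r => 0)
  have hdom' : (c.prod (PSpace.chart r 0)).dom ∈
      genericFilter {z : VProd Y (PSpace r) | z.fst ∈ W} :=
    open_mem_genericFilter hW' (c.prod _).isOpen_dom ⟨⟨w, p⟩, hw, Chart.mem_prod_dom.2 ⟨hc, hp⟩⟩
  have hprime := c.isPrime_ideal hW hdom
  rw [← c.trdeg_coordRing hW hdom, ← trdeg_mvPolynomial, ← Chart.trdeg_coordRing _ hW' hdom']
  let x : HomogCoords.idx Y → c.coordRing W := fun a => Ideal.Quotient.mk _ (X a)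
  -- The coordinates of `Y` become constants, those of `ℙʳ` become `1` and the variables; this makes
  -- the coordinate ring of the product a polynomial ring over that of `W`.
  let Φ : HomogCoords.idx Y ⊕ Fin (r + 1) → MvPolynomial (Fin r) (c.coordRing W) :=
    Sum.elim (fun a => C (x a)) (Fin.cons 1 X)
  let δ := aeval (R := ℂ) Φ
  have hxmk : ∀ f : MvPolynomial (HomogCoords.idx Y) ℂ,
      aeval x f = Ideal.Quotient.mk (c.ideal W) f := by
    intro f
    have : aeval x = Ideal.Quotient.mkₐ ℂ (c.ideal W) := algHom_ext fun a => aeval_X _ _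
    exact DFunLike.congr_fun this f
  have hsurj : Function.Surjective δ := by
    intro g
    induction g using MvPolynomial.induction_on with
    | C a =>
      obtain ⟨f, rfl⟩ := Ideal.Quotient.mk_surjective a
      refine ⟨rename Sum.inl f, ?_⟩
      change aeval _ (rename _ _) = _
      rw [aeval_rename, ← hxmk]
      have h := comp_aeval_apply (R := ℂ) (f := x)
        (IsScalarTower.toAlgHom ℂ (c.coordRing W) (MvPolynomial (Fin r) (c.coordRing W))) f
      exact h.symm
    | add f g hf hg =>
      obtain ⟨f, rfl⟩ := hf
      obtain ⟨g, rfl⟩ := hg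
      exact ⟨f + g, map_add _ _ _⟩
    | mul_X f i hf =>
      obtain ⟨f, rfl⟩ := hf
      refine ⟨f * X (Sum.inr i.succ), ?_⟩
      rw [map_mul]
      congr 1
      exact aeval_X _ _
  let ev : ∀ y : Y, y ∈ W → y ∈ c.dom → (c.coordRing W →+* ℂ) := fun y hy hyd =>
    Ideal.Quotient.lift (c.ideal W) (eval (c.aff y)) fun f hf => c.mem_ideal.1 hf y hy hyd
  have hev : ∀ (y : Y) (hy : y ∈ W) (hyd : y ∈ c.dom) (t : Fin r → ℂ) f,
      eval t (map (ev y hy hyd) (δ f)) = eval (Sum.elim (c.aff y) (Fin.cons 1 t)) f := by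
    intro y hy hyd t f
    have h : ((eval t).comp (map (ev y hy hyd))).comp δ.toRingHom =
        eval (Sum.elim (c.aff y) (Fin.cons 1 t)) := by
      refine ringHom_ext (fun a => ?_) ?_
      · change eval t (map (ev y hy hyd) (aeval Φ (C a))) = _
        rw [algHom_C, IsScalarTower.algebraMap_apply ℂ (c.coordRing W)]
        rw [MvPolynomial.algebraMap_eq, map_C, eval_C, eval_C]
        exact eval_C a
      · rintro (a | i)
        · change eval t (map (ev y hy hyd) (aeval Φ (X _))) = _
          rw [aeval_X, eval_X]
          change eval t (map (ev y hy hyd) (C (x a))) = c.aff y a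
          rw [map_C, eval_C]
          exact eval_X a
        · change eval t (map (ev y hy hyd) (aeval Φ (X _))) = _
          rw [aeval_X, eval_X]
          revert i
          refine Fin.cases ?_ fun i => ?_
          · change eval t (map (ev y hy hyd) 1) = 1
            rw [map_one, map_one]
          · change eval t (map (ev y hy hyd) (X i)) = t i
            rw [map_X, eval_X]
    exact RingHom.congr_fun h f
  have hker : RingHom.ker δ =
      (c.prod (PSpace.chart r 0)).ideal {z : VProd Y (PSpace r) | z.fst ∈ W} := by
    ext f
    rw [RingHom.mem_ker, Chart.mem_ideal]
    constructor
    · rintro h ⟨y, q⟩ hy hyq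
      obtain ⟨hyd, hqd⟩ := Chart.mem_prod_dom.1 hyq
      have h1 := hev y hy hyd (fun i => (PSpace.chart r 0).aff q (i.succ : Fin (r + 1))) f
      rw [h, map_zero, map_zero, ← PSpace.chart_aff_eq_cons hqd] at h1
      refine Eq.trans (congrArg (fun z => eval z f) (funext ?_)) h1.symm
      rintro (a | b)
      · exact Chart.prod_aff_inl _ _ _ a
      · exact Chart.prod_aff_inr _ _ _ b
    · intro h
      -- A coefficient is zero in the coordinate ring if it vanishes at every affine point of `W`;
      -- at such a point the specialized polynomial vanishes at all `t`, hence is zero.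
      ext d
      rw [coeff_zero]
      obtain ⟨g, hg⟩ := Ideal.Quotient.mk_surjective (coeff d (δ f))
      rw [← hg, Ideal.Quotient.eq_zero_iff_mem, Chart.mem_ideal]
      intro y hy hyd
      have hzero : map (ev y hy hyd) (δ f) = 0 := by
        refine MvPolynomial.funext fun t => ?_
        obtain ⟨q, hq, hqt⟩ := PSpace.exists_chart_aff_eq t
        refine (hev y hy hyd t f).trans ?_
        rw [map_zero]
        refine Eq.trans (congrArg (fun z => eval z f) (funext ?_))
          (h ⟨y, q⟩ hy (Chart.mem_prod_dom.2 ⟨hyd, hq⟩))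
        rintro (a | b)
        · exact (Chart.prod_aff_inl c (PSpace.chart r 0) ⟨y, q⟩ a).symm
        · exact (congrFun hqt b).symm.trans
            (Chart.prod_aff_inr c (PSpace.chart r 0) ⟨y, q⟩ b).symm
      have h1 := congrArg (coeff d) hzero
      rw [coeff_map, ← hg, coeff_zero] at h1
      exact h1
  have e := (Ideal.quotientEquivAlgOfEq ℂ hker.symm).trans
    (Ideal.quotientKerAlgEquivOfSurjective hsurj)
  exact e.trdeg_eq

end ProjectiveSpace

/-! ### Tangent vectors at the generic point as derivations. -/

section Derivations

theorem exists_comp_eq_of_ker_le {K V V' V'' : Type*} [Field K] [AddCommGroup V] [Module K V]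
    [AddCommGroup V'] [Module K V'] [AddCommGroup V''] [Module K V''] {f : V →ₗ[K] V'}
    {g : V →ₗ[K] V''} (h : LinearMap.ker f ≤ LinearMap.ker g) : ∃ P : V' →ₗ[K] V'', P.comp f = g := by
  obtain ⟨P, hP⟩ := LinearMap.exists_extend
    (((LinearMap.ker f).liftQ g h).comp f.quotKerEquivRange.symm.toLinearMap)
  refine ⟨P, LinearMap.ext fun v => ?_⟩
  have := LinearMap.congr_fun hP ⟨f v, v, rfl⟩
  refine this.trans ?_
  have e : f.quotKerEquivRange.symm ⟨f v, v, rfl⟩ = Submodule.Quotient.mk v := by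
    rw [LinearEquiv.symm_apply_eq]
    rfl
  change (LinearMap.ker f).liftQ g h (f.quotKerEquivRange.symm ⟨f v, v, rfl⟩) = g v
  rw [e]
  rfl

open MvPolynomial TensorProduct

/-- Over a transcendence basis the extension is algebraic and, in characteristic zero, separable,
hence formally étale. Differentials of `K` are then the base change of those of a polynomial ring.
-/
theorem finrank_kaehlerDifferential (k K : Type) [Field k] [CharZero k] [Field K] [Algebra k K]
    {d : ℕ} (h : Algebra.trdeg k K = d) : Module.finrank K Ω[K⁄k] = d := by
  obtain ⟨ι, x, hx⟩ := exists_isTranscendenceBasis' k K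
  let := (aeval (R := k) x).toRingHom.toAlgebra
  have hinj : Function.Injective (algebraMap (MvPolynomial ι k) K) := hx.1
  have : FaithfulSMul (MvPolynomial ι k) K := (faithfulSMul_iff_algebraMap_injective _ _).2 hinj
  have : IsScalarTower k (MvPolynomial ι k) K := .of_algHom (aeval x)
  let := FractionRing.liftAlgebra (MvPolynomial ι k) K
  have : Algebra.IsAlgebraic (MvPolynomial ι k) K := by
    have := hx.isAlgebraic
    exact Algebra.IsAlgebraic.of_ringHom_of_comp_eq hx.1.aevalEquiv (RingHom.id K)
      hx.1.aevalEquiv.surjective Function.injective_id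
      (RingHom.ext fun p => hx.1.algebraMap_aevalEquiv p)
  have : Algebra.IsAlgebraic (FractionRing (MvPolynomial ι k)) K :=
    Algebra.IsAlgebraic.extendScalars (R := MvPolynomial ι k)
      (IsFractionRing.injective (MvPolynomial ι k) (FractionRing (MvPolynomial ι k)))
  have : CharZero (FractionRing (MvPolynomial ι k)) :=
    charZero_of_injective_algebraMap (algebraMap k _).injective
  have : Algebra.FormallyEtale (FractionRing (MvPolynomial ι k)) K :=
    Algebra.FormallyEtale.of_isSeparable _ _
  have : Algebra.FormallyEtale (MvPolynomial ι k) K :=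
    Algebra.FormallyEtale.comp _ (FractionRing (MvPolynomial ι k)) K
  rw [← (KaehlerDifferential.tensorKaehlerEquivOfFormallyEtale k (MvPolynomial ι k) K).finrank_eq,
    Module.finrank_eq_nat_card_basis ((KaehlerDifferential.mvPolynomialBasis k ι).baseChange K)]
  rw [← hx.cardinalMk_eq_trdeg] at h
  exact Nat.card_eq_of_bijective (α := ι) _ Function.bijective_id |>.symm.trans
    (by rw [Nat.card, h, Cardinal.toNat_natCast])

/-- Localization is formally étale, so the differentials of `A` and `K` agree after base change to
`K`; derivations into `K` are the dual space. -/
theorem finrank_derivation (k A K : Type) [Field k] [CharZero k] [CommRing A] [IsDomain A]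
    [Field K] [Algebra k A] [Algebra A K] [Algebra k K] [IsScalarTower k A K]
    [IsFractionRing A K] {d : ℕ} (h : Algebra.trdeg k K = d) :
    Module.finrank K (Derivation k A K) = d := by
  have : Algebra.FormallyEtale A K := Algebra.FormallyEtale.of_isLocalization (nonZeroDivisors A)
  let e : (Ω[K⁄k] →ₗ[K] K) ≃ₗ[K] (K ⊗[A] Ω[A⁄k] →ₗ[K] K) :=
    LinearEquiv.congrLeft K K
      (KaehlerDifferential.tensorKaehlerEquivOfFormallyEtale k A K).symm
  let e₁ : (Ω[A⁄k] →ₗ[A] K) ≃ₗ[K] (K ⊗[A] Ω[A⁄k] →ₗ[K] K) := LinearMap.liftBaseChangeEquiv K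
  let e₂ : (Ω[A⁄k] →ₗ[A] K) ≃ₗ[K] Derivation k A K :=
    { (KaehlerDifferential.linearMapEquivDerivation k A (M := K)) with
      map_smul' := fun c f => rfl }
  rw [← (e.trans (e₁.symm.trans e₂)).finrank_eq]
  have := Subspace.dual_finrank_eq (K := K) (V := Ω[K⁄k])
  rw [← finrank_kaehlerDifferential k K h]
  exact this

/-- The tangent vectors with values in `K` of the closed subscheme of affine space defined by `I`,
at the point with coordinates `x`. -/
def tangentVectors {k K σ : Type} [Field k] [Field K] [Algebra k K] [Fintype σ]
    (I : Ideal (MvPolynomial σ k)) (x : σ → K) : Submodule K (σ → K) where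
  carrier := {w | ∀ f ∈ I, ∑ i, aeval x (pderiv i f) * w i = 0}
  add_mem' {a b} ha hb f hf := by
    simp only [Pi.add_apply, mul_add, Finset.sum_add_distrib, ha f hf, hb f hf, add_zero]
  zero_mem' f _ := by simp
  smul_mem' c a ha f hf := by
    simp only [Pi.smul_apply, smul_eq_mul, mul_left_comm _ c, ← Finset.mul_sum, ha f hf, mul_zero]

theorem sum_pderiv_mul {k K σ : Type} [Field k] [Field K] [Algebra k K] [Fintype σ]
    (x w : σ → K) (f g : MvPolynomial σ k) :
    ∑ i, aeval x (pderiv i (f * g)) * w i =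
      aeval x f * ∑ i, aeval x (pderiv i g) * w i + aeval x g * ∑ i, aeval x (pderiv i f) * w i := by
  simp only [Derivation.leibniz, smul_eq_mul, map_add, map_mul, add_mul, Finset.sum_add_distrib,
    Finset.mul_sum, mul_assoc]

/-- At a common zero of the generators the product rule kills the derivative of every multiplier. -/
theorem mem_tangentVectors_span {k K σ : Type} [Field k] [Field K] [Algebra k K] [Fintype σ]
    {S : Set (MvPolynomial σ k)} {x w : σ → K} (hx : ∀ f ∈ S, aeval x f = 0) :
    w ∈ tangentVectors (Ideal.span S) x ↔ ∀ f ∈ S, ∑ i, aeval x (pderiv i f) * w i = 0 := by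
  refine ⟨fun h f hf => h f (Ideal.subset_span hf), fun h f hf => ?_⟩
  suffices aeval x f = 0 ∧ ∑ i, aeval x (pderiv i f) * w i = 0 from this.2
  induction hf using Submodule.span_induction with
  | mem f hf => exact ⟨hx f hf, h f hf⟩
  | zero => simp
  | add f g _ _ hf hg =>
    simp only [map_add, add_mul, Finset.sum_add_distrib, hf.1, hg.1, hf.2, hg.2, add_zero, and_self]
  | smul a f _ hf =>
    rw [smul_eq_mul, sum_pderiv_mul, map_mul, hf.1, hf.2]
    simp

/-- A derivation of `A` into `K` is determined by its values on the coordinates, and a vector arises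
in this way exactly when the differentials of all relations kill it. -/
theorem finrank_tangentVectors_ker {k K A σ : Type} [Field k] [CharZero k] [Field K] [CommRing A]
    [IsDomain A] [Algebra k A] [Algebra k K] [Algebra A K] [IsScalarTower k A K]
    [IsFractionRing A K] [Fintype σ] (π : MvPolynomial σ k →ₐ[k] A) (hπ : Function.Surjective π)
    {d : ℕ} (h : Algebra.trdeg k K = d) :
    Module.finrank K (tangentVectors (RingHom.ker π) fun i => algebraMap A K (π (X i))) = d := by
  classical
  rw [← finrank_derivation k A K h]
  generalize hx : (fun i => algebraMap A K (π (X i))) = x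
  have hmk : ∀ f, algebraMap A K (π f) = aeval x f := by
    intro f
    have : (IsScalarTower.toAlgHom k A K).comp π = aeval x := by
      refine algHom_ext fun i => ?_
      rw [aeval_X, ← hx]
      rfl
    exact DFunLike.congr_fun this f
  have hval : ∀ (D : Derivation k A K) f,
      D (π f) = ∑ i, aeval x (pderiv i f) * D (π (X i)) := by
    intro D f
    induction f using MvPolynomial.induction_on with
    | C r =>
      simp only [pderiv_C, map_zero, zero_mul, Finset.sum_const_zero]
      rw [algHom_C]
      exact D.map_algebraMap r
    | add f g hf hg =>
      simp only [map_add, hf, hg, add_mul, Finset.sum_add_distrib]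
    | mul_X f j hf =>
      rw [sum_pderiv_mul, map_mul, D.leibniz, ← hf, Algebra.smul_def, Algebra.smul_def, hmk, hmk]
      congr 2
      rw [Finset.sum_eq_single j]
      · simp
      · intro i _ hij
        simp [pderiv_X_of_ne hij.symm]
      · simp
  let T : Derivation k A K →ₗ[K] (σ → K) :=
    { toFun := fun D i => D (π (X i))
      map_add' := fun _ _ => rfl
      map_smul' := fun _ _ => rfl }
  have hinj : Function.Injective T := by
    intro D D' hDD
    refine Derivation.ext fun a => ?_
    obtain ⟨f, rfl⟩ := hπ a
    rw [hval, hval]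
    exact Finset.sum_congr rfl fun i _ => congrArg _ (congrFun hDD i)
  have hrange : LinearMap.range T = tangentVectors (RingHom.ker π) x := by
    ext w
    constructor
    · rintro ⟨D, rfl⟩ f hf
      refine (hval D f).symm.trans ?_
      rw [RingHom.mem_ker.1 hf, map_zero]
    · intro hw
      let L : MvPolynomial σ k →ₗ[k] K :=
        ∑ i, (LinearMap.mulRight k (w i)).comp
          ((aeval x).toLinearMap.comp (pderiv (R := k) i : Derivation k _ _).toLinearMap)
      have hL : ∀ f, L f = ∑ i, aeval x (pderiv i f) * w i := fun f => by
        simp [L, LinearMap.sum_apply]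
      obtain ⟨D₀, hD₀⟩ := exists_comp_eq_of_ker_le (f := π.toLinearMap) (g := L)
        fun f hf => (hL f).trans (hw f hf)
      let D : Derivation k A K := Derivation.mk' D₀ (by
          intro a b
          obtain ⟨f, rfl⟩ := hπ a
          obtain ⟨g, rfl⟩ := hπ b
          rw [Algebra.smul_def, Algebra.smul_def, hmk, hmk, ← map_mul]
          have hD : ∀ f, D₀ (π f) = L f := fun f => LinearMap.congr_fun hD₀ f
          rw [hD, hD, hD, hL, hL, hL, sum_pderiv_mul])
      refine ⟨D, funext fun j => ?_⟩
      refine (LinearMap.congr_fun hD₀ (X j)).trans ?_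
      rw [hL, Finset.sum_eq_single j]
      · simp
      · intro i _ hij
        simp [pderiv_X_of_ne hij.symm]
      · simp
  rw [← hrange]
  exact (LinearMap.finrank_range_of_inj hinj).symm ▸ rfl

end Derivations

/-! ### Kernel dimensions certified by matrix identities. -/

section LinearAlgebra

/-- A splitting of the kernel of a matrix. -/
theorem exists_kernel_splitting {K m n : Type} [Field K] [Fintype m] [Fintype n] [DecidableEq m]
    [DecidableEq n] (J : Matrix m n K) {d : ℕ}
    (h : Module.finrank K (LinearMap.ker J.mulVecLin) = d) :
    ∃ (W : Matrix n (Fin d) K) (C : Matrix (Fin d) n K) (P : Matrix n m K),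
      J * W = 0 ∧ C * W = 1 ∧ P * J + W * C = 1 := by
  let b := Module.finBasisOfFinrankEq K _ h
  let w : (Fin d → K) →ₗ[K] (n → K) :=
    (LinearMap.ker J.mulVecLin).subtype.comp b.equivFun.symm.toLinearMap
  have hw : LinearMap.ker w = ⊥ := LinearMap.ker_eq_bot.2
    (Subtype.val_injective.comp b.equivFun.symm.injective)
  obtain ⟨c, hc⟩ := w.exists_leftInverse_of_injective hw
  have hker : LinearMap.ker J.mulVecLin ≤ LinearMap.ker (LinearMap.id - w.comp c) := by
    intro v hv
    obtain ⟨a, ha⟩ := b.equivFun.symm.surjective ⟨v, hv⟩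
    have hva : w a = v := congrArg Subtype.val ha
    rw [LinearMap.mem_ker, LinearMap.sub_apply, LinearMap.comp_apply, ← hva,
      ← LinearMap.comp_apply c w, hc, LinearMap.id_apply, LinearMap.id_apply, sub_self]
  obtain ⟨p, hp⟩ := exists_comp_eq_of_ker_le hker
  have hJ : Matrix.toLin' J = J.mulVecLin := rfl
  refine ⟨LinearMap.toMatrix' w, LinearMap.toMatrix' c, LinearMap.toMatrix' p, ?_, ?_, ?_⟩
  · apply Matrix.toLin'.injective
    rw [Matrix.toLin'_mul, Matrix.toLin'_toMatrix', map_zero]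
    exact LinearMap.ext fun a => (b.equivFun.symm a).2
  · rw [← LinearMap.toMatrix'_comp, hc, LinearMap.toMatrix'_id]
  · apply Matrix.toLin'.injective
    rw [map_add, Matrix.toLin'_mul, Matrix.toLin'_mul, Matrix.toLin'_toMatrix',
      Matrix.toLin'_toMatrix', Matrix.toLin'_toMatrix', hJ, hp, Matrix.toLin'_one, sub_add_cancel]

/-- Three matrix identities certify the dimension of a kernel; unlike the dimension itself, they
specialize directly from a function field to points. -/
theorem finrank_ker_of_splitting {K m n : Type} [Field K] [Fintype m] [Fintype n]
    [DecidableEq n] {J : Matrix m n K} {d : ℕ} {W : Matrix n (Fin d) K}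
    {C : Matrix (Fin d) n K} {P : Matrix n m K} (h₁ : J * W = 0) (h₂ : C * W = 1)
    (h₃ : P * J + W * C = 1) : Module.finrank K (LinearMap.ker J.mulVecLin) = d := by
  have hinj : Function.Injective W.mulVecLin := by
    refine Function.LeftInverse.injective (g := C.mulVecLin) fun a => ?_
    simp only [Matrix.mulVecLin_apply, Matrix.mulVec_mulVec, h₂, Matrix.one_mulVec]
  have hrange : LinearMap.range W.mulVecLin = LinearMap.ker J.mulVecLin := by
    ext v
    constructor
    · rintro ⟨a, rfl⟩
      simp only [LinearMap.mem_ker, Matrix.mulVecLin_apply, Matrix.mulVec_mulVec, h₁,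
        Matrix.zero_mulVec]
    · intro hv
      rw [LinearMap.mem_ker, Matrix.mulVecLin_apply] at hv
      refine ⟨C.mulVec v, ?_⟩
      have := congrArg (fun A => Matrix.mulVec A v) h₃
      simp only [Matrix.add_mulVec, ← Matrix.mulVec_mulVec, hv, Matrix.mulVec_zero, zero_add,
        Matrix.one_mulVec] at this
      exact this
  rw [← hrange, LinearMap.finrank_range_of_inj hinj, Module.finrank_fin_fun]

end LinearAlgebra

/-! ### Tangent spaces at generic points. -/

section GenericTangent

open MvPolynomial Filter

theorem eventually_map_eq_of_map_coe_eq {Y m n : Type} [Finite m] [Finite n] {l : Filter Y}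
    {A B : Matrix m n (Y → ℂ)} (h : A.map (Germ.coeRingHom l) = B.map (Germ.coeRingHom l)) :
    ∀ᶠ y in l, A.map (Pi.evalRingHom (fun _ => ℂ) y) = B.map (Pi.evalRingHom (fun _ => ℂ) y) := by
  have h' : ∀ᶠ y in l, ∀ i j, A i j y = B i j y :=
    eventually_all.2 fun i => eventually_all.2 fun j =>
      Germ.coe_eq.1 (congrFun (congrFun h i) j)
  filter_upwards [h'] with y hy
  ext i j
  exact hy i j

theorem exists_map_coe_eq {Y m n : Type} {l : Filter Y} (A : Matrix m n (l.Germ ℂ)) :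
    ∃ A' : Matrix m n (Y → ℂ), A'.map (Germ.coeRingHom l) = A := by
  choose A' hA' using fun i j => Quotient.exists_rep (A i j)
  exact ⟨Matrix.of A', Matrix.ext hA'⟩

/-- The splitting matrices over `K` lift to matrices of functions, and the identities between germs
hold pointwise, eventually. -/
theorem eventually_finrank_ker {Y m n : Type} [Fintype m] [Fintype n] [DecidableEq m]
    [DecidableEq n] {l : Filter Y} {K : Type} [Field K] (ι : K →+* l.Germ ℂ) {J : Matrix m n K}
    {d : ℕ} (h : Module.finrank K (LinearMap.ker J.mulVecLin) = d) {J' : Matrix m n (Y → ℂ)}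
    (hJ' : J'.map (Germ.coeRingHom l) = J.map ι) :
    ∀ᶠ y in l, Module.finrank ℂ
      (LinearMap.ker (J'.map (Pi.evalRingHom (fun _ => ℂ) y)).mulVecLin) = d := by
  obtain ⟨W, C, P, h₁, h₂, h₃⟩ := exists_kernel_splitting J h
  obtain ⟨W', hW'⟩ := exists_map_coe_eq (W.map ι)
  obtain ⟨C', hC'⟩ := exists_map_coe_eq (C.map ι)
  obtain ⟨P', hP'⟩ := exists_map_coe_eq (P.map ι)
  have e₁ : (J' * W').map (Germ.coeRingHom l) =
      (0 : Matrix m (Fin d) (Y → ℂ)).map (Germ.coeRingHom l) := by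
    rw [Matrix.map_mul, hJ', hW', ← Matrix.map_mul, h₁, Matrix.map_zero _ (map_zero _),
      Matrix.map_zero _ (map_zero _)]
  have e₂ : (C' * W').map (Germ.coeRingHom l) =
      (1 : Matrix (Fin d) (Fin d) (Y → ℂ)).map (Germ.coeRingHom l) := by
    rw [Matrix.map_mul, hC', hW', ← Matrix.map_mul, h₂,
      Matrix.map_one _ (map_zero _) (map_one _), Matrix.map_one _ (map_zero _) (map_one _)]
  have e₃ : (P' * J' + W' * C').map (Germ.coeRingHom l) =
      (1 : Matrix n n (Y → ℂ)).map (Germ.coeRingHom l) := by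
    rw [Matrix.map_add _ (map_add _), Matrix.map_mul, Matrix.map_mul, hC', hW', hP', hJ',
      ← Matrix.map_mul, ← Matrix.map_mul, ← Matrix.map_add _ (map_add _), h₃,
      Matrix.map_one _ (map_zero _) (map_one _), Matrix.map_one _ (map_zero _) (map_one _)]
  filter_upwards [eventually_map_eq_of_map_coe_eq e₁, eventually_map_eq_of_map_coe_eq e₂,
    eventually_map_eq_of_map_coe_eq e₃] with y h₁ h₂ h₃
  rw [Matrix.map_mul, Matrix.map_zero _ (map_zero _)] at h₁
  rw [Matrix.map_mul, Matrix.map_one _ (map_zero _) (map_one _)] at h₂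
  rw [Matrix.map_add _ (map_add _), Matrix.map_mul, Matrix.map_mul,
    Matrix.map_one _ (map_zero _) (map_one _)] at h₃
  exact finrank_ker_of_splitting h₁ h₂ h₃

theorem tangentVectors_span_range {k K σ : Type} [Field k] [Field K] [Algebra k K] [Fintype σ]
    {m : Type} (f : m → MvPolynomial σ k) {x : σ → K} (hx : ∀ j, aeval x (f j) = 0) :
    tangentVectors (Ideal.span (Set.range f)) x =
      LinearMap.ker (Matrix.of fun j i => aeval x (pderiv i (f j))).mulVecLin := by
  ext w
  rw [mem_tangentVectors_span (Set.forall_mem_range.2 hx), Set.forall_mem_range, LinearMap.mem_ker,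
    funext_iff]
  rfl

/-- At a generic point of `W` the dimension of the tangent space is that of `W`. -/
theorem Chart.eventually_finrank_tangentVectors {Y : Type} [HomogCoords Y] (c : Chart Y)
    [Fintype (HomogCoords.idx Y)] {W : Set Y} (hW : IsIrreducible W)
    (h : c.dom ∈ genericFilter W) {d : ℕ} (hd : Algebra.trdeg ℂ (ratFun W) = d) :
    ∀ᶠ y in genericFilter W, Module.finrank ℂ (tangentVectors (c.ideal W) (c.aff y)) = d := by
  classical
  let := (isField_ratFun hW).toField
  let := (c.coordRingToRat hW h).toRingHom.toAlgebra
  have := c.isFractionRing_coordRing hW h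
  have hprime := c.isPrime_ideal hW h
  have : IsScalarTower ℂ (c.coordRing W) (ratFun W) := .of_algHom (c.coordRingToRat hW h)
  have key := finrank_tangentVectors_ker (k := ℂ) (A := c.coordRing W) (K := ratFun W)
    (Ideal.Quotient.mkₐ ℂ (c.ideal W)) (Ideal.Quotient.mkₐ_surjective _ _) hd
  obtain ⟨m, f, hf⟩ := Submodule.fg_iff_exists_fin_generating_family.1
    (IsNoetherian.noetherian (c.ideal W))
  have hf' : c.ideal W = Ideal.span (Set.range f) := hf.symm
  have hfm : ∀ j, f j ∈ c.ideal W := fun j => hf' ▸ Ideal.subset_span ⟨j, rfl⟩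
  have hx : ∀ g, aeval (fun i => algebraMap (c.coordRing W) (ratFun W)
      (Ideal.Quotient.mkₐ ℂ (c.ideal W) (X i))) g = c.toRat h g := by
    intro g
    have : aeval (fun i => c.toRat h (X i)) = c.toRat h := algHom_ext fun i => aeval_X _ _
    exact DFunLike.congr_fun this g
  have hker : RingHom.ker (Ideal.Quotient.mkₐ ℂ (c.ideal W)) = Ideal.span (Set.range f) := by
    rw [← hf']
    exact Ideal.Quotient.mkₐ_ker ℂ (c.ideal W)
  rw [hker, tangentVectors_span_range f fun j => by
    rw [hx, c.toRat_eq_zero_iff_mem hW h]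
    exact hfm j] at key
  have key' := eventually_finrank_ker (ratFun W).subtype key
    (J' := Matrix.of fun j i y => eval (c.aff y) (pderiv i (f j))) (by
      ext j i
      exact (congrArg Subtype.val (hx (pderiv i (f j)))).symm)
  filter_upwards [key', h, self_mem_genericFilter hW] with y hy hyd hyW
  rw [hf', tangentVectors_span_range f fun j => ?_]
  · exact hy
  · rw [aeval_eq_eval]
    exact c.mem_ideal.1 (hfm j) y hyW hyd

end GenericTangent

/-! ### Comparison of affine and cone tangent spaces. -/

section ConeTangent

open MvPolynomial Filter

instance (n : ℕ) : Fintype (HomogCoords.idx (PSpace n)) := inferInstanceAs (Fintype (Fin (n + 1)))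

theorem eval_smul_of_isHomogeneous {σ : Type} {F : MvPolynomial σ ℂ} {m : ℕ}
    (hF : F.IsHomogeneous m) (s : ℂ) (x : σ → ℂ) : eval (s • x) F = s ^ m * eval x F :=
  eval_eq_scale_mul hF (powersHom ℂ s) fun a => by
    change s * x a = s ^ 1 * x a
    rw [pow_one]

/-- The coordinates of a point in the standard chart. -/
def PSpace.affineRep {n : ℕ} (i : Fin (n + 1)) (p : PSpace n) : Fin (n + 1) → ℂ :=
  (PSpace.chart n i).aff p

theorem PSpace.affineRep_self {n : ℕ} {i : Fin (n + 1)} {p : PSpace n} (hp : p.rep i ≠ 0) :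
    PSpace.affineRep i p i = 1 :=
  (PSpace.chart_aff i p i).trans (div_self hp)

theorem PSpace.rep_eq_smul_aff {n : ℕ} {i : Fin (n + 1)} {p : PSpace n} (hp : p.rep i ≠ 0) :
    p.rep = p.rep i • (PSpace.affineRep i p) := by
  funext a
  rw [Pi.smul_apply, PSpace.affineRep, PSpace.chart_aff, smul_eq_mul, mul_div_cancel₀ _ hp]

variable {n : ℕ} {X : Set (PSpace n)} {p : PSpace n}

/-- Partial derivatives of a form are again forms, so normalizing the representative only multiplies
the equations by nonzero factors. -/
theorem mem_coneTangent_iff_aff {i : Fin (n + 1)} (hp : p.rep i ≠ 0) {w : Fin (n + 1) → ℂ} :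
    w ∈ coneTangent X p ↔ ∀ (k : ℕ) (F : MvPolynomial (Fin (n + 1)) ℂ), F.IsHomogeneous k →
      (∀ x ∈ X, eval x.rep F = 0) →
        ∑ j, eval (PSpace.affineRep i p) (pderiv j F) * w j = 0 := by
  refine forall₄_congr fun k F hF hX => ?_
  have h : ∀ j, eval p.rep (pderiv j F) * w j = p.rep i ^ (k - 1) *
      (eval (PSpace.affineRep i p) (pderiv j F) * w j) := by
    intro j
    rw [← mul_assoc, ← eval_smul_of_isHomogeneous (hF.pderiv (i := j)), ← PSpace.rep_eq_smul_aff hp]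
  rw [Finset.sum_congr rfl fun j _ => h j, ← Finset.mul_sum, mul_eq_zero,
    or_iff_right (pow_ne_zero _ hp)]

theorem sum_pderiv_mul_self {σ : Type} [Fintype σ] {F : MvPolynomial σ ℂ} {k : ℕ}
    (hF : F.IsHomogeneous k) (x : σ → ℂ) : ∑ j, eval x (pderiv j F) * x j = k * eval x F := by
  have h := congrArg (eval x) hF.sum_X_mul_pderiv
  simp only [map_sum, map_mul, eval_X, nsmul_eq_mul, map_natCast] at h
  rw [← h]
  exact Finset.sum_congr rfl fun j _ => mul_comm _ _

/-- Homogenization by powers of `X i`, which are invisible on the slice `x i = 1`, also to first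
order in directions along the slice. -/
theorem exists_isHomogeneous_eq {σ : Type} [Fintype σ] (i : σ) (f : MvPolynomial σ ℂ) :
    ∃ (N : ℕ) (F : MvPolynomial σ ℂ), F.IsHomogeneous N ∧
      (∀ x : σ → ℂ, x i = 1 → eval x F = eval x f) ∧
      ∀ x w : σ → ℂ, x i = 1 → w i = 0 →
        ∑ j, eval x (pderiv j F) * w j = ∑ j, eval x (pderiv j f) * w j := by
  classical
  have hX : ∀ (k : ℕ) (x : σ → ℂ), x i = 1 → eval x (X i ^ k : MvPolynomial σ ℂ) = 1 := by
    intro k x hx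
    rw [map_pow, eval_X, hx, one_pow]
  have hdX : ∀ (k : ℕ) (x w : σ → ℂ), w i = 0 →
      ∑ j, eval x (pderiv j (X i ^ k : MvPolynomial σ ℂ)) * w j = 0 := by
    intro k x w hw
    refine Finset.sum_eq_zero fun j _ => ?_
    by_cases hj : j = i
    · rw [hj, hw, mul_zero]
    · rw [Derivation.leibniz_pow, pderiv_X_of_ne (Ne.symm hj)]
      simp
  refine ⟨f.totalDegree, ∑ k ∈ Finset.range (f.totalDegree + 1),
    X i ^ (f.totalDegree - k) * homogeneousComponent k f, ?_, ?_, ?_⟩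
  · refine IsHomogeneous.sum _ _ _ fun k hk => ?_
    have h := ((isHomogeneous_X ℂ i).pow (f.totalDegree - k)).mul
      (homogeneousComponent_isHomogeneous k f)
    have e : 1 * (f.totalDegree - k) + k = f.totalDegree := by
      have := Finset.mem_range.1 hk
      omega
    rwa [e] at h
  · intro x hx
    conv_rhs => rw [← sum_homogeneousComponent f]
    rw [map_sum, map_sum]
    refine Finset.sum_congr rfl fun k _ => ?_
    rw [map_mul, hX _ x hx, one_mul]
  · intro x w hx hw
    conv_rhs => rw [← sum_homogeneousComponent f]
    simp only [map_sum, Finset.sum_mul]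
    rw [Finset.sum_comm]
    conv_rhs => rw [Finset.sum_comm]
    refine Finset.sum_congr rfl fun k _ => ?_
    have h := sum_pderiv_mul (k := ℂ) x w (X i ^ (f.totalDegree - k)) (homogeneousComponent k f)
    simp only [aeval_eq_eval] at h
    refine h.trans ?_
    rw [hX _ x hx, hdX _ x w hw, one_mul, mul_zero, add_zero]

theorem mem_tangentVectors_iff_mem_coneTangent {i : Fin (n + 1)} (hp : p.rep i ≠ 0)
    {w : Fin (n + 1) → ℂ} :
    w ∈ tangentVectors (σ := Fin (n + 1)) ((PSpace.chart n i).ideal X) (PSpace.affineRep i p) ↔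
      w ∈ coneTangent X p ∧ w i = 0 := by
  rw [mem_coneTangent_iff_aff hp]
  have hai := PSpace.affineRep_self hp
  constructor
  · intro hw
    constructor
    · intro k F hF hX
      refine hw F ((PSpace.chart n i).mem_ideal.2 fun x hx hxd => ?_)
      exact ((PSpace.chart n i).evalAt_eq_zero_iff hxd hF).1 (hX x hx)
    · have h := hw _ ((PSpace.chart n i).den_sub_one_mem_ideal X i)
      have h' : ∑ j, eval (PSpace.affineRep i p)
          (pderiv j ((MvPolynomial.X i : MvPolynomial (Fin (n + 1)) ℂ) - 1)) * w j = 0 := h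
      rw [Finset.sum_eq_single i] at h'
      · simpa using h'
      · intro j _ hj
        simp [pderiv_X_of_ne hj.symm]
      · simp
  · rintro ⟨hw, hwi⟩ f hf
    obtain ⟨N, F, hF, hFf, hdF⟩ := exists_isHomogeneous_eq i f
    -- The factor `X i` makes the form vanish also at the points of `X` outside the chart.
    have h := hw (1 + N) (MvPolynomial.X i * F) ((isHomogeneous_X ℂ i).mul hF) fun x hx => by
      by_cases hxi : x.rep i = 0
      · rw [map_mul, eval_X, hxi, zero_mul]
      · have h0 := (PSpace.chart n i).mem_ideal.1 hf x hx (PSpace.mem_chart_dom.2 hxi)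
        have h1 : eval (PSpace.affineRep i x) F = 0 := by
          rw [hFf _ (PSpace.affineRep_self hxi)]
          exact h0
        rw [map_mul, PSpace.rep_eq_smul_aff hxi, eval_smul_of_isHomogeneous hF, h1, mul_zero,
          mul_zero]
    have h2 := sum_pderiv_mul (k := ℂ) (PSpace.affineRep i p) w
      (MvPolynomial.X i) F
    simp only [aeval_eq_eval] at h2
    have h3 := h2.symm.trans h
    rw [eval_X, hai, one_mul, hdF _ _ hai hwi] at h3
    have h4 : ∑ j, eval (PSpace.affineRep i p)
        (pderiv j (MvPolynomial.X i : MvPolynomial (Fin (n + 1)) ℂ)) * w j = 0 := by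
      refine Finset.sum_eq_zero fun j _ => ?_
      by_cases hj : j = i
      · rw [hj, hwi, mul_zero]
      · rw [pderiv_X_of_ne (Ne.symm hj), map_zero, zero_mul]
    rw [h4, mul_zero, add_zero] at h3
    exact h3

theorem rep_mem_coneTangent (hpX : p ∈ X) : p.rep ∈ coneTangent X p := fun k F hF hX => by
  rw [sum_pderiv_mul_self hF, hX p hpX, mul_zero]

/-- By Euler's formula `p.rep` is itself a tangent vector of the cone. Its `i`-th coordinate is
nonzero, so this coordinate maps the cone tangent space onto `ℂ`, with the affine tangent space as
kernel. -/
theorem finrank_coneTangent_eq {i : Fin (n + 1)} (hpX : p ∈ X) (hp : p.rep i ≠ 0) :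
    Module.finrank ℂ (coneTangent X p) =
      Module.finrank ℂ
        (tangentVectors (σ := Fin (n + 1)) ((PSpace.chart n i).ideal X) (PSpace.affineRep i p)) + 1 := by
  let ℓ : coneTangent X p →ₗ[ℂ] ℂ := (LinearMap.proj i).comp (coneTangent X p).subtype
  have hr : LinearMap.range ℓ = ⊤ := by
    rw [LinearMap.range_eq_top]
    intro c
    refine ⟨(c / p.rep i) • ⟨p.rep, rep_mem_coneTangent hpX⟩, ?_⟩
    change c / p.rep i * p.rep i = c
    exact div_mul_cancel₀ _ hp
  let T : Submodule ℂ (Fin (n + 1) → ℂ) :=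
    tangentVectors (σ := Fin (n + 1)) ((PSpace.chart n i).ideal X) (PSpace.affineRep i p)
  have hk : (LinearMap.ker ℓ).map (coneTangent X p).subtype = T := by
    ext w
    rw [Submodule.mem_map]
    refine Iff.trans ?_ (mem_tangentVectors_iff_mem_coneTangent hp).symm
    constructor
    · rintro ⟨v, hv, rfl⟩
      exact ⟨v.2, hv⟩
    · rintro ⟨h1, h2⟩
      exact ⟨⟨w, h1⟩, h2, rfl⟩
  have h := ℓ.finrank_range_add_finrank_ker
  rw [hr, finrank_top, Module.finrank_self, ← LinearMap.finrank_range_of_inj (f :=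
    (coneTangent X p).subtype.domRestrict (LinearMap.ker ℓ)) (by
      exact (coneTangent X p).subtype_injective.comp Subtype.val_injective),
    LinearMap.range_domRestrict, hk] at h
  rw [← h, add_comm]

theorem exists_rep_ne_zero (p : PSpace n) : ∃ i, p.rep i ≠ 0 := Function.ne_iff.1 p.rep_nonzero

theorem eventually_finrank_coneTangent (hX : IsIrreducible X) {d : ℕ}
    (hd : Algebra.trdeg ℂ (ratFun X) = d) :
    ∀ᶠ p in genericFilter X, Module.finrank ℂ (coneTangent X p) = d + 1 := by
  obtain ⟨q, hq⟩ := hX.1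
  obtain ⟨i, hi⟩ := exists_rep_ne_zero q
  have hdom : (PSpace.chart n i).dom ∈ genericFilter X :=
    open_mem_genericFilter hX (PSpace.chart n i).isOpen_dom ⟨q, hq, PSpace.mem_chart_dom.2 hi⟩
  filter_upwards [(PSpace.chart n i).eventually_finrank_tangentVectors hX hdom hd, hdom,
    self_mem_genericFilter hX] with p h1 h2 h3
  rw [finrank_coneTangent_eq h3 (PSpace.mem_chart_dom.1 h2)]
  exact congrArg (· + 1) h1

end ConeTangent

/-! ### Conormal spaces and the linear system of critical data. -/

section Gradients

open MvPolynomial Filter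

variable {n r : ℕ} {X : Set (PSpace n)} {p : PSpace n}

/-- The Jacobian matrix of a family of polynomials. -/
def jacobian (F : Fin r → MvPolynomial (Fin (n + 1)) ℂ) (x : Fin (n + 1) → ℂ) :
    Matrix (Fin r) (Fin (n + 1)) ℂ := Matrix.of fun j b => eval x (pderiv b (F j))

theorem finrank_ker_add_of_linearIndependent {m : ℕ} {G : Matrix (Fin r) (Fin m) ℂ}
    (h : LinearIndependent ℂ G.row) : r + Module.finrank ℂ (LinearMap.ker G.mulVecLin) = m := by
  have h1 := h.rank_matrix
  rw [Fintype.card_fin] at h1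
  have h2 := G.mulVecLin.finrank_range_add_finrank_ker
  rw [Module.finrank_fin_fun] at h2
  exact (congrArg (· + _) h1.symm).trans h2

theorem coneTangent_le_ker_jacobian {k : ℕ} {F : Fin r → MvPolynomial (Fin (n + 1)) ℂ}
    (hF : ∀ j, (F j).IsHomogeneous k) (hX : ∀ j, ∀ x ∈ X, eval x.rep (F j) = 0) :
    coneTangent X p ≤ LinearMap.ker (jacobian F p.rep).mulVecLin := fun _ hw =>
  LinearMap.mem_ker.2 (funext fun j => hw k (F j) (hF j) (hX j))

theorem add_finrank_coneTangent_le {k : ℕ} {F : Fin r → MvPolynomial (Fin (n + 1)) ℂ}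
    (hF : ∀ j, (F j).IsHomogeneous k) (hX : ∀ j, ∀ x ∈ X, eval x.rep (F j) = 0)
    (h : LinearIndependent ℂ (jacobian F p.rep).row) :
    r + Module.finrank ℂ (coneTangent X p) ≤ n + 1 := by
  have h1 := finrank_ker_add_of_linearIndependent h
  have h2 := Submodule.finrank_mono (coneTangent_le_ker_jacobian (p := p) hF hX)
  omega

theorem coneTangent_eq_ker_jacobian {k : ℕ} {F : Fin r → MvPolynomial (Fin (n + 1)) ℂ}
    (hF : ∀ j, (F j).IsHomogeneous k) (hX : ∀ j, ∀ x ∈ X, eval x.rep (F j) = 0)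
    (h : LinearIndependent ℂ (jacobian F p.rep).row)
    (hr : r + Module.finrank ℂ (coneTangent X p) = n + 1) :
    coneTangent X p = LinearMap.ker (jacobian F p.rep).mulVecLin := by
  have h1 := finrank_ker_add_of_linearIndependent h
  exact Submodule.eq_of_le_of_finrank_eq (coneTangent_le_ker_jacobian hF hX) (by omega)

/-- The tangent space is cut out by equations of equal degree with independent gradients. -/
theorem exists_jacobian (hpX : p ∈ X) (hr : r + Module.finrank ℂ (coneTangent X p) = n + 1) :
    ∃ (k : ℕ) (F : Fin r → MvPolynomial (Fin (n + 1)) ℂ), (∀ j, (F j).IsHomogeneous (k + 1)) ∧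
      (∀ j, ∀ x ∈ X, eval x.rep (F j) = 0) ∧ LinearIndependent ℂ (jacobian F p.rep).row := by
  let S : Set (Fin (n + 1) → ℂ) := {g | ∃ (k : ℕ) (F : MvPolynomial (Fin (n + 1)) ℂ),
    F.IsHomogeneous k ∧ (∀ x ∈ X, eval x.rep F = 0) ∧ g = fun b => eval p.rep (pderiv b F)}
  obtain ⟨b, hbS, hspan, hli⟩ := exists_linearIndependent ℂ S
  have : Finite b := hli.finite
  obtain ⟨m, ⟨e⟩⟩ := Finite.exists_equiv_fin b
  let G : Matrix (Fin m) (Fin (n + 1)) ℂ := Matrix.of fun j => (e.symm j : Fin (n + 1) → ℂ)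
  have hG : LinearIndependent ℂ G.row := hli.comp _ e.symm.injective
  have hT : coneTangent X p = LinearMap.ker G.mulVecLin := by
    ext w
    rw [LinearMap.mem_ker]
    constructor
    · intro hw
      funext j
      obtain ⟨k, F, hF, hX, hg⟩ := hbS (e.symm j).2
      refine Eq.trans ?_ (hw k F hF hX)
      change ∑ i, (e.symm j : Fin (n + 1) → ℂ) i * w i = _
      rw [hg]
    · intro hw k F hF hX
      have hmem : (fun b => eval p.rep (pderiv b F)) ∈ Submodule.span ℂ b := by
        rw [hspan]
        exact Submodule.subset_span ⟨k, F, hF, hX, rfl⟩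
      have hle : Submodule.span ℂ b ≤
          LinearMap.ker ((Matrix.of fun (i : Fin (n + 1)) (_ : Unit) => w i).vecMulLinear) := by
        refine Submodule.span_le.2 fun g hg => ?_
        refine LinearMap.mem_ker.2 (funext fun _ => ?_)
        have := congrFun hw (e ⟨g, hg⟩)
        refine Eq.trans ?_ this
        change ∑ i, g i * w i = ∑ i, (e.symm (e ⟨g, hg⟩) : Fin (n + 1) → ℂ) i * w i
        rw [Equiv.symm_apply_apply]
      exact congrFun (LinearMap.mem_ker.1 (hle hmem)) ()
  have hmr : m = r := by
    have := finrank_ker_add_of_linearIndependent hG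
    rw [← hT] at this
    omega
  subst hmr
  choose k F hF hX hg using fun j => hbS (e.symm j).2
  obtain ⟨i, hi⟩ := exists_rep_ne_zero p
  -- Powers of a coordinate that is nonzero at `p` equalize the degrees. Since the equations vanish
  -- at `p`, their gradients there are only rescaled. The `+ 1` keeps the common degree positive, so
  -- that all gradients have degree `∑ j, k j`.
  refine ⟨∑ j, k j, fun j => MvPolynomial.X i ^ (∑ l, k l - k j + 1) * F j, fun j => ?_,
    fun j x hx => ?_, ?_⟩
  · have h := ((isHomogeneous_X ℂ i).pow (∑ l, k l - k j + 1)).mul (hF j)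
    have hle : k j ≤ ∑ l, k l := Finset.single_le_sum (f := k) (fun _ _ => Nat.zero_le _)
      (Finset.mem_univ j)
    have e : 1 * (∑ l, k l - k j + 1) + k j = ∑ l, k l + 1 := by omega
    rwa [e] at h
  · rw [map_mul, hX j x hx, mul_zero]
  · have hrow : ∀ j, (jacobian (fun j => MvPolynomial.X i ^ (∑ l, k l - k j + 1) * F j)
        p.rep).row j = Units.mk0 (p.rep i ^ (∑ l, k l - k j + 1)) (pow_ne_zero _ hi) • G.row j := by
      intro j
      funext b
      change eval p.rep (pderiv b _) = p.rep i ^ _ * (e.symm j : Fin (n + 1) → ℂ) b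
      rw [hg j, Derivation.leibniz, map_add, smul_eq_mul, smul_eq_mul, map_mul, map_mul, hX j p hpX,
        zero_mul, add_zero, map_pow, eval_X]
    rw [funext hrow]
    exact hG.units_smul _

/-- The vector space of data for which `q` satisfies the critical equations on `X`. -/
def criticalData (X : Set (PSpace n)) (q : PSpace n) : Submodule ℂ (Fin (n + 1) → ℂ) where
  carrier := {v | ∀ w ∈ coneTangent X q, ∑ i, dlog v q.rep i * w i = 0}
  add_mem' {a b} ha hb w hw := by
    have h : ∀ i, dlog (a + b) q.rep i = dlog a q.rep i + dlog b q.rep i := fun i => by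
      simp only [dlog, Pi.add_apply, Finset.sum_add_distrib]
      ring
    simp only [h, add_mul, Finset.sum_add_distrib, ha w hw, hb w hw, add_zero]
  zero_mem' w _ := by simp [dlog]
  smul_mem' c a ha w hw := by
    have h : ∀ i, dlog (c • a) q.rep i = c * dlog a q.rep i := fun i => by
      simp only [dlog, Pi.smul_apply, smul_eq_mul, ← Finset.mul_sum]
      ring
    simp only [h, mul_assoc, ← Finset.mul_sum, ha w hw, mul_zero]

theorem mem_criticalData {q : PSpace n} {v : Fin (n + 1) → ℂ} :
    v ∈ criticalData X q ↔ ∀ w ∈ coneTangent X q, ∑ i, dlog v q.rep i * w i = 0 := Iff.rfl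

/-- The matrix whose columns span the data for which a point is critical. -/
def frameMatrix (k : ℕ) (F : Fin r → MvPolynomial (Fin (n + 1)) ℂ) :
    Matrix (Fin (n + 1)) (Fin (r + 1)) (MvPolynomial (Fin (n + 1)) ℂ) :=
  Matrix.of fun b => Fin.cons (MvPolynomial.X b * MvPolynomial.X 0 ^ k)
    fun j => MvPolynomial.X b * pderiv b (F j)

/-- The factor `X 0 ^ k` is there to give the first column the degree of the others. -/
theorem isHomogeneous_frameMatrix {k : ℕ} {F : Fin r → MvPolynomial (Fin (n + 1)) ℂ}
    (hF : ∀ j, (F j).IsHomogeneous (k + 1)) (b : Fin (n + 1)) (j : Fin (r + 1)) :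
    (frameMatrix k F b j).IsHomogeneous (k + 1) := by
  revert j
  refine Fin.cases ?_ fun j => ?_
  · have := (isHomogeneous_X ℂ b).mul ((isHomogeneous_X ℂ (0 : Fin (n + 1))).pow k)
    rwa [one_mul, Nat.add_comm 1 k] at this
  · have := (isHomogeneous_X ℂ b).mul ((hF j).pderiv (i := b))
    rwa [Nat.add_sub_cancel, Nat.add_comm 1 k] at this

/-- This is the parametrization of critical data: each entry is the coordinate `x b` times the sum
of a constant, `x 0 ^ k * c 0`, and a combination of gradients. -/
theorem frameMatrix_mulVec {k : ℕ} {F : Fin r → MvPolynomial (Fin (n + 1)) ℂ}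
    (x : Fin (n + 1) → ℂ) (c : Fin (r + 1) → ℂ) (b : Fin (n + 1)) :
    ((frameMatrix k F).map (eval x)).mulVec c b =
      x b * (x 0 ^ k * c 0 + Matrix.vecMul (fun j => c (Fin.succ j)) (jacobian F x) b) := by
  have h0 : frameMatrix k F b 0 = MvPolynomial.X b * MvPolynomial.X 0 ^ k := rfl
  have hs : ∀ j, frameMatrix k F b (Fin.succ j) = MvPolynomial.X b * pderiv b (F j) := fun j => rfl
  have hJ : ∀ j, jacobian F x j b = eval x (pderiv b (F j)) := fun j => rfl
  rw [Matrix.mulVec, dotProduct, Fin.sum_univ_succ, Matrix.vecMul, dotProduct, mul_add,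
    Finset.mul_sum, Matrix.map_apply, h0, map_mul, map_pow, eval_X, eval_X, mul_assoc]
  refine congrArg _ (Finset.sum_congr rfl fun j _ => ?_)
  rw [Matrix.map_apply, hs, hJ, map_mul, eval_X]
  ring

theorem mem_compl_arrangement_iff {q : PSpace n} :
    q ∉ arrangement n ↔ (∀ i, q.rep i ≠ 0) ∧ ∑ i, q.rep i ≠ 0 := by
  change ¬ (∏ i, q.rep i) * ∑ i, q.rep i = 0 ↔ _
  rw [mul_eq_zero, not_or, ← Ne, ← Ne, Finset.prod_ne_zero_iff]
  simp

/-- The point is tangent to its own cone, so combinations of gradients vanish on it. Hence the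
gradient columns of the frame contribute nothing to the sum of the data. -/
theorem vecMul_jacobian_dotProduct {k : ℕ} {F : Fin r → MvPolynomial (Fin (n + 1)) ℂ}
    (hF : ∀ j, (F j).IsHomogeneous k) (hX : ∀ j, ∀ x ∈ X, eval x.rep (F j) = 0) (hp : p ∈ X)
    (c : Fin r → ℂ) : ∑ b, p.rep b * Matrix.vecMul c (jacobian F p.rep) b = 0 := by
  have h : (jacobian F p.rep).mulVec p.rep = 0 :=
    LinearMap.mem_ker.1 (coneTangent_le_ker_jacobian hF hX (rep_mem_coneTangent hp))
  have h1 := Matrix.dotProduct_mulVec c (jacobian F p.rep) p.rep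
  rw [h, dotProduct_zero, dotProduct_comm] at h1
  exact h1.symm

/-- Summing the entries of a relation among the columns leaves only `c 0`, times `p₊` and a power of
`p₀`, which are nonzero off the arrangement. What remains is a relation among the gradients. -/
theorem frameMatrix_injective_iff {k : ℕ} {F : Fin r → MvPolynomial (Fin (n + 1)) ℂ}
    (hF : ∀ j, (F j).IsHomogeneous (k + 1)) (hX : ∀ j, ∀ x ∈ X, eval x.rep (F j) = 0)
    (hp : p ∈ X) (hpa : p ∉ arrangement n) :
    LinearMap.ker ((frameMatrix k F).map (eval p.rep)).mulVecLin = ⊥ ↔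
      LinearIndependent ℂ (jacobian F p.rep).row := by
  obtain ⟨hp0, hps⟩ := mem_compl_arrangement_iff.1 hpa
  rw [← Matrix.vecMul_injective_iff, LinearMap.ker_eq_bot']
  constructor
  · intro h
    refine (injective_iff_map_eq_zero (jacobian F p.rep).vecMulLinear).2 fun c hc => ?_
    have h1 := h (Fin.cons 0 c) (funext fun b => by
      refine (frameMatrix_mulVec _ _ b).trans ?_
      have : Matrix.vecMul c (jacobian F p.rep) = 0 := hc
      simp [this])
    funext j
    exact congrFun h1 j.succ
  · intro h c hc
    have h1 : ∀ b, p.rep 0 ^ k * c 0 +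
        Matrix.vecMul (fun j => c (Fin.succ j)) (jacobian F p.rep) b = 0 := fun b =>
      (mul_eq_zero_iff_left (hp0 b)).1 ((frameMatrix_mulVec _ _ b).symm.trans (congrFun hc b))
    have h2 : (∑ b, p.rep b) * (p.rep 0 ^ k * c 0) = 0 := by
      have := vecMul_jacobian_dotProduct hF hX hp fun j => c (Fin.succ j)
      have h4 := Finset.sum_eq_zero fun b (_ : b ∈ Finset.univ) =>
        (congrArg (p.rep b * ·) (h1 b)).trans (mul_zero _)
      simp only [mul_add, Finset.sum_add_distrib] at h4
      rwa [this, add_zero, ← Finset.sum_mul] at h4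
    have h3 : c 0 = 0 := by
      rcases mul_eq_zero.1 h2 with h | h
      · exact absurd h hps
      · exact (mul_eq_zero.1 h).resolve_left (pow_ne_zero _ (hp0 0))
    have h4 : (fun j => c (Fin.succ j)) = 0 := by
      refine h (Eq.trans (funext fun b => ?_) (Matrix.zero_vecMul _).symm)
      have := h1 b
      rwa [h3, mul_zero, zero_add] at this
    funext j
    revert j
    exact Fin.cases h3 fun j => congrFun h4 j

/-- In one direction the data sum to `p₊` times the constant, so `dlog` returns the chosen
combination of gradients. In the other, a covector vanishing on the kernel of the Jacobian is a
combination of its rows. -/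
theorem range_frameMatrix {k : ℕ} {F : Fin r → MvPolynomial (Fin (n + 1)) ℂ}
    (hF : ∀ j, (F j).IsHomogeneous (k + 1)) (hX : ∀ j, ∀ x ∈ X, eval x.rep (F j) = 0)
    (hp : p ∈ X) (hpa : p ∉ arrangement n)
    (h : LinearIndependent ℂ (jacobian F p.rep).row)
    (hr : r + Module.finrank ℂ (coneTangent X p) = n + 1) :
    LinearMap.range ((frameMatrix k F).map (eval p.rep)).mulVecLin = criticalData X p := by
  obtain ⟨hp0, hps⟩ := mem_compl_arrangement_iff.1 hpa
  have hT := coneTangent_eq_ker_jacobian hF hX h hr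
  ext v
  rw [mem_criticalData, hT]
  constructor
  · rintro ⟨c, rfl⟩ w hw
    have hv : ∀ b, ((frameMatrix k F).map (eval p.rep)).mulVecLin c b = _ :=
      frameMatrix_mulVec p.rep c
    have hsum : ∑ b, ((frameMatrix k F).map (eval p.rep)).mulVecLin c b =
        (∑ b, p.rep b) * (p.rep 0 ^ k * c 0) := by
      simp only [hv, mul_add, Finset.sum_add_distrib, Finset.sum_mul]
      rw [vecMul_jacobian_dotProduct hF hX hp, add_zero]
    have hd : dlog (((frameMatrix k F).map (eval p.rep)).mulVecLin c) p.rep =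
        Matrix.vecMul (fun j => c (Fin.succ j)) (jacobian F p.rep) := by
      funext b
      rw [dlog, hsum, hv, mul_div_cancel_left₀ _ (hp0 b), mul_div_cancel_left₀ _ hps,
        add_sub_cancel_left]
    rw [hd]
    change Matrix.vecMul (fun j => c (Fin.succ j)) (jacobian F p.rep) ⬝ᵥ w = 0
    rw [← Matrix.dotProduct_mulVec]
    have : (jacobian F p.rep).mulVec w = 0 := LinearMap.mem_ker.1 hw
    rw [this, dotProduct_zero]
  · intro hv
    obtain ⟨P, hP⟩ := exists_comp_eq_of_ker_le (f := (jacobian F p.rep).mulVecLin)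
      (g := (Matrix.of fun (_ : Unit) i => dlog v p.rep i).mulVecLin)
      fun w hw => LinearMap.mem_ker.2 (funext fun _ => hv w hw)
    have hrow : Matrix.vecMul (LinearMap.toMatrix' P ()) (jacobian F p.rep) = dlog v p.rep := by
      have h1 : LinearMap.toMatrix' P * jacobian F p.rep =
          Matrix.of fun (_ : Unit) i => dlog v p.rep i := by
        apply Matrix.toLin'.injective
        rw [Matrix.toLin'_mul, Matrix.toLin'_toMatrix']
        exact hP
      exact congrFun h1 ()
    refine ⟨Fin.cons ((∑ j, v j) / (∑ j, p.rep j) / p.rep 0 ^ k) (LinearMap.toMatrix' P ()),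
      funext fun b => ?_⟩
    refine (frameMatrix_mulVec _ _ b).trans ?_
    simp only [Fin.cons_zero, Fin.cons_succ]
    rw [hrow, mul_div_cancel₀ _ (pow_ne_zero _ (hp0 0)), dlog, add_sub_cancel,
      mul_div_cancel₀ _ (hp0 b)]

end Gradients

/-! ### Local frames and openness of the regular locus. -/

section Frames

open MvPolynomial Filter

variable {n r : ℕ}

theorem isHomogeneous_det {σ : Type} {N k : ℕ} {A : Matrix (Fin N) (Fin N) (MvPolynomial σ ℂ)}
    (hA : ∀ i j, (A i j).IsHomogeneous k) : A.det.IsHomogeneous (N * k) := by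
  rw [Matrix.det_apply]
  refine IsHomogeneous.sum _ _ _ fun g _ => ?_
  have h := IsHomogeneous.prod Finset.univ (fun i => A (g i) i) (fun _ => k) fun i _ => hA _ _
  rw [Finset.sum_const, Finset.card_univ, Fintype.card_fin, smul_eq_mul] at h
  rcases Int.units_eq_one_or (Equiv.Perm.sign g) with hs | hs
  · rwa [hs, one_smul]
  · rw [hs, Units.neg_smul, one_smul]
    exact h.neg

theorem isHomogeneous_adjugate {σ : Type} {N k : ℕ}
    {A : Matrix (Fin (N + 1)) (Fin (N + 1)) (MvPolynomial σ ℂ)}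
    (hA : ∀ i j, (A i j).IsHomogeneous k) (i j : Fin (N + 1)) :
    (A.adjugate i j).IsHomogeneous (N * k) := by
  rw [Matrix.adjugate_fin_succ_eq_det_submatrix]
  have h := isHomogeneous_det (A := A.submatrix j.succAbove i.succAbove) fun _ _ => hA _ _
  rcases neg_one_pow_eq_or (MvPolynomial σ ℂ) (j + i : ℕ) with hs | hs
  · rwa [hs, one_mul]
  · rw [hs, neg_one_mul]
    exact h.neg

theorem isHomogeneous_mul {σ : Type} {a b c k l : ℕ} {A : Matrix (Fin a) (Fin b) (MvPolynomial σ ℂ)}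
    {A' : Matrix (Fin b) (Fin c) (MvPolynomial σ ℂ)} (hA : ∀ i j, (A i j).IsHomogeneous k)
    (hA' : ∀ i j, (A' i j).IsHomogeneous l) (i : Fin a) (j : Fin c) :
    ((A * A') i j).IsHomogeneous (k + l) :=
  IsHomogeneous.sum _ _ _ fun _ _ => (hA _ _).mul (hA' _ _)

/-- The values of a matrix of polynomials. -/
abbrev evalMatrix {a b : ℕ} (M : Matrix (Fin a) (Fin b) (MvPolynomial (Fin (n + 1)) ℂ))
    (x : Fin (n + 1) → ℂ) : Matrix (Fin a) (Fin b) ℂ := M.map (eval x)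

/-- The square matrix of polynomials obtained from `M` by multiplication with a constant matrix. -/
def framePoly (M : Matrix (Fin (n + 1)) (Fin (r + 1)) (MvPolynomial (Fin (n + 1)) ℂ))
    (C : Matrix (Fin (r + 1)) (Fin (n + 1)) ℂ) :
    Matrix (Fin (r + 1)) (Fin (r + 1)) (MvPolynomial (Fin (n + 1)) ℂ) :=
  (C.map MvPolynomial.C : Matrix (Fin (r + 1)) (Fin (n + 1)) (MvPolynomial (Fin (n + 1)) ℂ)) * M

theorem isHomogeneous_framePoly {k : ℕ}
    {M : Matrix (Fin (n + 1)) (Fin (r + 1)) (MvPolynomial (Fin (n + 1)) ℂ)}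
    (hM : ∀ b j, (M b j).IsHomogeneous k) (C : Matrix (Fin (r + 1)) (Fin (n + 1)) ℂ)
    (i j : Fin (r + 1)) : (framePoly M C i j).IsHomogeneous k := by
  have h := isHomogeneous_mul (fun i j => isHomogeneous_C (Fin (n + 1)) (C i j)) hM i j
  rwa [zero_add] at h

theorem framePoly_map (M : Matrix (Fin (n + 1)) (Fin (r + 1)) (MvPolynomial (Fin (n + 1)) ℂ))
    (C : Matrix (Fin (r + 1)) (Fin (n + 1)) ℂ) (x : Fin (n + 1) → ℂ) :
    evalMatrix (framePoly M C) x = C * evalMatrix M x := by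
  rw [framePoly, evalMatrix, Matrix.map_mul]
  refine congrArg (· * _) ?_
  ext i j
  exact eval_C _

theorem eval_det_framePoly
    (M : Matrix (Fin (n + 1)) (Fin (r + 1)) (MvPolynomial (Fin (n + 1)) ℂ))
    (C : Matrix (Fin (r + 1)) (Fin (n + 1)) ℂ) (x : Fin (n + 1) → ℂ) :
    eval x (framePoly M C).det = (C * evalMatrix M x).det := by
  rw [← framePoly_map, RingHom.map_det]
  rfl

/-- The set of points at which `C` is a left inverse of `M` up to an invertible matrix. -/
def frameDom (M : Matrix (Fin (n + 1)) (Fin (r + 1)) (MvPolynomial (Fin (n + 1)) ℂ))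
    (C : Matrix (Fin (r + 1)) (Fin (n + 1)) ℂ) : Set (PSpace n) :=
  {q | (C * evalMatrix M q.rep).det ≠ 0}

theorem isOpen_frameDom {k : ℕ}
    {M : Matrix (Fin (n + 1)) (Fin (r + 1)) (MvPolynomial (Fin (n + 1)) ℂ)}
    (hM : ∀ b j, (M b j).IsHomogeneous k) (C : Matrix (Fin (r + 1)) (Fin (n + 1)) ℂ) :
    IsOpen (frameDom M C) := by
  have h := isOpen_setOf_evalAt_ne_zero (Y := PSpace n) (F := (framePoly M C).det)
    (isHomogeneous_det (isHomogeneous_framePoly hM C))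
  convert h using 1
  ext q
  exact not_congr ((eval_det_framePoly M C q.rep).symm ▸ Iff.rfl)

theorem exists_mul_eq_one {a b : ℕ} {A : Matrix (Fin a) (Fin b) ℂ}
    (h : LinearMap.ker A.mulVecLin = ⊥) : ∃ C : Matrix (Fin b) (Fin a) ℂ, C * A = 1 := by
  obtain ⟨c, hc⟩ := A.mulVecLin.exists_leftInverse_of_injective h
  refine ⟨LinearMap.toMatrix' c, ?_⟩
  apply Matrix.toLin'.injective
  rw [Matrix.toLin'_mul, Matrix.toLin'_toMatrix', Matrix.toLin'_one]
  exact hc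

theorem ker_eq_bot_of_det_ne_zero {a b : ℕ} {A : Matrix (Fin a) (Fin b) ℂ}
    {C : Matrix (Fin b) (Fin a) ℂ} (h : (C * A).det ≠ 0) : LinearMap.ker A.mulVecLin = ⊥ := by
  refine LinearMap.ker_eq_bot'.2 fun v hv => Matrix.eq_zero_of_mulVec_eq_zero h ?_
  rw [← Matrix.mulVec_mulVec, show A.mulVec v = 0 from hv, Matrix.mulVec_zero]

theorem isClosed_arrangement (n : ℕ) : IsClosed (arrangement n) := by
  have h := isClosed_setOf_evalAt_eq_zero (Y := PSpace n)
    (F := (∏ i, X i : MvPolynomial (Fin (n + 1)) ℂ) * ∑ i, X i)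
    ((IsHomogeneous.prod Finset.univ (fun i : Fin (n + 1) => (X i : MvPolynomial (Fin (n + 1)) ℂ))
      (fun _ => 1) fun i _ => isHomogeneous_X ℂ i).mul
        (IsHomogeneous.sum Finset.univ _ 1 fun i _ => isHomogeneous_X ℂ i))
  convert h using 1
  ext p
  change (∏ i, p.rep i) * ∑ i, p.rep i = 0 ↔ eval p.rep _ = 0
  simp

/-- Local frames of the family of vector spaces `V q`, `q ∈ B`. -/
structure IsFrame (V : PSpace n → Submodule ℂ (Fin (n + 1) → ℂ)) (B : Set (PSpace n)) (k : ℕ)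
    (M : Matrix (Fin (n + 1)) (Fin (r + 1)) (MvPolynomial (Fin (n + 1)) ℂ))
    (C : Matrix (Fin (r + 1)) (Fin (n + 1)) ℂ) : Prop where
  homog : ∀ b j, (M b j).IsHomogeneous k
  range : ∀ q ∈ B, q ∈ frameDom M C → LinearMap.range (evalMatrix M q.rep).mulVecLin = V q

variable {X : Set (PSpace n)} {d : ℕ}

/-- Semicontinuity: independent gradients at `q` stay independent at generic points of `X`, where
the tangent space has dimension `d + 1`, so there cannot be too many of them. -/
theorem le_finrank_coneTangent (hX : IsIrreducible X) (hd : Algebra.trdeg ℂ (ratFun X) = d)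
    {q : PSpace n} (hq : q ∈ X) (hqa : q ∉ arrangement n) :
    d + 1 ≤ Module.finrank ℂ (coneTangent X q) := by
  have hle := Submodule.finrank_le (coneTangent X q)
  rw [Module.finrank_fin_fun] at hle
  obtain ⟨r, hr⟩ := Nat.exists_eq_add_of_le hle
  obtain ⟨k, F, hF, hFX, hli⟩ := exists_jacobian hq ((add_comm r _).trans hr.symm)
  have hM := isHomogeneous_frameMatrix hF
  obtain ⟨C, hC⟩ := exists_mul_eq_one ((frameMatrix_injective_iff hF hFX hq hqa).2 hli)
  have hqU : q ∈ frameDom (frameMatrix k F) C := by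
    change (C * evalMatrix (frameMatrix k F) _).det ≠ 0
    rw [hC, Matrix.det_one]
    exact one_ne_zero
  obtain ⟨p, ⟨hpX, hpU, hpa⟩, hp⟩ := inter_nonempty_of_mem_genericFilter hX
    ((isOpen_frameDom hM C).inter (isClosed_arrangement n).isOpen_compl) ⟨q, hq, hqU, hqa⟩
    (eventually_finrank_coneTangent hX hd)
  have h := add_finrank_coneTangent_le hF hFX
    ((frameMatrix_injective_iff hF hFX hpX hpa).1 (ker_eq_bot_of_det_ne_zero hpU))
  have hp' : Module.finrank ℂ (coneTangent X p) = d + 1 := hp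
  omega

theorem mem_regLocus_iff (hd : topologicalKrullDim X = d) {p : PSpace n} :
    p ∈ regLocus X ↔ p ∈ X ∧ Module.finrank ℂ (coneTangent X p) = d + 1 := by
  change p ∈ X ∧ (Module.finrank ℂ (coneTangent X p) : WithBot ℕ∞) = topologicalKrullDim X + 1 ↔ _
  rw [hd]
  exact and_congr_right fun _ => by norm_cast

/-- At a regular point `r` equations with independent gradients cut out the tangent space and
provide the frame. Wherever they stay independent on `X` off the arrangement,
`le_finrank_coneTangent` forces regularity; this last part yields openness. -/
theorem exists_frame (hX : IsIrreducible X) (hdim : topologicalKrullDim X = d)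
    (hd : Algebra.trdeg ℂ (ratFun X) = d) (hr : d + r = n) {p : PSpace n}
    (hp : p ∈ regLocus X \ arrangement n) :
    ∃ (k : ℕ) (M : Matrix (Fin (n + 1)) (Fin (r + 1)) (MvPolynomial (Fin (n + 1)) ℂ))
      (C : Matrix (Fin (r + 1)) (Fin (n + 1)) ℂ), p ∈ frameDom M C ∧
        IsFrame (criticalData X) (regLocus X \ arrangement n) k M C ∧
        ∀ q ∈ X, q ∉ arrangement n → q ∈ frameDom M C → q ∈ regLocus X := by
  obtain ⟨hpX, hpd⟩ := (mem_regLocus_iff hdim).1 hp.1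
  obtain ⟨k, F, hF, hFX, hli⟩ := exists_jacobian (r := r) hpX (by omega)
  have hM := isHomogeneous_frameMatrix hF
  obtain ⟨C, hC⟩ := exists_mul_eq_one ((frameMatrix_injective_iff hF hFX hpX hp.2).2 hli)
  refine ⟨k + 1, frameMatrix k F, C, ?_, ⟨hM, ?_⟩, ?_⟩
  · change (C * evalMatrix (frameMatrix k F) _).det ≠ 0
    rw [hC, Matrix.det_one]
    exact one_ne_zero
  · intro q hq hqU
    obtain ⟨hqX, hqd⟩ := (mem_regLocus_iff hdim).1 hq.1
    exact range_frameMatrix hF hFX hqX hq.2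
      ((frameMatrix_injective_iff hF hFX hqX hq.2).1 (ker_eq_bot_of_det_ne_zero hqU)) (by omega)
  · intro q hqX hqa hqU
    have h1 := le_finrank_coneTangent hX hd hqX hqa
    have h2 := add_finrank_coneTangent_le hF hFX
      ((frameMatrix_injective_iff hF hFX hqX hqa).1 (ker_eq_bot_of_det_ne_zero hqU))
    exact (mem_regLocus_iff hdim).2 ⟨hqX, by omega⟩

theorem exists_isOpen_inter_eq (hX : IsIrreducible X) (hdim : topologicalKrullDim X = d)
    (hd : Algebra.trdeg ℂ (ratFun X) = d) (hr : d + r = n) :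
    ∃ O : Set (PSpace n), IsOpen O ∧ regLocus X \ arrangement n = X ∩ O := by
  refine ⟨⋃₀ {U | IsOpen U ∧ X ∩ U ⊆ regLocus X \ arrangement n},
    isOpen_sUnion fun U hU => hU.1, Set.Subset.antisymm ?_ ?_⟩
  · intro p hp
    obtain ⟨k, M, C, h1, h2, h3⟩ := exists_frame hX hdim hd hr hp
    exact ⟨hp.1.1, frameDom M C ∩ (arrangement n)ᶜ,
      ⟨(isOpen_frameDom h2.homog C).inter (isClosed_arrangement n).isOpen_compl,
        fun q hq => ⟨h3 q hq.1 hq.2.2 hq.2.1, hq.2.2⟩⟩, h1, hp.2⟩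
  · rintro p ⟨hpX, U, hU, hpU⟩
    exact hU.2 ⟨hpX, hpU⟩

theorem regLocus_diff_nonempty (hX : IsIrreducible X) (hdim : topologicalKrullDim X = d)
    (hd : Algebra.trdeg ℂ (ratFun X) = d) (hXa : ¬ X ⊆ arrangement n) :
    (regLocus X \ arrangement n).Nonempty := by
  obtain ⟨q, hq, hqa⟩ := Set.not_subset.1 hXa
  obtain ⟨p, ⟨hpX, hpa⟩, hp⟩ := inter_nonempty_of_mem_genericFilter hX
    (isClosed_arrangement n).isOpen_compl ⟨q, hq, hqa⟩ (eventually_finrank_coneTangent hX hd)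
  exact ⟨p, (mem_regLocus_iff hdim).2 ⟨hpX, hp⟩, hpa⟩

end Frames

/-! ### Maps of projective spaces given by matrices of polynomials. -/

section BundleMap

open MvPolynomial

/-- The point of projective space with the given homogeneous coordinates. -/
def PSpace.ofVec {m : ℕ} (v : Fin (m + 1) → ℂ) : PSpace m :=
  open Classical in
  if h : v ≠ 0 then Projectivization.mk ℂ v h
  else Projectivization.mk ℂ (fun _ => 1) fun h => one_ne_zero (congrFun h 0)

theorem PSpace.exists_rep_ofVec {m : ℕ} {v : Fin (m + 1) → ℂ} (h : v ≠ 0) :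
    ∃ s : ℂ, s ≠ 0 ∧ (PSpace.ofVec v).rep = s • v := by
  rw [PSpace.ofVec, dif_pos h]
  exact PSpace.exists_rep_mk h

theorem PSpace.ofVec_eq {m : ℕ} {v : Fin (m + 1) → ℂ} {p : PSpace m} {s : ℂ} (hs : s ≠ 0)
    (h : v = s • p.rep) : PSpace.ofVec v = p := by
  have hv : v ≠ 0 := h ▸ smul_ne_zero hs p.rep_nonzero
  obtain ⟨t, ht, e⟩ := PSpace.exists_rep_ofVec hv
  rw [h, smul_smul] at e
  exact PSpace.ext_of_smul (e ▸ congrArg (fun v => (PSpace.ofVec v).rep) h)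

variable {n m l : ℕ}

/-- The linear map with matrix `A`, depending on a point of `ℙⁿ`, as a map of projective spaces. -/
def bundleMap (A : Matrix (Fin (l + 1)) (Fin (m + 1)) (MvPolynomial (Fin (n + 1)) ℂ))
    (z : VProd (PSpace n) (PSpace m)) : VProd (PSpace n) (PSpace l) :=
  ⟨z.fst, PSpace.ofVec ((evalMatrix A z.fst.rep).mulVec z.snd.rep)⟩

/-- The bihomogeneous polynomials describing `bundleMap A`. -/
def bundlePoly (A : Matrix (Fin (l + 1)) (Fin (m + 1)) (MvPolynomial (Fin (n + 1)) ℂ))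
    (j : Fin (l + 1)) : MvPolynomial (Fin (n + 1) ⊕ Fin (m + 1)) ℂ :=
  ∑ i, rename Sum.inl (A j i) * X (Sum.inr i)

theorem isHomog_bundlePoly {e : ℕ}
    {A : Matrix (Fin (l + 1)) (Fin (m + 1)) (MvPolynomial (Fin (n + 1)) ℂ)}
    (hA : ∀ j i, (A j i).IsHomogeneous e) (j : Fin (l + 1)) :
    IsHomog (Y := VProd (PSpace n) (PSpace m)) (bundlePoly A j)
      ((e, 1) : ℕ × ℕ) := by
  refine IsWeightedHomogeneous.sum _ _ _ fun i _ => ?_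
  have h := (VProd.isHomog_rename_inl (Y := PSpace n) (Z := PSpace m) (hA j i)).mul
    (isWeightedHomogeneous_X ℂ (HomogCoords.wt (Y := VProd (PSpace n) (PSpace m))) (Sum.inr i))
  have e : ((e, 0) + (0, 1) : ℕ × ℕ) = (e, 1) := by simp
  exact e ▸ h

theorem evalAt_bundlePoly
    (A : Matrix (Fin (l + 1)) (Fin (m + 1)) (MvPolynomial (Fin (n + 1)) ℂ))
    (j : Fin (l + 1)) (z : VProd (PSpace n) (PSpace m)) :
    evalAt (Y := VProd (PSpace n) (PSpace m)) (bundlePoly A j) z =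
      (evalMatrix A z.fst.rep).mulVec z.snd.rep j := by
  refine (map_sum (eval _) _ _).trans (Finset.sum_congr rfl fun i _ => ?_)
  refine (map_mul (eval _) _ _).trans ?_
  refine congrArg₂ (· * ·) (VProd.evalAt_rename_inl (Y := PSpace n) (A j i) z) ?_
  exact eval_X (Sum.inr i)

theorem isPolyMapOn_bundleMap {e : ℕ}
    {A : Matrix (Fin (l + 1)) (Fin (m + 1)) (MvPolynomial (Fin (n + 1)) ℂ)}
    (hA : ∀ j i, (A j i).IsHomogeneous e) {S : Set (VProd (PSpace n) (PSpace m))}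
    (hS : ∀ z ∈ S, (evalMatrix A z.fst.rep).mulVec z.snd.rep ≠ 0) :
    IsPolyMapOn S (bundleMap A) := by
  intro y _
  -- The second factor is replaced by forms of bidegree `(e, 1)`, which shifts the first degree by
  -- `e` times the second.
  let D : ℕ × ℕ →+ ℕ × ℕ :=
    { toFun := fun a => (a.1 + e * a.2, a.2)
      map_zero' := rfl
      map_add' := fun a b => Prod.ext
        (by simp only [Prod.fst_add, Prod.snd_add]; ring) rfl }
  refine ⟨Set.univ, isOpen_univ, trivial, D,
    Sum.elim (fun a => X (Sum.inl a)) (bundlePoly A), ?_, ?_⟩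
  · rintro (a | j)
    · exact isWeightedHomogeneous_X ℂ (HomogCoords.wt (Y := VProd (PSpace n) (PSpace m)))
        (Sum.inl a)
    · have h := isHomog_bundlePoly hA j
      have e : D (0, 1) = (e, 1) := Prod.ext (by simp [D]) rfl
      exact e.symm ▸ h
  · rintro z ⟨hz, -⟩
    obtain ⟨t, ht, hrep⟩ := PSpace.exists_rep_ofVec (hS z hz)
    let s : Multiplicative (ℕ × ℕ) →* ℂ :=
      { toFun := fun a => t⁻¹ ^ (Multiplicative.toAdd a).2
        map_one' := pow_zero _
        map_mul' := fun a b => pow_add _ _ _ }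
    refine ⟨s, fun a => pow_ne_zero _ (inv_ne_zero ht), ?_⟩
    rintro (a | j)
    · refine (eval_X (Sum.inl a)).trans ?_
      exact (one_mul _).symm
    · refine (evalAt_bundlePoly A j z).trans ?_
      change _ = t⁻¹ ^ 1 * (PSpace.ofVec ((evalMatrix A z.fst.rep).mulVec z.snd.rep)).rep j
      rw [hrep, pow_one, Pi.smul_apply, smul_eq_mul, inv_mul_cancel_left₀ ht]

end BundleMap

/-! ### Frames, coframes and local trivializations. -/

section Trivialization

open MvPolynomial

theorem mulVec_injective_of_det_ne_zero {a b : ℕ} {A : Matrix (Fin a) (Fin b) ℂ}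
    {C : Matrix (Fin b) (Fin a) ℂ} (h : (C * A).det ≠ 0) : Function.Injective A.mulVec :=
  LinearMap.ker_eq_bot.1 (ker_eq_bot_of_det_ne_zero h)

theorem mul_left_cancel_of_det_ne_zero {a b c : ℕ} {A : Matrix (Fin a) (Fin b) ℂ}
    {C : Matrix (Fin b) (Fin a) ℂ} (h : (C * A).det ≠ 0) {S T : Matrix (Fin b) (Fin c) ℂ}
    (hST : A * S = A * T) : S = T := by
  have h1 : C * A * S = C * A * T := by rw [Matrix.mul_assoc, hST, Matrix.mul_assoc]
  have h2 := congrArg ((C * A)⁻¹ * ·) h1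
  simpa only [Matrix.nonsing_inv_mul_cancel_left _ _ (isUnit_iff_ne_zero.2 h)] using h2

/-- The matrix of a change of frame. -/
def transition {a b : ℕ} (A A' : Matrix (Fin a) (Fin b) ℂ) (C' : Matrix (Fin b) (Fin a) ℂ) :
    Matrix (Fin b) (Fin b) ℂ := (C' * A')⁻¹ * (C' * A)

/-- The columns of `A` are combinations of those of `A'`, and `(C' * A')⁻¹ * C'` is a left inverse
of `A'` that recovers the coefficients. -/
theorem mul_transition {a b : ℕ} {A A' : Matrix (Fin a) (Fin b) ℂ}
    {C' : Matrix (Fin b) (Fin a) ℂ} (h : (C' * A').det ≠ 0)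
    (hr : LinearMap.range A.mulVecLin ≤ LinearMap.range A'.mulVecLin) :
    A' * transition A A' C' = A := by
  choose v hv using fun c : Fin b => hr ⟨Pi.single c 1, rfl⟩
  have hT : A' * (Matrix.of fun i c => v c i) = A := by
    ext i c
    have := congrFun (hv c) i
    simp only [Matrix.mulVecLin_apply, Matrix.mulVec_single_one] at this
    exact this
  have : transition A A' C' = Matrix.of fun i c => v c i := by
    rw [transition, ← hT, ← Matrix.mul_assoc C',
      Matrix.nonsing_inv_mul_cancel_left _ _ (isUnit_iff_ne_zero.2 h)]
  rw [this, hT]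

theorem det_transition_ne_zero {a b : ℕ} {A A' : Matrix (Fin a) (Fin b) ℂ}
    {C C' : Matrix (Fin b) (Fin a) ℂ} (h : (C * A).det ≠ 0) (h' : (C' * A').det ≠ 0)
    (hr : LinearMap.range A.mulVecLin ≤ LinearMap.range A'.mulVecLin) :
    (transition A A' C').det ≠ 0 := by
  rw [← mul_transition h' hr, ← Matrix.mul_assoc, Matrix.det_mul] at h
  exact right_ne_zero_of_mul h

/-- Both sides become `A` after multiplication by `A''`, which can be cancelled. -/
theorem transition_mul_transition {a b : ℕ} {A A' A'' : Matrix (Fin a) (Fin b) ℂ}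
    {C' C'' : Matrix (Fin b) (Fin a) ℂ} (h' : (C' * A').det ≠ 0) (h'' : (C'' * A'').det ≠ 0)
    (hr : LinearMap.range A.mulVecLin ≤ LinearMap.range A'.mulVecLin)
    (hr' : LinearMap.range A'.mulVecLin ≤ LinearMap.range A''.mulVecLin) :
    transition A' A'' C'' * transition A A' C' = transition A A'' C'' := by
  refine mul_left_cancel_of_det_ne_zero h'' ?_
  rw [← Matrix.mul_assoc, mul_transition h'' hr', mul_transition h' hr,
    mul_transition h'' (hr.trans hr')]

variable {n r : ℕ} {V : PSpace n → Submodule ℂ (Fin (n + 1) → ℂ)} {B : Set (PSpace n)} {k : ℕ}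
  {M : Matrix (Fin (n + 1)) (Fin (r + 1)) (MvPolynomial (Fin (n + 1)) ℂ)}
  {C : Matrix (Fin (r + 1)) (Fin (n + 1)) ℂ}

/-- The matrix of coordinates with respect to a frame, up to a scalar factor. -/
def coframe (M : Matrix (Fin (n + 1)) (Fin (r + 1)) (MvPolynomial (Fin (n + 1)) ℂ))
    (C : Matrix (Fin (r + 1)) (Fin (n + 1)) ℂ) :
    Matrix (Fin (r + 1)) (Fin (n + 1)) (MvPolynomial (Fin (n + 1)) ℂ) :=
  (framePoly M C).adjugate *
    (C.map MvPolynomial.C : Matrix (Fin (r + 1)) (Fin (n + 1)) (MvPolynomial (Fin (n + 1)) ℂ))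

theorem isHomogeneous_coframe (hM : ∀ b j, (M b j).IsHomogeneous k)
    (C : Matrix (Fin (r + 1)) (Fin (n + 1)) ℂ) (i : Fin (r + 1)) (j : Fin (n + 1)) :
    (coframe M C i j).IsHomogeneous (r * k) :=
  isHomogeneous_mul (isHomogeneous_adjugate (isHomogeneous_framePoly hM C))
    (fun i j => isHomogeneous_C (Fin (n + 1)) (C i j)) i j

theorem evalMatrix_adjugate_framePoly (x : Fin (n + 1) → ℂ) :
    evalMatrix (framePoly M C).adjugate x = (C * evalMatrix M x).adjugate := by
  rw [← framePoly_map]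
  exact RingHom.map_adjugate (eval x) _

theorem evalMatrix_coframe (x : Fin (n + 1) → ℂ) :
    evalMatrix (coframe M C) x = (C * evalMatrix M x).adjugate * C := by
  rw [← evalMatrix_adjugate_framePoly, coframe, evalMatrix, Matrix.map_mul]
  refine congrArg (_ * ·) ?_
  ext i j
  exact eval_C _

/-- The adjugate replaces the inverse to keep entries polynomial; the determinant, nonzero on
`frameDom`, disappears projectively. -/
theorem coframe_mulVec_mulVec (x : Fin (n + 1) → ℂ) (c : Fin (r + 1) → ℂ) :
    (evalMatrix (coframe M C) x).mulVec ((evalMatrix M x).mulVec c) =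
      (C * evalMatrix M x).det • c := by
  rw [evalMatrix_coframe, Matrix.mulVec_mulVec, Matrix.mul_assoc, Matrix.adjugate_mul,
    Matrix.smul_mulVec, Matrix.one_mulVec]

theorem mulVec_coframe_mulVec {x u : Fin (n + 1) → ℂ}
    (hu : u ∈ LinearMap.range (evalMatrix M x).mulVecLin) :
    (evalMatrix M x).mulVec ((evalMatrix (coframe M C) x).mulVec u) =
      (C * evalMatrix M x).det • u := by
  obtain ⟨c, rfl⟩ := hu
  rw [Matrix.mulVecLin_apply, coframe_mulVec_mulVec, Matrix.mulVec_smul]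

/-- The total space of the projectivization of a family of vector spaces. -/
def totalSpace (V : PSpace n → Submodule ℂ (Fin (n + 1) → ℂ)) (B : Set (PSpace n)) :
    Set (VProd (PSpace n) (PSpace n)) := {z | z.fst ∈ B ∧ z.snd.rep ∈ V z.fst}

theorem frame_mulVec_ne_zero {z : VProd (PSpace n) (PSpace r)} (hz : z.fst ∈ frameDom M C) :
    (evalMatrix M z.fst.rep).mulVec z.snd.rep ≠ 0 := by
  intro h0
  have h1 := coframe_mulVec_mulVec (M := M) (C := C) z.fst.rep z.snd.rep
  rw [h0, Matrix.mulVec_zero] at h1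
  exact smul_ne_zero hz z.snd.rep_nonzero h1.symm

namespace IsFrame

theorem coframe_mulVec_ne_zero (h : IsFrame V B k M C) {z : VProd (PSpace n) (PSpace n)}
    (hz : z ∈ totalSpace V B ∩ VProd.fst ⁻¹' frameDom M C) :
    (evalMatrix (coframe M C) z.fst.rep).mulVec z.snd.rep ≠ 0 := by
  intro h0
  have h1 := mulVec_coframe_mulVec (C := C) ((h.range z.fst hz.1.1 hz.2).symm ▸ hz.1.2 :
    z.snd.rep ∈ LinearMap.range (evalMatrix M z.fst.rep).mulVecLin)
  rw [h0, Matrix.mulVec_zero] at h1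
  exact smul_ne_zero hz.2 z.snd.rep_nonzero h1.symm

theorem isMorphismOn_coframe (h : IsFrame V B k M C) : IsMorphismOn (totalSpace V B ∩ VProd.fst ⁻¹' frameDom M C)
    {z | z.fst ∈ B ∩ frameDom M C} (bundleMap (coframe M C)) :=
  (isPolyMapOn_bundleMap (isHomogeneous_coframe h.homog C) fun _ hz =>
    h.coframe_mulVec_ne_zero hz).isMorphismOn fun _ hz => ⟨hz.1.1, hz.2⟩

theorem isMorphismOn_frame (h : IsFrame V B k M C) : IsMorphismOn {z : VProd (PSpace n) (PSpace r) |
    z.fst ∈ B ∩ frameDom M C} (totalSpace V B ∩ VProd.fst ⁻¹' frameDom M C) (bundleMap M) :=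
  (isPolyMapOn_bundleMap h.homog fun _ hz => frame_mulVec_ne_zero hz.2).isMorphismOn fun z hz => by
    refine ⟨⟨hz.1, ?_⟩, hz.2⟩
    obtain ⟨s, hs, e⟩ := PSpace.exists_rep_ofVec (frame_mulVec_ne_zero hz.2)
    change (PSpace.ofVec _).rep ∈ V z.fst
    rw [e, ← h.range z.fst hz.1 hz.2]
    exact Submodule.smul_mem _ _ ⟨_, rfl⟩

theorem leftInvOn (h : IsFrame V B k M C) : Set.LeftInvOn (bundleMap M) (bundleMap (coframe M C))
    (totalSpace V B ∩ VProd.fst ⁻¹' frameDom M C) := by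
  intro z hz
  obtain ⟨s, hs, e⟩ := PSpace.exists_rep_ofVec (h.coframe_mulVec_ne_zero hz)
  refine VProd.ext rfl (PSpace.ofVec_eq (mul_ne_zero hs hz.2) ?_)
  change (evalMatrix M z.fst.rep).mulVec (PSpace.ofVec _).rep = _
  rw [e, Matrix.mulVec_smul, mulVec_coframe_mulVec
    ((h.range z.fst hz.1.1 hz.2).symm ▸ hz.1.2), smul_smul]

theorem rightInvOn (_ : IsFrame V B k M C) : Set.LeftInvOn (bundleMap (coframe M C)) (bundleMap M)
    {z : VProd (PSpace n) (PSpace r) | z.fst ∈ B ∩ frameDom M C} := by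
  intro z hz
  obtain ⟨s, hs, e⟩ := PSpace.exists_rep_ofVec (frame_mulVec_ne_zero hz.2)
  refine VProd.ext rfl (PSpace.ofVec_eq (mul_ne_zero hs hz.2) ?_)
  change (evalMatrix (coframe M C) z.fst.rep).mulVec (PSpace.ofVec _).rep = _
  rw [e, Matrix.mulVec_smul, coframe_mulVec_mulVec, smul_smul]

/-- Over a local frame the total space is closed in the product. -/
theorem closure_inter_subset (h : IsFrame V B k M C) :
    closure (totalSpace V B ∩ VProd.fst ⁻¹' frameDom M C) ∩
      VProd.fst ⁻¹' (B ∩ frameDom M C) ⊆ totalSpace V B := by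
  rintro z ⟨hz, hzB, hzU⟩
  refine ⟨hzB, ?_⟩
  have key : (evalMatrix (M * coframe M C) z.fst.rep).mulVec z.snd.rep =
      (C * evalMatrix M z.fst.rep).det • z.snd.rep := by
    funext b
    -- `M * coframe M C` acts on the range of `M` as the determinant, so the rows of `A` give
    -- bihomogeneous equations of the total space, which persist on its closure. Where the
    -- determinant is nonzero, they put the vector back into the range.
    let A : Matrix (Fin (n + 1)) (Fin (n + 1)) (MvPolynomial (Fin (n + 1)) ℂ) :=
      M * coframe M C - (framePoly M C).det • 1
    have hA : ∀ i j, (A i j).IsHomogeneous (k + r * k) := by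
      intro i j
      refine (isHomogeneous_mul h.homog (isHomogeneous_coframe h.homog C) i j).sub ?_
      have h1 := isHomogeneous_det (isHomogeneous_framePoly h.homog C)
      have e : (r + 1) * k = k + r * k := by ring
      rw [e] at h1
      rw [Matrix.smul_apply, smul_eq_mul]
      by_cases hij : i = j
      · rw [hij, Matrix.one_apply_eq, mul_one]
        exact h1
      · rw [Matrix.one_apply_ne hij, mul_zero]
        exact isHomogeneous_zero _ _ _
    have hev : ∀ (x u : Fin (n + 1) → ℂ), (evalMatrix A x).mulVec u =
        (evalMatrix (M * coframe M C) x).mulVec u - (C * evalMatrix M x).det • u := by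
      intro x u
      have e : evalMatrix A x = evalMatrix (M * coframe M C) x -
          (C * evalMatrix M x).det • (1 : Matrix (Fin (n + 1)) (Fin (n + 1)) ℂ) := by
        ext i j
        rw [← eval_det_framePoly]
        change eval x (_ - _ * _) = _ - _ * _
        rw [map_sub, map_mul]
        refine congrArg₂ (· - ·) rfl (congrArg₂ (· * ·) rfl ?_)
        by_cases hij : i = j
        · rw [hij, Matrix.one_apply_eq, Matrix.one_apply_eq, map_one]
        · rw [Matrix.one_apply_ne hij, Matrix.one_apply_ne hij, map_zero]
      rw [e, Matrix.sub_mulVec, Matrix.smul_mulVec, Matrix.one_mulVec]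
    have hsub : closure (totalSpace V B ∩ VProd.fst ⁻¹' frameDom M C) ⊆
        {z | evalAt (Y := VProd (PSpace n) (PSpace n)) (bundlePoly A b) z = 0} := by
      refine closure_minimal (fun y hy => ?_)
        (isClosed_setOf_evalAt_eq_zero (isHomog_bundlePoly hA b))
      refine (evalAt_bundlePoly A b y).trans ?_
      rw [hev, evalMatrix, Matrix.map_mul, ← Matrix.mulVec_mulVec]
      rw [mulVec_coframe_mulVec ((h.range y.fst hy.1.1 hy.2).symm ▸ hy.1.2), sub_self]
      rfl
    have h0 := (evalAt_bundlePoly A b z).symm.trans (hsub hz)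
    rw [hev] at h0
    exact sub_eq_zero.1 h0
  rw [← h.range z.fst hzB hzU]
  rw [evalMatrix, Matrix.map_mul, ← Matrix.mulVec_mulVec] at key
  have h1 : z.snd.rep = (C * evalMatrix M z.fst.rep).det⁻¹ •
      ((C * evalMatrix M z.fst.rep).det • z.snd.rep) := by
    rw [smul_smul, inv_mul_cancel₀ hzU, one_smul]
  rw [h1, ← key]
  exact Submodule.smul_mem _ _ ⟨_, rfl⟩

end IsFrame

end Trivialization

/-! ### Transition matrices and the projective bundle. -/

section TotalSpace

open MvPolynomial Filter

variable {n r : ℕ} {V : PSpace n → Submodule ℂ (Fin (n + 1) → ℂ)} {B : Set (PSpace n)}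

/-- The change of frame, normalized so as not to depend on the choice of coordinates. -/
def normalizedTransition (k k' : ℕ)
    (M M' : Matrix (Fin (n + 1)) (Fin (r + 1)) (MvPolynomial (Fin (n + 1)) ℂ))
    (C' : Matrix (Fin (r + 1)) (Fin (n + 1)) ℂ) (q : PSpace n) :
    Matrix (Fin (r + 1)) (Fin (r + 1)) ℂ :=
  (q.rep 0 ^ k' / q.rep 0 ^ k) • transition (evalMatrix M q.rep) (evalMatrix M' q.rep) C'

/-- By Cramer's rule the inverse is the adjugate over the determinant; the powers of coordinate `0`
balance the degrees of numerator and denominator. -/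
theorem regularOn_normalizedTransition {k k' : ℕ}
    {M M' : Matrix (Fin (n + 1)) (Fin (r + 1)) (MvPolynomial (Fin (n + 1)) ℂ)}
    {C' : Matrix (Fin (r + 1)) (Fin (n + 1)) ℂ} (hM : ∀ b j, (M b j).IsHomogeneous k)
    (hM' : ∀ b j, (M' b j).IsHomogeneous k') {S : Set (PSpace n)} (hS : S ⊆ frameDom M' C')
    (hS0 : ∀ q ∈ S, q.rep 0 ≠ 0) (a b : Fin (r + 1)) :
    RegularOn S fun q => normalizedTransition k k' M M' C' q a b := by
  let N : MvPolynomial (Fin (n + 1)) ℂ :=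
    ((framePoly M' C').adjugate * framePoly M C') a b * X 0 ^ k'
  let D : MvPolynomial (Fin (n + 1)) ℂ := (framePoly M' C').det * X 0 ^ k
  have hN : N.IsHomogeneous (r * k' + k + 1 * k') :=
    (isHomogeneous_mul (isHomogeneous_adjugate (isHomogeneous_framePoly hM' C'))
      (isHomogeneous_framePoly hM C') a b).mul ((isHomogeneous_X ℂ 0).pow k')
  have hD : D.IsHomogeneous (r * k' + k + 1 * k') := by
    have h := (isHomogeneous_det (isHomogeneous_framePoly hM' C')).mul
      ((isHomogeneous_X ℂ (0 : Fin (n + 1))).pow k)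
    have e : (r + 1) * k' + 1 * k = r * k' + k + 1 * k' := by ring
    rwa [e] at h
  have hDv : ∀ q : PSpace n, evalAt (Y := PSpace n) D q =
      (C' * evalMatrix M' q.rep).det * q.rep 0 ^ k := by
    intro q
    rw [← eval_det_framePoly]
    change eval q.rep (_ * _) = _
    rw [map_mul, map_pow, eval_X]
  have hNv : ∀ q : PSpace n, evalAt (Y := PSpace n) N q =
      ((C' * evalMatrix M' q.rep).adjugate * (C' * evalMatrix M q.rep)) a b * q.rep 0 ^ k' := by
    intro q
    have e : eval q.rep (((framePoly M' C').adjugate * framePoly M C') a b) =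
        ((C' * evalMatrix M' q.rep).adjugate * (C' * evalMatrix M q.rep)) a b := by
      rw [← framePoly_map M, ← evalMatrix_adjugate_framePoly, evalMatrix, evalMatrix,
        ← Matrix.map_mul]
      rfl
    rw [← e]
    change eval q.rep (_ * _) = _
    rw [map_mul, map_pow, eval_X]
  refine (regularOn_div (Y := PSpace n) hN hD fun q hq => ?_).congr fun q hq => ?_
  · rw [hDv]
    exact mul_ne_zero (hS hq) (pow_ne_zero _ (hS0 q hq))
  · have h1 : (C' * evalMatrix M' q.rep).det ≠ 0 := hS hq
    have h2 := pow_ne_zero k (hS0 q hq)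
    change evalAt (Y := PSpace n) N q / evalAt (Y := PSpace n) D q = _
    rw [hDv, hNv, normalizedTransition, transition, Matrix.inv_def, Ring.inverse_eq_inv',
      Matrix.smul_mul, Matrix.smul_apply, Matrix.smul_apply, smul_eq_mul, smul_eq_mul]
    field_simp

theorem det_normalizedTransition_ne_zero {k k' : ℕ}
    {M M' : Matrix (Fin (n + 1)) (Fin (r + 1)) (MvPolynomial (Fin (n + 1)) ℂ)}
    {C C' : Matrix (Fin (r + 1)) (Fin (n + 1)) ℂ} (h : IsFrame V B k M C)
    (h' : IsFrame V B k' M' C') {q : PSpace n} (hq : q ∈ B) (hq0 : q.rep 0 ≠ 0)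
    (hM : q ∈ frameDom M C) (hM' : q ∈ frameDom M' C') :
    (normalizedTransition k k' M M' C' q).det ≠ 0 := by
  rw [normalizedTransition, Matrix.det_smul]
  exact mul_ne_zero (pow_ne_zero _ (div_ne_zero (pow_ne_zero _ hq0) (pow_ne_zero _ hq0)))
    (det_transition_ne_zero hM hM' ((h.range q hq hM).trans (h'.range q hq hM').symm).le)

/-- The projectivization of a family of vector spaces with local frames is a projective bundle. -/
theorem isProjectiveBundle_totalSpace (hB0 : ∀ q ∈ B, q.rep 0 ≠ 0)
    (hfr : ∀ p ∈ B, ∃ (k : ℕ)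
      (M : Matrix (Fin (n + 1)) (Fin (r + 1)) (MvPolynomial (Fin (n + 1)) ℂ))
      (C : Matrix (Fin (r + 1)) (Fin (n + 1)) ℂ), p ∈ frameDom M C ∧ IsFrame V B k M C) :
    IsProjectiveBundle r VProd.fst (totalSpace V B) B := by
  have hfr' : ∀ p : B, ∃ (k : ℕ)
      (M : Matrix (Fin (n + 1)) (Fin (r + 1)) (MvPolynomial (Fin (n + 1)) ℂ))
      (C : Matrix (Fin (r + 1)) (Fin (n + 1)) ℂ), p.1 ∈ frameDom M C ∧ IsFrame V B k M C :=
    fun p => hfr p.1 p.2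
  choose k M C hmem h using hfr'
  have hdet : ∀ (i j : B) (q : PSpace n), q ∈ B ∩ frameDom (M i) (C i) ∩ frameDom (M j) (C j) →
      (normalizedTransition (k i) (k j) (M i) (M j) (C j) q).det ≠ 0 := fun i j q hq =>
    det_normalizedTransition_ne_zero (h i) (h j) hq.1.1 (hB0 q hq.1.1) hq.1.2 hq.2
  have hrange : ∀ (i j : B) (q : PSpace n), q ∈ B → q ∈ frameDom (M i) (C i) →
      q ∈ frameDom (M j) (C j) → LinearMap.range (evalMatrix (M i) q.rep).mulVecLin ≤
        LinearMap.range (evalMatrix (M j) q.rep).mulVecLin := fun i j q hq hi hj =>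
    (((h i).range q hq hi).trans ((h j).range q hq hj).symm).le
  -- The default `1` only matters off the overlaps, where nothing is required.
  let A : B → B → PSpace n → GL (Fin (r + 1)) ℂ := fun i j q =>
    open Classical in
    if hd : (normalizedTransition (k i) (k j) (M i) (M j) (C j) q).det ≠ 0 then
      Matrix.GeneralLinearGroup.mkOfDetNeZero _ hd else 1
  have hA : ∀ (i j : B) (q : PSpace n), q ∈ B ∩ frameDom (M i) (C i) ∩ frameDom (M j) (C j) →
      (A i j q : Matrix (Fin (r + 1)) (Fin (r + 1)) ℂ) =
        normalizedTransition (k i) (k j) (M i) (M j) (C j) q := by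
    intro i j q hq
    change ((dite _ _ _ : GL (Fin (r + 1)) ℂ) : Matrix (Fin (r + 1)) (Fin (r + 1)) ℂ) = _
    rw [dif_pos (hdet i j q hq)]
    rfl
  refine ⟨(isPolyMapOn_fst _).isMorphismOn fun z hz => hz.1, B, fun i => frameDom (M i) (C i),
    fun i => bundleMap (coframe (M i) (C i)), A, fun i => isOpen_frameDom (h i).homog _,
    fun p hp => Set.mem_iUnion.2 ⟨⟨p, hp⟩, hmem ⟨p, hp⟩⟩,
    fun i => ⟨(h i).isMorphismOn_coframe, bundleMap (M i), (h i).isMorphismOn_frame,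
      (h i).leftInvOn, (h i).rightInvOn⟩, fun i e _ => rfl, ?_, ?_, ?_⟩
  · intro i j a b
    refine (regularOn_normalizedTransition (C' := C j) (h i).homog (h j).homog
      (fun q hq => hq.2) (fun q hq => hB0 q hq.1.1) a b).congr fun q hq => ?_
    exact (congrFun (congrFun (hA i j q hq) a) b).symm
  · rintro i j l q ⟨⟨⟨hq, hi⟩, hj⟩, hl⟩
    refine Units.ext ?_
    have hq0 := pow_ne_zero (k j) (hB0 q hq)
    refine (congrArg₂ (· * ·) (hA j l q ⟨⟨hq, hj⟩, hl⟩) (hA i j q ⟨⟨hq, hi⟩, hj⟩)).trans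
      (Eq.trans ?_ (hA i l q ⟨⟨hq, hi⟩, hl⟩).symm)
    simp only [normalizedTransition]
    rw [Matrix.smul_mul, Matrix.mul_smul, smul_smul, transition_mul_transition hj hl
      (hrange i j q hq hi hj) (hrange j l q hq hj hl), div_mul_div_cancel₀ hq0]
  · rintro i j e he ⟨hi, hj⟩
    obtain ⟨s, hs, hes⟩ := PSpace.exists_rep_ofVec ((h i).coframe_mulVec_ne_zero ⟨he, hi⟩)
    obtain ⟨t, ht, het⟩ := PSpace.exists_rep_ofVec ((h j).coframe_mulVec_ne_zero ⟨he, hj⟩)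
    have hu : ∀ i : B, e.fst ∈ frameDom (M i) (C i) →
        e.snd.rep ∈ LinearMap.range (evalMatrix (M i) e.fst.rep).mulVecLin := fun i hi =>
      ((h i).range e.fst he.1 hi).symm ▸ he.2
    have hdi : (C i * evalMatrix (M i) e.fst.rep).det ≠ 0 := hi
    have hdj : (C j * evalMatrix (M j) e.fst.rep).det ≠ 0 := hj
    have hq := hB0 e.fst he.1
    have hne : e.fst.rep 0 ^ k j / e.fst.rep 0 ^ k i ≠ 0 :=
      div_ne_zero (pow_ne_zero _ hq) (pow_ne_zero _ hq)
    -- Applying the injective matrix `M j` turns both sides into multiples of `e.snd.rep`; this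
    -- scalar is the ratio of the factors collected from the representatives, determinants and
    -- normalizing powers.
    refine ⟨t * (C j * evalMatrix (M j) e.fst.rep).det *
      (s * (C i * evalMatrix (M i) e.fst.rep).det *
        (e.fst.rep 0 ^ k j / e.fst.rep 0 ^ k i))⁻¹,
      mul_ne_zero (mul_ne_zero ht hdj) (inv_ne_zero (mul_ne_zero (mul_ne_zero hs hdi) hne)), ?_⟩
    refine mulVec_injective_of_det_ne_zero hdj ?_
    change (evalMatrix (M j) e.fst.rep).mulVec (PSpace.ofVec _).rep = (evalMatrix (M j) e.fst.rep).mulVec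
      (_ • Matrix.mulVec (A i j e.fst : Matrix (Fin (r + 1)) (Fin (r + 1)) ℂ) (PSpace.ofVec _).rep)
    rw [hA i j e.fst ⟨⟨he.1, hi⟩, hj⟩, normalizedTransition, hes, het, Matrix.mulVec_smul,
      mulVec_coframe_mulVec (hu j hj), Matrix.mulVec_smul, Matrix.smul_mulVec, Matrix.mulVec_smul,
      Matrix.mulVec_smul, Matrix.mulVec_smul, Matrix.mulVec_mulVec,
      mul_transition hdj (hrange i j e.fst he.1 hi hj), mulVec_coframe_mulVec (hu i hi)]
    simp only [smul_smul]
    congr 1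
    field_simp

end TotalSpace

/-! ### Irreducibility and dimension of the closure. -/

section TotalSpaceClosure

open MvPolynomial Filter

theorem isIrreducible_inter_isOpen {T : Type*} [TopologicalSpace T] {W U : Set T}
    (hW : IsIrreducible W) (hU : IsOpen U) (hne : (W ∩ U).Nonempty) : IsIrreducible (W ∩ U) := by
  refine ⟨hne, ?_⟩
  rintro G H hG hH ⟨x, ⟨hx, hxU⟩, hxG⟩ ⟨y, ⟨hy, hyU⟩, hyH⟩
  obtain ⟨z, hz, ⟨hzU, hzG⟩, -, hzH⟩ := hW.2 (U ∩ G) (U ∩ H) (hU.inter hG) (hU.inter hH)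
    ⟨x, hx, hxU, hxG⟩ ⟨y, hy, hyU, hyH⟩
  exact ⟨z, ⟨hz, hzU⟩, hzG, hzH⟩

theorem subset_closure_inter_isOpen {T : Type*} [TopologicalSpace T] {W U : Set T}
    (hW : IsIrreducible W) (hU : IsOpen U) (hne : (W ∩ U).Nonempty) : W ⊆ closure (W ∩ U) := by
  intro x hx
  rw [mem_closure_iff]
  intro G hG hxG
  obtain ⟨z, hz, hzG, hzU⟩ := hW.2 G U hG hU ⟨x, hx, hxG⟩ hne
  exact ⟨z, hzG, hz, hzU⟩

variable {n r : ℕ} {V : PSpace n → Submodule ℂ (Fin (n + 1) → ℂ)} {X O : Set (PSpace n)}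

/-- The family of vector spaces `V q`, `q ∈ B`, has local frames of length `r + 1`. -/
def HasFrames (r : ℕ) (V : PSpace n → Submodule ℂ (Fin (n + 1) → ℂ)) (B : Set (PSpace n)) : Prop :=
  ∀ p ∈ B, ∃ (k : ℕ) (M : Matrix (Fin (n + 1)) (Fin (r + 1)) (MvPolynomial (Fin (n + 1)) ℂ))
    (C : Matrix (Fin (r + 1)) (Fin (n + 1)) ℂ), p ∈ frameDom M C ∧ IsFrame V B k M C

/-- Closedness over `B` is local on `B`: the domain of a frame is open, and over it the total space
is given by equations. -/
theorem closure_totalSpace_inter {B : Set (PSpace n)} (h : HasFrames r V B) :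
    closure (totalSpace V B) ∩ VProd.fst ⁻¹' B = totalSpace V B := by
  refine Set.Subset.antisymm ?_ fun z hz => ⟨subset_closure hz, hz.1⟩
  rintro z ⟨hz, hzB⟩
  obtain ⟨k, M, C, hmem, hf⟩ := h z.fst hzB
  refine hf.closure_inter_subset ⟨?_, hzB, hmem⟩
  rw [Set.inter_comm]
  exact ((isOpen_frameDom hf.homog C).preimage VProd.continuous_fst).inter_closure ⟨hmem, hz⟩

section

variable {k : ℕ} {M : Matrix (Fin (n + 1)) (Fin (r + 1)) (MvPolynomial (Fin (n + 1)) ℂ)}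
  {C : Matrix (Fin (r + 1)) (Fin (n + 1)) ℂ}

theorem setOf_fst_mem_eq (U : Set (PSpace n)) : {z : VProd (PSpace n) (PSpace r) | z.fst ∈ X ∩ O ∩ U} =
    {z | z.fst ∈ X} ∩ VProd.fst ⁻¹' (O ∩ U) :=
  Set.ext fun _ => and_assoc

theorem IsFrame.image_eq {B : Set (PSpace n)} (h : IsFrame V B k M C) :
    bundleMap M '' {z | z.fst ∈ B ∩ frameDom M C} =
      totalSpace V B ∩ VProd.fst ⁻¹' frameDom M C :=
  Set.Subset.antisymm h.isMorphismOn_frame.mapsTo.image_subset fun _ hz =>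
    ⟨_, h.isMorphismOn_coframe.mapsTo hz, h.leftInvOn hz⟩

theorem IsFrame.coframe_image_eq {B : Set (PSpace n)} (h : IsFrame V B k M C) :
    bundleMap (coframe M C) '' (totalSpace V B ∩ VProd.fst ⁻¹' frameDom M C) =
      {z | z.fst ∈ B ∩ frameDom M C} :=
  Set.Subset.antisymm h.isMorphismOn_coframe.mapsTo.image_subset fun _ hz =>
    ⟨_, h.isMorphismOn_frame.mapsTo hz, h.rightInvOn hz⟩

theorem prod_inter_nonempty {U : Set (PSpace n)} (hne : (X ∩ O ∩ U).Nonempty) :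
    ({z : VProd (PSpace n) (PSpace r) | z.fst ∈ X} ∩ VProd.fst ⁻¹' (O ∩ U)).Nonempty := by
  obtain ⟨q, ⟨hqX, hqO⟩, hqU⟩ := hne
  exact ⟨⟨q, PSpace.ofVec 0⟩, hqX, hqO, hqU⟩

theorem IsFrame.isIrreducible (hX : IsIrreducible X) (hO : IsOpen O)
    (h : IsFrame V (X ∩ O) k M C) (hne : (X ∩ O ∩ frameDom M C).Nonempty) :
    IsIrreducible (totalSpace V (X ∩ O) ∩ VProd.fst ⁻¹' frameDom M C) := by
  rw [← h.image_eq]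
  refine IsIrreducible.image ?_ _ h.isMorphismOn_frame.continuousOn
  rw [setOf_fst_mem_eq]
  exact isIrreducible_inter_isOpen (isIrreducible_prod_univ hX r)
    ((hO.inter (isOpen_frameDom h.homog C)).preimage VProd.continuous_fst) (prod_inter_nonempty hne)

end

/-- The pieces over frame domains are irreducible, and two of them overlap because their domains
meet inside `X ∩ O`. Density moves a point of `G` from the first piece into the overlap, and
irreducibility of the second piece then produces a point of `G` and `H`. -/
theorem isIrreducible_totalSpace (hX : IsIrreducible X) (hO : IsOpen O)
    (h : HasFrames r V (X ∩ O)) (hne : (X ∩ O).Nonempty) :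
    IsIrreducible (totalSpace V (X ∩ O)) := by
  refine ⟨?_, ?_⟩
  · obtain ⟨p, hp⟩ := hne
    obtain ⟨k, M, C, hmem, hf⟩ := h p hp
    exact (hf.isIrreducible hX hO ⟨p, hp, hmem⟩).1.mono Set.inter_subset_left
  · rintro G H hG hH ⟨z, hz, hzG⟩ ⟨z', hz', hzH⟩
    obtain ⟨k, M, C, hmem, hf⟩ := h z.fst hz.1
    obtain ⟨k', M', C', hmem', hf'⟩ := h z'.fst hz'.1
    have hU := isOpen_frameDom hf.homog C
    have hU' := isOpen_frameDom hf'.homog C'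
    obtain ⟨q, hqX, ⟨hqO, hqU⟩, -, hqU'⟩ := hX.2 (O ∩ frameDom M C) (O ∩ frameDom M' C')
      (hO.inter hU) (hO.inter hU') ⟨z.fst, hz.1.1, hz.1.2, hmem⟩ ⟨z'.fst, hz'.1.1, hz'.1.2, hmem'⟩
    have hi := hf.isIrreducible hX hO ⟨q, ⟨hqX, hqO⟩, hqU⟩
    have hi' := hf'.isIrreducible hX hO ⟨q, ⟨hqX, hqO⟩, hqU'⟩
    -- `ofVec 0` is just some point of `ℙʳ`; its image over `q` shows that the overlap is nonempty.
    let e : VProd (PSpace n) (PSpace n) := bundleMap M ⟨q, PSpace.ofVec 0⟩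
    have he := hf.isMorphismOn_frame.mapsTo
      (show (⟨q, PSpace.ofVec 0⟩ : VProd (PSpace n) (PSpace r)) ∈
        {z : VProd (PSpace n) (PSpace r) | z.fst ∈ X ∩ O ∩ frameDom M C} from
          ⟨⟨hqX, hqO⟩, hqU⟩)
    obtain ⟨y, ⟨hy, hyU⟩, hyG, hyU'⟩ := hi.2 G _ hG (hU'.preimage VProd.continuous_fst)
      ⟨z, ⟨hz, hmem⟩, hzG⟩ ⟨e, he, hqU'⟩
    obtain ⟨x, ⟨hx, -⟩, hx'⟩ := hi'.2 G H hG hH ⟨y, ⟨hy, hyU'⟩, hyG⟩ ⟨z', ⟨hz', hmem'⟩, hzH⟩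
    exact ⟨x, hx, hx'⟩

/-- The dimension of the closure of the projectivization of a vector bundle. -/
theorem trdeg_ratFun_closure_totalSpace (hXc : IsClosed X) (hX : IsIrreducible X) (hO : IsOpen O)
    (h : HasFrames r V (X ∩ O)) (hne : (X ∩ O).Nonempty) :
    Algebra.trdeg ℂ (ratFun (closure (totalSpace V (X ∩ O)))) = Algebra.trdeg ℂ (ratFun X) + r := by
  have hE := isIrreducible_totalSpace hX hO h hne
  have hL := hE.closure
  have hW := isIrreducible_prod_univ hX r
  have hinter := closure_totalSpace_inter h
  obtain ⟨p, hp⟩ := hne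
  obtain ⟨k, M, C, hmem, hf⟩ := h p hp
  have hpU : (X ∩ O ∩ frameDom M C).Nonempty := ⟨p, hp, hmem⟩
  have hU := isOpen_frameDom hf.homog C
  have hOU : IsOpen (O ∩ frameDom M C) := hO.inter hU
  have hEne := (hf.isIrreducible hX hO hpU).1
  have hLX : closure (totalSpace V (X ∩ O)) ⊆ VProd.fst ⁻¹' X :=
    closure_minimal (fun z hz => hz.1.1) (hXc.preimage VProd.continuous_fst)
  have hLE : closure (totalSpace V (X ∩ O)) ∩ VProd.fst ⁻¹' (O ∩ frameDom M C) =
      totalSpace V (X ∩ O) ∩ VProd.fst ⁻¹' frameDom M C := by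
    refine Set.Subset.antisymm ?_ fun z hz => ⟨subset_closure hz.1, hz.1.1.2, hz.2⟩
    rintro z ⟨hz, hzO, hzU⟩
    exact ⟨hinter ▸ ⟨hz, hLX hz, hzO⟩, hzU⟩
  rw [← trdeg_ratFun_prod hX PSpace.exists_mem_chart r]
  -- Frame and coframe are inverse to each other on dense open parts of `X × ℙʳ` and of the closure;
  -- each is dominant and gives one inequality.
  refine le_antisymm ?_ ?_
  · refine (hf.isMorphismOn_frame.isGenericMap hW hL ?_
      (Set.inter_subset_left.trans subset_closure) ?_).trdeg_le hW hL
    · rw [setOf_fst_mem_eq]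
      exact inter_mem_genericFilter hW (hOU.preimage VProd.continuous_fst) (prod_inter_nonempty hpU)
    · have hsub : {z : VProd (PSpace n) (PSpace r) | z.fst ∈ X ∩ O ∩ frameDom M C} ⊆
          {z | z.fst ∈ X} := fun z hz => hz.1.1
      rw [Set.inter_eq_right.2 hsub, hf.image_eq]
      exact closure_minimal
        (subset_closure_inter_isOpen hE (hU.preimage VProd.continuous_fst) hEne) isClosed_closure
  · refine (hf.isMorphismOn_coframe.isGenericMap hL hW ?_ (fun z hz => hz.1.1) ?_).trdeg_le
      hL hW
    · rw [← hLE]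
      exact inter_mem_genericFilter hL (hOU.preimage VProd.continuous_fst) (hLE ▸ hEne)
    · rw [Set.inter_eq_right.2 (Set.inter_subset_left.trans subset_closure), hf.coframe_image_eq,
        setOf_fst_mem_eq]
      exact subset_closure_inter_isOpen hW (hOU.preimage VProd.continuous_fst) (prod_inter_nonempty hpU)

end TotalSpaceClosure

/-! ### Critical points in the generic fibres of the correspondence. -/

section LikelihoodCorrespondence

open Filter

variable {n : ℕ} {X : Set (PSpace n)}

theorem isClosed_likelihoodCorrespondence : IsClosed (likelihoodCorrespondence X) := isClosed_closure

/-- The dimension of `X` and the Zariski open subset of `X` over which the likelihood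
correspondence is a projective bundle. -/
theorem exists_hasFrames_criticalData (hclosed : IsClosed X) (hirr : IsIrreducible X)
    (hX : ¬ X ⊆ arrangement n) :
    ∃ d r : ℕ, d + r = n ∧ topologicalKrullDim X = d ∧ Algebra.trdeg ℂ (ratFun X) = d ∧
      ∃ O, IsOpen O ∧ (X ∩ O).Nonempty ∧ regLocus X \ arrangement n = X ∩ O ∧
        HasFrames r (criticalData X) (X ∩ O) := by
  obtain ⟨d, hdim, hd⟩ := exists_topologicalKrullDim_eq_trdeg PSpace.exists_mem_chart hclosed hirr
  have hne := regLocus_diff_nonempty hirr hdim hd hX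
  have hdn : d ≤ n := by
    obtain ⟨p, hp⟩ := hne
    have h1 := ((mem_regLocus_iff hdim).1 hp.1).2
    have h2 := Submodule.finrank_le (coneTangent X p)
    rw [Module.finrank_fin_fun, h1] at h2
    omega
  obtain ⟨r, rfl⟩ := Nat.exists_eq_add_of_le hdn
  obtain ⟨O, hO, hB⟩ := exists_isOpen_inter_eq hirr hdim hd rfl
  refine ⟨d, r, rfl, hdim, hd, O, hO, hB ▸ hne, hB, hB ▸ fun p hp => ?_⟩
  obtain ⟨k, M, C, h1, h2, -⟩ := exists_frame hirr hdim hd rfl hp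
  exact ⟨k, M, C, h1, h2⟩

theorem exists_isOpen_of_eventually {P : PSpace n → Prop}
    (h : ∀ᶠ u in genericFilter (Set.univ : Set (PSpace n)), P u) :
    ∃ U : Set (PSpace n), IsOpen U ∧ U.Nonempty ∧ ∀ u ∈ U, P u := by
  obtain ⟨U, hU, hne, hsub⟩ := (mem_genericFilter (PSpace.isIrreducible_univ n)).1 h
  rw [Set.univ_inter] at hne hsub
  exact ⟨U, hU, hne, fun u hu => hsub hu⟩

/-- The fibres of the likelihood correspondence over generic data, and the critical points. -/
theorem exists_hasDegree_and_eventually_encard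
    (hL : IsIrreducible (likelihoodCorrespondence X))
    (hdim : topologicalKrullDim (likelihoodCorrespondence X) = n)
    (hgen : ∀ᶠ z in genericFilter (likelihoodCorrespondence X), IsCritical X z.snd z.fst) :
    ∃ m : ℕ, HasDegree VProd.snd (likelihoodCorrespondence X) (Set.univ : Set (PSpace n)) m ∧
      ∀ᶠ u in genericFilter (Set.univ : Set (PSpace n)),
        {p | IsCritical X u p}.encard = m ∧
          (likelihoodCorrespondence X ∩ VProd.snd ⁻¹' {u}).Finite := by
  have huniv := PSpace.isIrreducible_univ n
  have hcharts := VProd.exists_mem_chart (PSpace.exists_mem_chart (n := n))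
    (PSpace.exists_mem_chart (n := n))
  have hmor : IsMorphismOn (Set.univ : Set (VProd (PSpace n) (PSpace n))) Set.univ VProd.snd :=
    (isPolyMapOn_snd _).isMorphismOn (Set.mapsTo_univ _ _)
  have hsub : ∀ u p, IsCritical X u p → (⟨p, u⟩ : VProd _ _) ∈ likelihoodCorrespondence X :=
    fun u p h => subset_closure (show _ ∈ {z : VProd (PSpace n) (PSpace n) |
      IsCritical X z.snd z.fst} from h)
  by_cases hd : (Set.univ : Set (PSpace n)) ⊆ closure (VProd.snd '' likelihoodCorrespondence X)
  · obtain ⟨m, hm, hcard⟩ := exists_rank_eq_and_encard_fiber PSpace.exists_mem_chart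
      PSpace.exists_mem_chart isClosed_likelihoodCorrespondence hL huniv hdim (PSpace.trdeg_ratFun_univ n) hd
    refine ⟨m, Or.inl ⟨hd, hm⟩, ?_⟩
    filter_upwards [hcard, eventually_forall_fiber hcharts hmor
      isClosed_likelihoodCorrespondence hL huniv hdim
      (PSpace.trdeg_ratFun_univ n) hgen] with u hu hfib
    -- Over a generic `u` all points of the fibre are critical, so the fibre counted by the degree
    -- is the set of critical points.
    have hset : {y | y ∈ likelihoodCorrespondence X ∧ y.snd = u} =
        (fun p => (⟨p, u⟩ : VProd (PSpace n) (PSpace n))) '' {p | IsCritical X u p} := by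
      ext y
      constructor
      · rintro ⟨hy, rfl⟩
        exact ⟨y.fst, hfib y hy rfl, rfl⟩
      · rintro ⟨p, hp, rfl⟩
        exact ⟨hsub u p hp, rfl⟩
    refine ⟨?_, Set.finite_of_encard_eq_coe hu⟩
    rw [← hu, hset, Function.Injective.encard_image fun p q h => congrArg VProd.fst h]
  -- If the image is not dense, a generic `u` avoids its closure: there are no critical points and
  -- the fibre is empty.
  · refine ⟨0, Or.inr ⟨hd, rfl⟩, ?_⟩
    obtain ⟨v, -, hv⟩ := Set.not_subset.1 hd
    filter_upwards [open_mem_genericFilter huniv isClosed_closure.isOpen_compl ⟨v, trivial, hv⟩]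
      with u hu
    have hempty : ∀ y ∈ likelihoodCorrespondence X, y.snd ≠ u := fun y hy h =>
      hu (subset_closure ⟨y, hy, h⟩)
    refine ⟨?_, ?_⟩
    · rw [Nat.cast_zero, Set.encard_eq_zero]
      exact Set.eq_empty_of_forall_notMem fun p hp => hempty _ (hsub u p hp) rfl
    · rw [Set.eq_empty_of_forall_notMem (s := likelihoodCorrespondence X ∩ VProd.snd ⁻¹' {u})
        fun y hy => hempty y hy.1 hy.2]
      exact Set.finite_empty

end LikelihoodCorrespondence

end LikelihoodGeometry

end

/-! ### The main theorem. -/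

open LikelihoodGeometry in
theorem mainTheorem1 (n : ℕ) (X : Set (PSpace n)) (hclosed : IsClosed X)
    (hirr : IsIrreducible X) (hX : ¬ X ⊆ arrangement n) :
    IsIrreducible (likelihoodCorrespondence X) ∧
    topologicalKrullDim (likelihoodCorrespondence X) = n ∧
    (∃ d r : ℕ, d + r = n ∧ topologicalKrullDim X = d ∧
      IsProjectiveBundle r VProd.fst
        (likelihoodCorrespondence X ∩ VProd.fst ⁻¹' (regLocus X \ arrangement n))
        (regLocus X \ arrangement n)) ∧
    (∃ U : Set (PSpace n), IsOpen U ∧ U.Nonempty ∧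
      ∀ u ∈ U, (likelihoodCorrespondence X ∩ VProd.snd ⁻¹' {u}).Finite) ∧
    (∃ m : ℕ, IsMLDegree X m ∧
      HasDegree VProd.snd (likelihoodCorrespondence X) (Set.univ : Set (PSpace n)) m) := by
  obtain ⟨d, r, hdr, hdim, hd, O, hO, hne, hB, hfr⟩ := exists_hasFrames_criticalData hclosed hirr hX
  -- Being critical is by definition membership of the data in `criticalData` over the base, so the
  -- universal family is the total space.
  have hset : likelihoodCorrespondence X = closure (totalSpace (criticalData X) (X ∩ O)) := by
    rw [← hB]
    rfl
  have hL : IsIrreducible (likelihoodCorrespondence X) :=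
    hset ▸ (isIrreducible_totalSpace hirr hO hfr hne).closure
  have hLdim : topologicalKrullDim (likelihoodCorrespondence X) = n := by
    obtain ⟨s, hs, hs'⟩ := exists_topologicalKrullDim_eq_trdeg
      (VProd.exists_mem_chart PSpace.exists_mem_chart PSpace.exists_mem_chart)
      isClosed_likelihoodCorrespondence hL
    have h := trdeg_ratFun_closure_totalSpace hclosed hirr hO hfr hne
    rw [← hset, hs', hd] at h
    have hsn : s = n := (by exact_mod_cast h : s = d + r).trans hdr
    rw [hs, hsn]
  have hinter : likelihoodCorrespondence X ∩ VProd.fst ⁻¹' (X ∩ O) =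
      totalSpace (criticalData X) (X ∩ O) := hset ▸ closure_totalSpace_inter hfr
  -- The closure adds no points over `O`, so the part of the correspondence there is nonempty, open
  -- and made of critical points.
  have hgen : ∀ᶠ z in genericFilter (likelihoodCorrespondence X), IsCritical X z.snd z.fst := by
    obtain ⟨z, hz⟩ := (isIrreducible_totalSpace hirr hO hfr hne).1
    have hLX : likelihoodCorrespondence X ⊆ VProd.fst ⁻¹' X :=
      closure_minimal (fun z hz => hz.1.1.1) (hclosed.preimage VProd.continuous_fst)
    filter_upwards [inter_mem_genericFilter hL (hO.preimage VProd.continuous_fst)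
      ⟨z, hset ▸ subset_closure hz, hz.1.2⟩] with y hy
    have hy' : y ∈ totalSpace (criticalData X) (X ∩ O) := hinter ▸ ⟨hy.1, hLX hy.1, hy.2⟩
    rw [← hB] at hy'
    exact hy'
  obtain ⟨m, hm, hev⟩ := exists_hasDegree_and_eventually_encard hL hLdim hgen
  refine ⟨hL, hLdim, ⟨d, r, hdr, hdim, ?_⟩, ?_, m, ?_, hm⟩
  · rw [hB, hinter]
    -- Off the arrangement coordinate `0` is nonzero, as the normalization of the transition
    -- matrices requires.
    exact isProjectiveBundle_totalSpace
      (fun q hq => (mem_compl_arrangement_iff.1 (hB.symm ▸ hq : q ∈ regLocus X \ _).2).1 0) hfr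
  · exact exists_isOpen_of_eventually (hev.mono fun u hu => hu.2)
  · exact exists_isOpen_of_eventually (hev.mono fun u hu => hu.1)
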